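/- All C\*-algebras are over $\mathbb{C}$. Let $\mathcal{K}$ be the C\*-algebra of compact operators on $\ell^2(\mathbb{N})$. For a C\*-algebra $B$ write $\mathcal{K}(B) = B \otimes \mathcal{K}$ for its stabilization (C\*-tensor product), $\mathcal{K}(\phi) = \phi \otimes \mathrm{id}_{\mathcal{K}}$ for a \*-homomorphism $\phi$, and $B^+$ for the unitization of $B$ (a unit is adjoined even if $B$ has one), with $\pi : B^+ \to \mathbb{C}$ the projection onto the scalars. *Operator $K_0$.* For unital $A$, let $V(A)$ be the set of projections in $A \otimes \mathcal{K}$ modulo the relation $P \sim Q$ iff $P = uQu^*$ for a unitary $u \in (A \otimes \mathcal{K})^+$; it is an abelian monoid under $[P] + [P'] = [Q + Q']$, where $Q \sim P$ and $Q' \sim P'$ are orthogonal. $K_0(A)$ is the universal (Grothendieck) group of $V(A)$; a unital \*-homomorphism $\phi : A \to B$ induces $K_0(\phi) : [P] \mapsto [\mathcal{K}(\phi)(P)]$. For a possibly non-unital C\*-algebra $B$, $K_0(B)$ is the kernel of $K_0(\pi) : K_0(B^+) \to K_0(\mathbb{C})$, and a \*-homomorphism $\phi$ acts through its unital extension $\phi^+$.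 Thus $K_0 \circ \mathcal{K}$ sends a unital algebra $A$ to $\ker\bigl(K_0((A \otimes \mathcal{K})^+) \to K_0(\mathbb{C})\bigr)$. *The functor $\tilde K_f$.* For a compact Hausdorff space $X$, $K(X)$ is the universal group of the monoid of isomorphism classes of complex vector bundles on $X$ under direct sum, contravariant by pullback. For unital $A$, let $S_f(A)$ be the category whose objects are the finite-dimensional commutative unital C\*-subalgebras $U \subseteq A$ (with the unit of $A$) and whose morphisms $U \to V$ are the maps $U \to V$ of the form $x \mapsto wxw^*$ with $w \in A$ unitary. The diagram $G_f(A)$ consists of the Gelfand spectra $\Sigma(U)$ and the maps $\Sigma(V) \to \Sigma(U)$ induced by these morphisms, and $$\tilde K_f(A) = \operatorname{colim}_{U \in S_f(A)} K(\Sigma(U)),$$ the colimit being taken in abelian groups. A unital \*-homomorphism $\phi : A \to B$ induces $\tilde K_f(\phi)$ through the functor $U \mapsto \phi(U)$ and the maps $K(\Sigma(U)) \to K(\Sigma(\phi(U)))$ coming from $\phi|_U : U \to \phi(U)$. For a possibly non-unital C\*-algebra $B$, $\tilde K_f(B)$ is the kernel of $\tilde K_f(\pi) : \tilde K_f(B^+)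 \to \tilde K_f(\mathbb{C})$, and \*-homomorphisms act through $\phi^+$. For a projection $P$ of a unital C\*-algebra $D$, let $[(P)] \in \tilde K_f(D)$ be the class of the vector bundle over $\Sigma(\mathbb{C}P + \mathbb{C}(1-P))$ which has rank one at the character $\chi$ with $\chi(P) = 1$ (if there is one) and rank zero at the character with $\chi(P) = 0$ (if there is one). **Theorem.** As functors from unital C\*-algebras and unital \*-homomorphisms to abelian groups, $$K_0 \circ \mathcal{K} \;\simeq\; K_0 \;\simeq\; \tilde K_f \circ \mathcal{K}.$$ That is: 1. there are group isomorphisms $\theta_A : K_0(A \otimes \mathcal{K}) \to K_0(A)$, for all unital C\*-algebras $A$, with $\theta_B \circ K_0(\mathcal{K}(\phi)) = K_0(\phi) \circ \theta_A$ for every unital \*-homomorphism $\phi : A \to B$; 2. there are group isomorphisms $\eta_A : K_0(A) \to \tilde K_f(A \otimes \mathcal{K})$, for all unital C\*-algebras $A$, with $\eta_B \circ K_0(\phi) = \tilde K_f(\mathcal{K}(\phi)) \circ \eta_A$ for every unital \*-homomorphism $\phi : A \to B$, and with $\eta_A([P] - [Q]) = [(P)] - [(Q)]$ for all projections $P, Q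 \in A \otimes \mathcal{K}$, where $[(P)], [(Q)]$ are formed in $\tilde K_f((A \otimes \mathcal{K})^+)$. -/

import Mathlib

open scoped TensorProduct InnerProductSpace
open UniformSpace (Completion)
open Filter Topology

universe u v w

noncomputable section

namespace OpK

/-! ### The C*-tensor product -/

section Tensor

variable (A : Type u) (B : Type v) [NonUnitalCStarAlgebra A] [NonUnitalCStarAlgebra B]

/-- The algebraic tensor product over `ℂ` of two C*-algebras, as a *-algebra. It is a separate type
because it carries the maximal C*-norm below. -/
def AlgTensor : Type (max u v) := A ⊗[ℂ] B

namespace AlgTensor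

instance : NonUnitalRing (AlgTensor A B) := inferInstanceAs (NonUnitalRing (A ⊗[ℂ] B))
instance : StarRing (AlgTensor A B) := inferInstanceAs (StarRing (A ⊗[ℂ] B))
instance : Module ℂ (AlgTensor A B) := inferInstanceAs (Module ℂ (A ⊗[ℂ] B))
instance : IsScalarTower ℂ (AlgTensor A B) (AlgTensor A B) :=
  inferInstanceAs (IsScalarTower ℂ (A ⊗[ℂ] B) (A ⊗[ℂ] B))
instance : SMulCommClass ℂ (AlgTensor A B) (AlgTensor A B) :=
  inferInstanceAs (SMulCommClass ℂ (A ⊗[ℂ] B) (A ⊗[ℂ] B))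
instance : StarModule ℂ (AlgTensor A B) := inferInstanceAs (StarModule ℂ (A ⊗[ℂ] B))

variable {A B}

/-- The elementary tensor `a ⊗ b`. -/
def tmul (a : A) (b : B) : AlgTensor A B := a ⊗ₜ[ℂ] b

theorem induction_on {motive : AlgTensor A B → Prop} (x : AlgTensor A B) (zero : motive 0)
    (tmul : ∀ a b, motive (tmul a b)) (add : ∀ x y, motive x → motive y → motive (x + y)) :
    motive x :=
  TensorProduct.induction_on (motive := motive) x zero tmul add

theorem tmul_mul_tmul (a a' : A) (b b' : B) :
    tmul a b * tmul a' b' = tmul (a * a') (b * b') :=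
  Algebra.TensorProduct.tmul_mul_tmul a a' b b'

theorem star_tmul (a : A) (b : B) : star (tmul a b) = tmul (star a) (star b) :=
  TensorProduct.star_tmul a b

theorem tmul_add (a : A) (b b' : B) : tmul a (b + b') = tmul a b + tmul a b' :=
  TensorProduct.tmul_add a b b'

theorem tmul_sub (a : A) (b b' : B) : tmul a (b - b') = tmul a b - tmul a b' :=
  TensorProduct.tmul_sub a b b'

variable (A B)

/-- The C*-seminorms on the algebraic tensor product that are bounded by `‖a‖ ‖b‖` on elementary
tensors. (For C*-algebras the last property holds for every C*-seminorm.) -/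
structure CStarSeminorm where
  toFun : AlgTensor A B → ℝ
  nonneg : ∀ x, 0 ≤ toFun x
  add_le : ∀ x y, toFun (x + y) ≤ toFun x + toFun y
  smul : ∀ (c : ℂ) x, toFun (c • x) = ‖c‖ * toFun x
  mul_le : ∀ x y, toFun (x * y) ≤ toFun x * toFun y
  star_mul_self : ∀ x, toFun (star x * x) = toFun x * toFun x
  tmul_le : ∀ a b, toFun (tmul a b) ≤ ‖a‖ * ‖b‖

variable {A B}

instance : Inhabited (CStarSeminorm A B) :=
  ⟨{ toFun := fun _ => 0
     nonneg := by simp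
     add_le := by simp
     smul := by simp
     mul_le := by simp
     star_mul_self := by simp
     tmul_le := fun a b => by positivity }⟩

theorem CStarSeminorm.zero (p : CStarSeminorm A B) : p.toFun 0 = 0 := by
  simpa using p.smul 0 0

theorem CStarSeminorm.neg (p : CStarSeminorm A B) (x) : p.toFun (-x) = p.toFun x := by
  simpa using p.smul (-1) x

theorem CStarSeminorm.star (p : CStarSeminorm A B) (x) : p.toFun (star x) = p.toFun x := by
  have key : ∀ x, p.toFun x ≤ p.toFun (Star.star x) := fun x => by
    rcases (p.nonneg x).eq_or_lt with h | h
    · rw [← h]; exact p.nonneg _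
    · have := p.mul_le (Star.star x) x
      rw [p.star_mul_self] at this
      exact le_of_mul_le_mul_right this h
  exact le_antisymm (by simpa using key (Star.star x)) (key x)

theorem CStarSeminorm.bddAbove (x : AlgTensor A B) :
    BddAbove (Set.range fun p : CStarSeminorm A B => p.toFun x) := by
  induction x using induction_on with
  | zero => exact ⟨0, by rintro _ ⟨p, rfl⟩; exact p.zero.le⟩
  | tmul a b => exact ⟨‖a‖ * ‖b‖, by rintro _ ⟨p, rfl⟩; exact p.tmul_le a b⟩
  | add x y hx hy =>
    obtain ⟨M, hM⟩ := hx
    obtain ⟨N, hN⟩ := hy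
    refine ⟨M + N, ?_⟩
    rintro _ ⟨p, rfl⟩
    exact (p.add_le x y).trans (add_le_add (hM ⟨p, rfl⟩) (hN ⟨p, rfl⟩))

/-- The maximal C*-norm on the algebraic tensor product. -/
def maxNorm (x : AlgTensor A B) : ℝ := ⨆ p : CStarSeminorm A B, p.toFun x

theorem le_maxNorm (p : CStarSeminorm A B) (x) : p.toFun x ≤ maxNorm x :=
  le_ciSup (CStarSeminorm.bddAbove x) p

theorem maxNorm_le {x : AlgTensor A B} {r : ℝ} (h : ∀ p : CStarSeminorm A B, p.toFun x ≤ r) :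
    maxNorm x ≤ r := ciSup_le h

theorem maxNorm_nonneg (x : AlgTensor A B) : 0 ≤ maxNorm x :=
  ((default : CStarSeminorm A B).nonneg x).trans (le_maxNorm _ x)

theorem maxNorm_smul_le (c : ℂ) (x : AlgTensor A B) : maxNorm (c • x) ≤ ‖c‖ * maxNorm x :=
  maxNorm_le fun p => by
    rw [p.smul]; exact mul_le_mul_of_nonneg_left (le_maxNorm p x) (norm_nonneg c)

/-- The maximal C*-norm as a seminorm of the additive group. -/
def maxSeminorm : AddGroupSeminorm (AlgTensor A B) where
  toFun := maxNorm
  map_zero' := le_antisymm (maxNorm_le fun p => p.zero.le) (maxNorm_nonneg _)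
  add_le' x y := maxNorm_le fun p => (p.add_le x y).trans
    (add_le_add (le_maxNorm p x) (le_maxNorm p y))
  neg' x := by simp only [maxNorm, CStarSeminorm.neg]

instance : NonUnitalSeminormedRing (AlgTensor A B) :=
  { (inferInstance : NonUnitalRing (AlgTensor A B)),
    (maxSeminorm (A := A) (B := B)).toSeminormedAddCommGroup with
    norm_mul_le := fun x y => maxNorm_le fun p => (p.mul_le x y).trans
      (mul_le_mul (le_maxNorm p x) (le_maxNorm p y) (p.nonneg y) (maxNorm_nonneg x)) }

theorem norm_def (x : AlgTensor A B) : ‖x‖ = maxNorm x := rfl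

instance : NormedSpace ℂ (AlgTensor A B) where
  norm_smul_le := maxNorm_smul_le

theorem norm_tmul_le (a : A) (b : B) : ‖tmul a b‖ ≤ ‖a‖ * ‖b‖ := maxNorm_le fun p => p.tmul_le a b

theorem norm_star (x : AlgTensor A B) : ‖star x‖ = ‖x‖ := by
  simp only [norm_def, maxNorm, CStarSeminorm.star]

theorem norm_mul_self_le (x : AlgTensor A B) : ‖x‖ * ‖x‖ ≤ ‖star x * x‖ := by
  have h0 := norm_nonneg (star x * x)
  have h1 : ‖x‖ ≤ √‖star x * x‖ := maxNorm_le fun p => by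
    refine Real.le_sqrt_of_sq_le ?_
    rw [sq, ← p.star_mul_self]
    exact le_maxNorm p _
  calc ‖x‖ * ‖x‖ ≤ √‖star x * x‖ * √‖star x * x‖ :=
        mul_le_mul h1 h1 (norm_nonneg x) (Real.sqrt_nonneg _)
    _ = _ := Real.mul_self_sqrt h0

end AlgTensor

/-- The (maximal) C*-tensor product of two C*-algebras: the completion of the algebraic tensor
product in the maximal C*-norm. If one of the factors is nuclear, as are the compact operators, this
is the only C*-tensor product. -/
def CTensor : Type (max u v) := Completion (AlgTensor A B)

namespace CTensor

instance : NormedAddCommGroup (CTensor A B) :=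
  inferInstanceAs (NormedAddCommGroup (Completion (AlgTensor A B)))
instance : CompleteSpace (CTensor A B) :=
  inferInstanceAs (CompleteSpace (Completion (AlgTensor A B)))

variable {A B}

/-- The canonical map from the algebraic tensor product. -/
def mk : AlgTensor A B →+ CTensor A B :=
  (Completion.toCompl : AlgTensor A B →+ Completion (AlgTensor A B))

theorem continuous_mk : Continuous (mk : AlgTensor A B → CTensor A B) :=
  Completion.continuous_coe _

theorem norm_mk (x : AlgTensor A B) : ‖mk x‖ = ‖x‖ := Completion.norm_coe x

theorem isDenseInducing_mk : IsDenseInducing (mk : AlgTensor A B → CTensor A B) :=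
  Completion.isDenseInducing_coe

@[elab_as_elim]
theorem induction_on {P : CTensor A B → Prop} (x : CTensor A B) (hp : IsClosed {x | P x})
    (ih : ∀ x, P (mk x)) : P x :=
  Completion.induction_on x hp ih

@[elab_as_elim]
theorem induction_on₂ {P : CTensor A B → CTensor A B → Prop} (x y : CTensor A B)
    (hp : IsClosed {z : CTensor A B × CTensor A B | P z.1 z.2}) (ih : ∀ x y, P (mk x) (mk y)) :
    P x y :=
  Completion.induction_on₂ x y hp ih

@[elab_as_elim]
theorem induction_on₃ {P : CTensor A B → CTensor A B → CTensor A B → Prop} (x y z : CTensor A B)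
    (hp : IsClosed {z : CTensor A B × CTensor A B × CTensor A B | P z.1 z.2.1 z.2.2})
    (ih : ∀ x y z, P (mk x) (mk y) (mk z)) : P x y z :=
  Completion.induction_on₃ x y z hp ih

instance : Mul (CTensor A B) :=
  ⟨fun x y => (isDenseInducing_mk.prodMap isDenseInducing_mk).extend
    (fun p : AlgTensor A B × AlgTensor A B => mk (p.1 * p.2)) (x, y)⟩

theorem mk_mul (x y : AlgTensor A B) : mk (x * y) = mk x * mk y :=
  ((isDenseInducing_mk.prodMap isDenseInducing_mk).extend_eq
    (continuous_mk.comp continuous_mul) (x, y)).symm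

instance : ContinuousMul (CTensor A B) where
  continuous_mul := by
    let m : AlgTensor A B →+ AlgTensor A B →+ CTensor A B :=
      (AddMonoidHom.mul : AlgTensor A B →+ AlgTensor A B →+ AlgTensor A B).compr₂
        (mk : AlgTensor A B →+ CTensor A B)
    have hm : Continuous fun p : AlgTensor A B × AlgTensor A B => m p.1 p.2 :=
      continuous_mk.comp continuous_mul
    have di : IsDenseInducing (Completion.toCompl : AlgTensor A B → Completion (AlgTensor A B)) :=
      Completion.isDenseInducing_coe
    exact di.extend_Z_bilin (φ := m) di hm

instance : Star (CTensor A B) := ⟨Completion.map star⟩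

theorem uniformContinuous_star_alg : UniformContinuous (star : AlgTensor A B → AlgTensor A B) :=
  (AddMonoidHomClass.isometry_of_norm (starAddEquiv : AlgTensor A B ≃+ AlgTensor A B)
    AlgTensor.norm_star).uniformContinuous

theorem mk_star (x : AlgTensor A B) : mk (star x) = star (mk x) :=
  (Completion.map_coe uniformContinuous_star_alg x).symm

instance : ContinuousStar (CTensor A B) := ⟨Completion.continuous_map⟩

instance : NonUnitalNormedRing (CTensor A B) where
  __ := (inferInstance : NormedAddCommGroup (CTensor A B))
  left_distrib x y z := by
    refine induction_on₃ x y z (isClosed_eq (by fun_prop) (by fun_prop)) fun x y z => ?_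
    simp only [← map_add, ← mk_mul, mul_add]
  right_distrib x y z := by
    refine induction_on₃ x y z (isClosed_eq (by fun_prop) (by fun_prop)) fun x y z => ?_
    simp only [← map_add, ← mk_mul, add_mul]
  zero_mul x := by
    refine induction_on x (isClosed_eq (by fun_prop) (by fun_prop)) fun x => ?_
    rw [← map_zero mk, ← mk_mul, zero_mul]
  mul_zero x := by
    refine induction_on x (isClosed_eq (by fun_prop) (by fun_prop)) fun x => ?_
    rw [← map_zero mk, ← mk_mul, mul_zero]
  mul_assoc x y z := by
    refine induction_on₃ x y z (isClosed_eq (by fun_prop) (by fun_prop)) fun x y z => ?_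
    simp only [← mk_mul, mul_assoc]
  norm_mul_le x y := by
    refine induction_on₂ x y (isClosed_le (by fun_prop) (by fun_prop)) fun x y => ?_
    rw [← mk_mul, norm_mk, norm_mk, norm_mk]
    exact norm_mul_le x y

instance : StarRing (CTensor A B) where
  star_involutive x := by
    refine induction_on x (isClosed_eq (by fun_prop) (by fun_prop)) fun x => ?_
    simp only [← mk_star, star_star]
  star_mul x y := by
    refine induction_on₂ x y (isClosed_eq (by fun_prop) (by fun_prop)) fun x y => ?_
    simp only [← mk_mul, ← mk_star, star_mul]
  star_add x y := by
    refine induction_on₂ x y (isClosed_eq (by fun_prop) (by fun_prop)) fun x y => ?_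
    simp only [← map_add, ← mk_star, star_add]

instance : CStarRing (CTensor A B) where
  norm_mul_self_le x := by
    refine induction_on x (isClosed_le (by fun_prop) (by fun_prop)) fun x => ?_
    rw [← mk_star, ← mk_mul, norm_mk, norm_mk]
    exact AlgTensor.norm_mul_self_le x

instance : Module ℂ (CTensor A B) := inferInstanceAs (Module ℂ (Completion (AlgTensor A B)))

instance : NormedSpace ℂ (CTensor A B) where
  norm_smul_le c x := norm_smul_le c (show Completion (AlgTensor A B) from x)

theorem mk_smul (c : ℂ) (x : AlgTensor A B) : mk (c • x) = c • mk x := Completion.coe_smul c x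

theorem continuous_smul' (c : ℂ) : Continuous fun x : CTensor A B => c • x :=
  continuous_const_smul c

instance : IsScalarTower ℂ (CTensor A B) (CTensor A B) where
  smul_assoc c x y := by
    simp only [smul_eq_mul]
    refine induction_on₂ x y (isClosed_eq
      (((continuous_smul' c).comp continuous_fst).mul continuous_snd)
      ((continuous_smul' c).comp (continuous_fst.mul continuous_snd))) fun x y => ?_
    simp only [← mk_mul, ← mk_smul, smul_mul_assoc]

instance : SMulCommClass ℂ (CTensor A B) (CTensor A B) where
  smul_comm c x y := by
    simp only [smul_eq_mul]
    refine induction_on₂ x y (isClosed_eq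
      ((continuous_smul' c).comp (continuous_fst.mul continuous_snd))
      (continuous_fst.mul ((continuous_smul' c).comp continuous_snd))) fun x y => ?_
    simp only [← mk_mul, ← mk_smul, mul_smul_comm]

instance : StarModule ℂ (CTensor A B) where
  star_smul c x := by
    refine induction_on x (isClosed_eq (continuous_star.comp (continuous_smul' c))
      ((continuous_smul' (star c)).comp continuous_star)) fun x => ?_
    simp only [← mk_star, ← mk_smul, star_smul]

instance : NonUnitalCStarAlgebra (CTensor A B) where

/-- The elementary tensor `a ⊗ b` in the C*-tensor product. -/
def tmul (a : A) (b : B) : CTensor A B := mk (AlgTensor.tmul a b)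

end CTensor

/-! ### Functoriality in the first factor -/

variable {A B}
variable {A' : Type w} [NonUnitalCStarAlgebra A']

namespace AlgTensor

/-- The linear map `φ ⊗ id` on the algebraic tensor product. -/
def mapLin (φ : A →⋆ₙₐ[ℂ] A') : AlgTensor A B →ₗ[ℂ] AlgTensor A' B :=
  TensorProduct.map (φ : A →ₗ[ℂ] A') (LinearMap.id : B →ₗ[ℂ] B)

theorem mapLin_tmul (φ : A →⋆ₙₐ[ℂ] A') (a : A) (b : B) : mapLin φ (tmul a b) = tmul (φ a) b := rfl

/-- The *-homomorphism `φ ⊗ id` on the algebraic tensor product. -/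
def map (φ : A →⋆ₙₐ[ℂ] A') : AlgTensor A B →⋆ₙₐ[ℂ] AlgTensor A' B where
  toFun := mapLin φ
  map_smul' c x := map_smul (mapLin φ) c x
  map_zero' := map_zero (mapLin φ)
  map_add' x y := map_add (mapLin φ) x y
  map_mul' x y := by
    induction x using induction_on with
    | zero => simp only [zero_mul, map_zero]
    | add x x' hx hx' => rw [add_mul, map_add, hx, hx', map_add, add_mul]
    | tmul a b =>
      induction y using induction_on with
      | zero => simp only [mul_zero, map_zero]
      | add y y' hy hy' => rw [mul_add, map_add, hy, hy', map_add, mul_add]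
      | tmul a' b' => simp only [tmul_mul_tmul, mapLin_tmul, map_mul]
  map_star' x := by
    induction x using induction_on with
    | zero => simp only [star_zero, map_zero]
    | add x x' hx hx' => rw [star_add, map_add, hx, hx', map_add, star_add]
    | tmul a b => simp only [star_tmul, mapLin_tmul, map_star]

theorem map_tmul (φ : A →⋆ₙₐ[ℂ] A') (a : A) (b : B) : map φ (tmul a b) = tmul (φ a) b := rfl

theorem norm_map_le (φ : A →⋆ₙₐ[ℂ] A') (x : AlgTensor A B) : ‖map φ x‖ ≤ ‖x‖ :=
  maxNorm_le fun p => le_maxNorm (A := A) (B := B)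
    { toFun := fun x => p.toFun (map φ x)
      nonneg := fun x => p.nonneg _
      add_le := fun x y => by rw [map_add]; exact p.add_le _ _
      smul := fun c x => by rw [map_smul]; exact p.smul _ _
      mul_le := fun x y => by rw [map_mul]; exact p.mul_le _ _
      star_mul_self := fun x => by rw [map_mul, map_star]; exact p.star_mul_self _
      tmul_le := fun a b => (p.tmul_le (φ a) b).trans
        (mul_le_mul_of_nonneg_right (NonUnitalStarAlgHom.norm_apply_le φ a) (norm_nonneg b)) } x

theorem uniformContinuous_map (φ : A →⋆ₙₐ[ℂ] A') :
    UniformContinuous (map φ : AlgTensor A B → AlgTensor A' B) :=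
  (AddMonoidHomClass.lipschitz_of_bound (map φ : AlgTensor A B →⋆ₙₐ[ℂ] AlgTensor A' B) 1
    fun x => by simpa using norm_map_le φ x).uniformContinuous

end AlgTensor

namespace CTensor

/-- The extension of `φ ⊗ id` to the C*-tensor product, as a function. -/
def mapFun (φ : A →⋆ₙₐ[ℂ] A') : CTensor A B → CTensor A' B :=
  Completion.map (AlgTensor.map φ : AlgTensor A B → AlgTensor A' B)

theorem continuous_mapFun (φ : A →⋆ₙₐ[ℂ] A') :
    Continuous (mapFun φ : CTensor A B → CTensor A' B) := Completion.continuous_map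

theorem mapFun_mk (φ : A →⋆ₙₐ[ℂ] A') (x : AlgTensor A B) :
    mapFun φ (mk x) = mk (AlgTensor.map φ x) :=
  Completion.map_coe (AlgTensor.uniformContinuous_map φ) x

/-- The *-homomorphism `φ ⊗ id` on the C*-tensor product. -/
def map (φ : A →⋆ₙₐ[ℂ] A') : CTensor A B →⋆ₙₐ[ℂ] CTensor A' B where
  toFun := mapFun φ
  map_smul' c x := by
    refine induction_on x (isClosed_eq ((continuous_mapFun φ).comp (continuous_smul' c))
      ((continuous_smul' c).comp (continuous_mapFun φ))) fun x => ?_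
    simp only [← mk_smul, mapFun_mk, map_smul, MonoidHom.id_apply]
  map_zero' := by rw [← map_zero mk, mapFun_mk, map_zero, map_zero]
  map_add' x y := by
    have h := continuous_mapFun (B := B) φ
    refine induction_on₂ x y (isClosed_eq (by fun_prop) (by fun_prop)) fun x y => ?_
    simp only [← map_add, mapFun_mk]
  map_mul' x y := by
    have h := continuous_mapFun (B := B) φ
    refine induction_on₂ x y (isClosed_eq (by fun_prop) (by fun_prop)) fun x y => ?_
    simp only [← mk_mul, mapFun_mk, map_mul]
  map_star' x := by
    have h := continuous_mapFun (B := B) φ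
    refine induction_on x (isClosed_eq (by fun_prop) (by fun_prop)) fun x => ?_
    simp only [← mk_star, mapFun_mk, map_star]

theorem map_mk (φ : A →⋆ₙₐ[ℂ] A') (x : AlgTensor A B) : map φ (mk x) = mk (AlgTensor.map φ x) :=
  mapFun_mk φ x

theorem map_id (x : CTensor A B) : map (NonUnitalStarAlgHom.id ℂ A) x = x := by
  refine induction_on x (isClosed_eq (continuous_mapFun _) continuous_id) fun x => ?_
  rw [map_mk]
  congr 1
  induction x using AlgTensor.induction_on with
  | zero => exact map_zero _
  | tmul a b => rfl
  | add x y hx hy => rw [map_add, hx, hy]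

theorem map_comp {A'' : Type*} [NonUnitalCStarAlgebra A''] (ψ : A' →⋆ₙₐ[ℂ] A'')
    (φ : A →⋆ₙₐ[ℂ] A') (x : CTensor A B) : map (ψ.comp φ) x = map ψ (map φ x) := by
  refine induction_on x (isClosed_eq (continuous_mapFun _)
    ((continuous_mapFun _).comp (continuous_mapFun _))) fun x => ?_
  rw [map_mk, map_mk, map_mk]
  congr 1
  induction x using AlgTensor.induction_on with
  | zero => simp only [map_zero]
  | tmul a b => rfl
  | add x y hx hy => rw [map_add, hx, hy, map_add, map_add]

end CTensor

end Tensor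

/-! ### Compact operators and stabilization -/

/-- The separable infinite-dimensional Hilbert space `ℓ²(ℕ)`. -/
abbrev Ell2 : Type := lp (fun _ : ℕ => ℂ) 2

/-- The standard orthonormal basis of `ℓ²(ℕ)`. -/
def ebasis : HilbertBasis ℕ ℂ Ell2 := HilbertBasis.ofRepr (LinearIsometryEquiv.refl ℂ Ell2)

/-- The projection onto the span of the first `n` basis vectors. -/
def trunc (n : ℕ) : Ell2 →L[ℂ] Ell2 :=
  ∑ i ∈ Finset.range n, InnerProductSpace.rankOne ℂ (ebasis i) (ebasis i)

/-- The partial isometry that moves the first `n` basis vectors to the next `n` ones. -/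
def shift (n : ℕ) : Ell2 →L[ℂ] Ell2 :=
  ∑ i ∈ Finset.range n, InnerProductSpace.rankOne ℂ (ebasis (n + i)) (ebasis i)

theorem rankOne_mul_rankOne (i j k l : ℕ) :
    InnerProductSpace.rankOne ℂ (ebasis i) (ebasis j) *
      InnerProductSpace.rankOne ℂ (ebasis k) (ebasis l) =
    if j = k then InnerProductSpace.rankOne ℂ (ebasis i) (ebasis l) else 0 := by
  rw [ContinuousLinearMap.mul_def, InnerProductSpace.rankOne_comp_rankOne,
    orthonormal_iff_ite.1 ebasis.orthonormal]
  split_ifs <;> simp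

theorem star_rankOne (i j : ℕ) :
    star (InnerProductSpace.rankOne ℂ (ebasis i) (ebasis j)) =
      InnerProductSpace.rankOne ℂ (ebasis j) (ebasis i) := by
  rw [ContinuousLinearMap.star_eq_adjoint, InnerProductSpace.adjoint_rankOne]

theorem star_trunc (n : ℕ) : star (trunc n) = trunc n := by
  simp only [trunc, star_sum, star_rankOne]

theorem trunc_mul_trunc (n : ℕ) : trunc n * trunc n = trunc n := by
  simp only [trunc, Finset.sum_mul_sum, rankOne_mul_rankOne, Finset.sum_ite_eq, Finset.mem_range]
  exact Finset.sum_congr rfl fun i hi => by simp [Finset.mem_range.1 hi]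

theorem trunc_mul_shift (n : ℕ) : trunc n * shift n = 0 := by
  simp only [trunc, shift, Finset.sum_mul_sum, rankOne_mul_rankOne]
  exact Finset.sum_eq_zero fun i hi => Finset.sum_eq_zero fun j hj => by
    rw [if_neg]; have := Finset.mem_range.1 hi; omega

theorem shift_mul_trunc (n : ℕ) : shift n * trunc n = shift n := by
  simp only [trunc, shift, Finset.sum_mul_sum, rankOne_mul_rankOne, Finset.sum_ite_eq,
    Finset.mem_range]
  exact Finset.sum_congr rfl fun i hi => by simp [Finset.mem_range.1 hi]

theorem star_shift_mul_shift (n : ℕ) : star (shift n) * shift n = trunc n := by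
  simp only [trunc, shift, star_sum, star_rankOne, Finset.sum_mul_sum, rankOne_mul_rankOne,
    add_right_inj, Finset.sum_ite_eq, Finset.mem_range]
  exact Finset.sum_congr rfl fun i hi => by simp [Finset.mem_range.1 hi]

theorem isCompactOperator_rankOne (x y : Ell2) :
    IsCompactOperator (InnerProductSpace.rankOne ℂ x y) := by
  have h : IsCompactOperator (innerSL ℂ y) := isCompactOperator_of_locallyCompactSpace_dom _
  exact h.clm_comp (ContinuousLinearMap.toSpanSingleton ℂ x)

theorem isCompactOperator_sum {ι : Type*} (s : Finset ι) (f : ι → Ell2 →L[ℂ] Ell2)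
    (hf : ∀ i ∈ s, IsCompactOperator (f i)) :
    IsCompactOperator (∑ i ∈ s, f i : Ell2 →L[ℂ] Ell2) :=
  Submodule.sum_mem (compactOperator (RingHom.id ℂ) Ell2 Ell2) hf

theorem isCompactOperator_trunc (n : ℕ) : IsCompactOperator (trunc n) :=
  isCompactOperator_sum _ _ fun _ _ => isCompactOperator_rankOne _ _

theorem isCompactOperator_shift (n : ℕ) : IsCompactOperator (shift n) :=
  isCompactOperator_sum _ _ fun _ _ => isCompactOperator_rankOne _ _

theorem norm_trunc_le (n : ℕ) : ‖trunc n‖ ≤ 1 :=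
  IsStarProjection.norm_le _ ⟨trunc_mul_trunc n, star_trunc n⟩

theorem tendsto_trunc_apply (x : Ell2) : Tendsto (fun n => trunc n x) atTop (𝓝 x) := by
  have := (ebasis.hasSum_repr x).tendsto_sum_nat
  refine this.congr fun n => ?_
  simp [trunc, HilbertBasis.repr_apply_apply]

theorem tendsto_trunc_mul {T : Ell2 →L[ℂ] Ell2} (hT : IsCompactOperator T) :
    Tendsto (fun n => trunc n * T) atTop (𝓝 T) := by
  rw [Metric.tendsto_atTop]
  intro ε hε
  obtain ⟨K, hK, hKS⟩ := hT.image_closedBall_subset_compact (f := (T : Ell2 →ₗ[ℂ] Ell2)) 1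
  obtain ⟨t, -, htf, ht⟩ := Metric.finite_approx_of_totallyBounded hK.totallyBounded
    (ε / 8) (by positivity)
  have h1 : ∀ᶠ n in atTop, ∀ y ∈ t, dist (trunc n y) y < ε / 8 :=
    (htf.eventually_all).2 fun y _ =>
      (Metric.tendsto_nhds.1 (tendsto_trunc_apply y)) _ (by positivity)
  obtain ⟨N, hN⟩ := eventually_atTop.1 h1
  refine ⟨N, fun n hn => ?_⟩
  rw [dist_eq_norm]
  refine lt_of_le_of_lt (ContinuousLinearMap.opNorm_le_of_unit_norm (𝕜 := ℂ) (by positivity :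
    0 ≤ ε / 2) fun x hx => ?_) (by linarith)
  have hx' : T x ∈ K := hKS ⟨x, by simp [hx], rfl⟩
  obtain ⟨y, hy, hxy⟩ := Set.mem_iUnion₂.1 (ht hx')
  rw [Metric.mem_ball] at hxy
  have h2 := hN n hn y hy
  have h3 : dist (trunc n (T x)) (trunc n y) ≤ dist (T x) y := by
    rw [dist_eq_norm, dist_eq_norm, ← map_sub]
    exact ((trunc n).le_opNorm _).trans (mul_le_of_le_one_left (norm_nonneg _) (norm_trunc_le n))
  have h4 : dist (trunc n (T x)) (T x) ≤ ε / 2 := by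
    have := dist_triangle4 (trunc n (T x)) (trunc n y) y (T x)
    rw [dist_comm y] at this
    linarith
  rwa [dist_eq_norm] at h4

theorem isCompactOperator_star {T : Ell2 →L[ℂ] Ell2} (hT : IsCompactOperator T) :
    IsCompactOperator (star T : Ell2 →L[ℂ] Ell2) := by
  have h := (tendsto_trunc_mul hT).star
  refine isCompactOperator_of_tendsto h (Eventually.of_forall fun n => ?_)
  rw [star_mul, star_trunc]
  exact (isCompactOperator_trunc n).clm_comp (star T)

/-- The C*-algebra of compact operators on `ℓ²(ℕ)`. -/
def Compacts : NonUnitalStarSubalgebra ℂ (Ell2 →L[ℂ] Ell2) where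
  carrier := {T | IsCompactOperator T}
  add_mem' hS hT := hS.add hT
  zero_mem' := isCompactOperator_zero
  mul_mem' {S _} _ hT := hT.clm_comp S
  smul_mem' c _ hT := hT.smul c
  star_mem' hT := isCompactOperator_star hT

instance : IsClosed (Compacts : Set (Ell2 →L[ℂ] Ell2)) := isClosed_setOfPred_isCompactOperator

/-- The stabilization `A ⊗ 𝒦` of a C*-algebra `A`. -/
abbrev Stab (A : Type u) [NonUnitalCStarAlgebra A] : Type u := CTensor A Compacts

/-- The effect of stabilization on morphisms, `φ ↦ φ ⊗ id`. -/
abbrev Stab.map {A : Type u} {B : Type v} [NonUnitalCStarAlgebra A] [NonUnitalCStarAlgebra B]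
    (φ : A →⋆ₙₐ[ℂ] B) : Stab A →⋆ₙₐ[ℂ] Stab B := CTensor.map φ

/-! ### Unitary equivalence of projections -/

section Unital

variable {D : Type u} [CStarAlgebra D]

theorem exists_unitary_of_isUnit {T p : D} (hT : IsUnit T)
    (hp : Commute p (star T * T)) :
    ∃ c : D, Commute p c ∧ T * c ∈ unitary D := by
  let _ := CStarAlgebra.spectralOrder D
  have _ := CStarAlgebra.spectralOrderedRing D
  have hpos : IsStrictlyPositive (star T * T) :=
    IsStrictlyPositive.iff_of_unital.2 ⟨star_mul_self_nonneg T, hT.star.mul hT⟩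
  set h := star T * T with hh
  set c := h ^ (-(1 / 2) : ℝ) with hc
  have hcs : star c = c := (CFC.rpow_nonneg (a := h) (y := -(1 / 2))).isSelfAdjoint
  have hcu : IsUnit c := (CFC.isUnit_rpow_iff h (-(1 / 2)) (by norm_num) hpos.nonneg).2 hpos.isUnit
  have hpc : Commute h c := by
    rw [hc, CFC.rpow_def]
    exact (Commute.cfc_nnreal (Commute.refl h) _).symm
  have hchc : c * h * c = 1 := by
    have h1 : c * c = h ^ (-1 : ℝ) := by
      rw [hc, ← CFC.rpow_add hpos.isUnit]; norm_num
    have h2 : h ^ (-1 : ℝ) * h = 1 := by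
      have := CFC.rpow_neg_mul_rpow (a := h) 1 hpos
      rwa [CFC.rpow_one h hpos.nonneg] at this
    rw [mul_assoc, hpc.eq, ← mul_assoc, h1, h2]
  refine ⟨c, ?_, ?_⟩
  · rw [hc, CFC.rpow_def]
    exact (Commute.cfc_nnreal hp.symm _).symm
  · have h1 : star (T * c) * (T * c) = 1 := by
      rw [star_mul, hcs]
      calc c * star T * (T * c) = c * (star T * T) * c := by simp only [mul_assoc]
        _ = 1 := hchc
    refine Unitary.mem_iff.2 ⟨h1, ?_⟩
    obtain ⟨U, hU⟩ := hT.mul hcu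
    rw [← hU] at h1 ⊢
    have : star (U : D) = ↑U⁻¹ := by
      rw [← mul_one (star (U : D)), ← U.mul_inv, ← mul_assoc, h1, one_mul]
    rw [this, U.mul_inv]

theorem norm_one_le : ‖(1 : D)‖ ≤ 1 := IsStarProjection.norm_le _ (.one D)

/-- A projection that is almost below the projection `e` is unitarily equivalent to one below `e`. -/
theorem exists_unitary_le {p e : D} (hp : IsStarProjection p) (he : IsStarProjection e)
    (hpe : ‖p - e * p‖ ≤ 1 / 4) : ∃ u ∈ unitary D, e * (u * p * star u) = u * p * star u := by
  have hpp : p * p = p := hp.isIdempotentElem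
  have hps : star p = p := hp.isSelfAdjoint
  have hee : e * e = e := he.isIdempotentElem
  set d := p - e * p with hd
  have hdp : d * p = d := by rw [hd, sub_mul, mul_assoc, hpp]
  have hd1 : ‖d‖ < 1 := hpe.trans_lt (by norm_num)
  set z : Dˣ := Units.oneSub d hd1 with hz
  have hzv : (z : D) = 1 - d := rfl
  have hzp : (z : D) * p = e * p := by rw [hzv, sub_mul, one_mul, hdp, hd, sub_sub_cancel]
  set y : D := ((z⁻¹ : Dˣ) : D) with hy
  have hyz : y * z = 1 := z.inv_mul
  have hy1 : y - 1 = y * d := by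
    have : y * (1 - d) = 1 := hyz
    rw [mul_sub, mul_one] at this
    rw [← this]; abel
  have hyn : ‖y - 1‖ ≤ 1 / 3 := by
    have h1 : ‖y‖ ≤ 1 + ‖y - 1‖ := by
      have := norm_add_le (1 : D) (y - 1)
      rw [add_sub_cancel] at this
      linarith [norm_one_le (D := D)]
    have h2 : ‖y - 1‖ ≤ ‖y‖ * (1 / 4) := by
      rw [hy1]; exact (norm_mul_le _ _).trans (mul_le_mul_of_nonneg_left hpe (norm_nonneg _))
    linarith
  set T : D := z * p + star y * (1 - p) with hT
  have hTp : T * p = e * p := by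
    rw [hT, add_mul, mul_assoc, hpp, mul_assoc, sub_mul, hpp, one_mul, sub_self, mul_zero,
      add_zero, hzp]
  have hTu : IsUnit T := by
    have h1 : 1 - T = d - (star y - 1) * (1 - p) := by
      rw [hT, hzv, sub_mul, hdp]; noncomm_ring
    have h2 : ‖1 - T‖ < 1 := by
      rw [h1]
      have h3 : ‖(star y - 1) * (1 - p)‖ ≤ 1 / 3 := by
        refine (norm_mul_le _ _).trans ?_
        have h4 : ‖star y - 1‖ ≤ 1 / 3 := by
          rw [← norm_star, star_sub, star_star, star_one]; exact hyn
        have h5 : ‖1 - p‖ ≤ 1 := IsStarProjection.norm_le _ hp.one_sub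
        nlinarith [norm_nonneg (star y - 1), norm_nonneg (1 - p)]
      linarith [norm_sub_le d ((star y - 1) * (1 - p))]
    have := (Units.oneSub (1 - T) h2).isUnit
    simpa using this
  have hTT : star T * T = p * star (z : D) * z * p + (1 - p) * y * star y * (1 - p) := by
    have h1 : star (z : D) * star y = 1 := by rw [← star_mul, hyz, star_one]
    have h2 : star T = p * star (z : D) + (1 - p) * y := by
      rw [hT, star_add, star_mul, star_mul, hps, star_star, star_sub, star_one, hps]
    have h3 : p * (1 - p) = 0 := by rw [mul_sub, mul_one, hpp, sub_self]
    have h4 : (1 - p) * p = 0 := by rw [sub_mul, one_mul, hpp, sub_self]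
    calc star T * T = p * star (z : D) * z * p + p * (star (z : D) * star y) * (1 - p)
          + (1 - p) * (y * z) * p + (1 - p) * y * star y * (1 - p) := by
            rw [h2, hT]; simp only [add_mul, mul_add, mul_assoc]; abel
      _ = _ := by rw [h1, hyz, mul_one, mul_one, h3, h4, add_zero, add_zero]
  have hcomm : Commute p (star T * T) := by
    have h3 : p * (1 - p) = 0 := by rw [mul_sub, mul_one, hpp, sub_self]
    have h4 : (1 - p) * p = 0 := by rw [sub_mul, one_mul, hpp, sub_self]
    show p * (star T * T) = star T * T * p
    rw [hTT, mul_add, add_mul]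
    simp only [mul_assoc, hpp, h4, mul_zero, add_zero]
    simp only [← mul_assoc, hpp, h3, zero_mul, add_zero]
  obtain ⟨c, hpc, hu⟩ := exists_unitary_of_isUnit hTu hcomm
  refine ⟨T * c, hu, ?_⟩
  have h1 : T * c * p = e * p * c := by rw [mul_assoc, ← hpc.eq, ← mul_assoc, hTp]
  rw [h1]
  simp only [← mul_assoc, hee]

/-- A partial isometry between orthogonal projections is implemented by a unitary. -/
theorem exists_unitary_swap {e s : D} (hs : star s * s = e) (hse : s * e = s) (hes : e * s = 0) :
    ∃ u ∈ unitary D, ∀ x, e * x = x → x * e = x → u * x * star u = s * x * star s := by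
  have he : star e = e := by rw [← hs, star_mul, star_star]
  have hee : e * e = e := by nth_rw 1 [← hs]; rw [mul_assoc, hse, hs]
  have hss : s * s = 0 := by nth_rw 1 [← hse]; rw [mul_assoc, hes, mul_zero]
  have hse' : star s * e = 0 := by rw [← he, ← star_mul, hes, star_zero]
  have hes' : e * star s = star s := by rw [← he, ← star_mul, hse]
  have hss' : star s * star s = 0 := by rw [← star_mul, hss, star_zero]
  have a1 : ∀ x, star s * (s * x) = e * x := fun x => by rw [← mul_assoc, hs]
  have a3 : ∀ x, e * (s * x) = 0 := fun x => by rw [← mul_assoc, hes, zero_mul]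
  have a4 : ∀ x, s * (s * x) = 0 := fun x => by rw [← mul_assoc, hss, zero_mul]
  have a5 : ∀ x, star s * (e * x) = 0 := fun x => by rw [← mul_assoc, hse', zero_mul]
  set w : D := 1 - e - s * star s + s + star s with hw
  have hws : star w = w := by
    simp only [hw, star_add, star_sub, star_one, he, star_mul, star_star]; abel
  have hww : w * w = 1 := by
    simp only [hw, add_mul, mul_add, sub_mul, mul_sub, one_mul, mul_one, mul_assoc, hs, hse, hes,
      hee, hss, hse', hes', hss', a1, a3, a4, mul_zero]
    abel
  refine ⟨w, Unitary.mem_iff.2 ⟨by rw [hws, hww], by rw [hws, hww]⟩, fun x hx hx' => ?_⟩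
  have b1 : w * x = s * x := by
    have : star s * x = 0 := by rw [← hx, a5]
    simp only [hw, add_mul, sub_mul, one_mul, mul_assoc, this, hx, mul_zero]
    abel
  have b2 : x * star w = x * star s := by
    have : x * s = 0 := by rw [← hx', mul_assoc, hes, mul_zero]
    rw [hws]
    simp only [hw, mul_add, mul_sub, mul_one, ← mul_assoc, this, hx', zero_mul]
    abel
  rw [b1, mul_assoc, b2, mul_assoc]

end Unital

/-- The projections of a C*-algebra. -/
abbrev Proj (B : Type u) [NonUnitalCStarAlgebra B] : Type u := {p : B // IsStarProjection p}

section Equivalence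

variable {B : Type u} [NonUnitalCStarAlgebra B]

/-- Two projections of `B` are unitarily equivalent if they are conjugate by a unitary of the
unitization of `B`. -/
def UEquiv (p q : Proj B) : Prop :=
  ∃ w ∈ unitary (Unitization ℂ B),
    ((p : B) : Unitization ℂ B) = w * ((q : B) : Unitization ℂ B) * star w

theorem UEquiv.refl (p : Proj B) : UEquiv p p := ⟨1, one_mem _, by simp⟩

theorem UEquiv.symm {p q : Proj B} (h : UEquiv p q) : UEquiv q p := by
  obtain ⟨w, hw, h⟩ := h
  refine ⟨star w, Unitary.star_mem hw, ?_⟩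
  rw [h, star_star, ← mul_assoc, ← mul_assoc, Unitary.star_mul_self_of_mem hw, one_mul, mul_assoc,
    Unitary.star_mul_self_of_mem hw, mul_one]

theorem UEquiv.trans {p q r : Proj B} (h : UEquiv p q) (h' : UEquiv q r) : UEquiv p r := by
  obtain ⟨w, hw, h⟩ := h
  obtain ⟨w', hw', h'⟩ := h'
  exact ⟨w * w', mul_mem hw hw', by rw [h, h', star_mul]; simp only [mul_assoc]⟩

variable (B) in
/-- Unitary equivalence as a setoid. -/
def projSetoid : Setoid (Proj B) := ⟨UEquiv, UEquiv.refl, UEquiv.symm, UEquiv.trans⟩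

/-- The sum of two orthogonal projections. -/
def Proj.add (p q : Proj B) (h : (p : B) * q = 0) : Proj B :=
  ⟨p + q, p.2.add q.2 h⟩

theorem Proj.mul_comm_zero {p q : Proj B} (h : (p : B) * q = 0) : (q : B) * p = 0 := by
  have := congrArg star h
  rwa [star_mul, star_zero, p.2.isSelfAdjoint.star_eq, q.2.isSelfAdjoint.star_eq] at this

theorem isStarProjection_inr {b : B} :
    IsStarProjection (b : Unitization ℂ B) ↔ IsStarProjection b := by
  simp only [isStarProjection_iff', ← Unitization.inr_mul, ← Unitization.inr_star,
    Unitization.inr_injective.eq_iff]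

/-- The conjugate of a projection by a unitary of the unitization is a projection. -/
theorem exists_conj (p : Proj B) {w : Unitization ℂ B} (hw : w ∈ unitary (Unitization ℂ B)) :
    ∃ q : Proj B, ((q : B) : Unitization ℂ B) = w * ((p : B) : Unitization ℂ B) * star w := by
  obtain ⟨b, hb⟩ : ∃ b : B, (b : Unitization ℂ B) = w * ((p : B) : Unitization ℂ B) * star w :=
    ⟨_, Unitization.ext (by simp) rfl⟩
  refine ⟨⟨b, isStarProjection_inr.1 ?_⟩, hb⟩
  rw [hb]
  have hp := isStarProjection_inr.2 p.2
  constructor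
  · show _ * _ = _
    calc w * ((p : B) : Unitization ℂ B) * star w * (w * ((p : B) : Unitization ℂ B) * star w)
        = w * ((p : B) : Unitization ℂ B) * (star w * w) * ((p : B) : Unitization ℂ B) * star w := by
          simp only [mul_assoc]
      _ = _ := by
          rw [Unitary.star_mul_self_of_mem hw, mul_one, mul_assoc w, hp.isIdempotentElem.eq]
  · show star _ = _
    rw [star_mul, star_mul, star_star, hp.isSelfAdjoint.star_eq, mul_assoc]

variable (B) in
/-- There is enough room in `B` to move projections away from each other: any two elements are
almost fixed by a projection `e` that is equivalent to a projection orthogonal to `e`. This holds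
for stable C*-algebras. -/
def HasRoom : Prop :=
  ∀ b c : B, ∀ ε > 0, ∃ e s : B, star s * s = e ∧ s * e = s ∧ e * s = 0 ∧
    ‖b - e * b‖ ≤ ε ∧ ‖c - e * c‖ ≤ ε

/-- Two projections in a common corner, up to unitary equivalence. -/
theorem HasRoom.exists_corner (hB : HasRoom B) (p q : Proj B) :
    ∃ e s : Unitization ℂ B, star s * s = e ∧ s * e = s ∧ e * s = 0 ∧ s.fst = 0 ∧
    ∃ u ∈ unitary (Unitization ℂ B), ∃ w ∈ unitary (Unitization ℂ B),
      e * (u * ((p : B) : Unitization ℂ B) * star u) =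
        u * ((p : B) : Unitization ℂ B) * star u ∧
      e * (w * ((q : B) : Unitization ℂ B) * star w) =
        w * ((q : B) : Unitization ℂ B) * star w := by
  obtain ⟨e, s, h1, h2, h3, h4, h5⟩ := hB p q (1 / 4) (by norm_num)
  have he : IsStarProjection e := by
    have hs : star e = e := by rw [← h1, star_mul, star_star]
    refine ⟨?_, hs⟩
    show e * e = e
    nth_rw 1 [← h1]; rw [mul_assoc, h2, h1]
  have he' := isStarProjection_inr.2 he
  obtain ⟨u, hu, hu'⟩ := exists_unitary_le (isStarProjection_inr.2 p.2) he'
    (by rw [← Unitization.inr_mul, ← Unitization.inr_sub, Unitization.norm_inr]; exact h4)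
  obtain ⟨w, hw, hw'⟩ := exists_unitary_le (isStarProjection_inr.2 q.2) he'
    (by rw [← Unitization.inr_mul, ← Unitization.inr_sub, Unitization.norm_inr]; exact h5)
  refine ⟨e, s, ?_, ?_, ?_, by simp, u, hu, w, hw, hu', hw'⟩
  · rw [← h1]; simp
  · rw [← Unitization.inr_mul, h2]
  · rw [← Unitization.inr_mul, h3, Unitization.inr_zero]

theorem HasRoom.exists_orthogonal (hB : HasRoom B) (p q : Proj B) :
    ∃ r : Proj B, UEquiv p r ∧ (q : B) * r = 0 := by
  obtain ⟨e, s, h1, h2, h3, -, u, hu, w, hw, hp, hq⟩ := hB.exists_corner p q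
  obtain ⟨x, hx, hsw⟩ := exists_unitary_swap h1 h2 h3
  set P : Unitization ℂ B := ((p : B) : Unitization ℂ B) with hP
  set Q : Unitization ℂ B := ((q : B) : Unitization ℂ B) with hQ
  have hPs : star P = P := (isStarProjection_inr.2 p.2).isSelfAdjoint
  have hQs : star Q = Q := (isStarProjection_inr.2 q.2).isSelfAdjoint
  have hes : star e = e := by rw [← h1, star_mul, star_star]
  have hp' : u * P * star u * e = u * P * star u := by
    have := congrArg star hp
    simpa only [star_mul, star_star, hPs, hes, mul_assoc] using this
  have hq' : w * Q * star w * e = w * Q * star w := by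
    have := congrArg star hq
    simpa only [star_mul, star_star, hQs, hes, mul_assoc] using this
  have hv : star w * x * u ∈ unitary (Unitization ℂ B) :=
    mul_mem (mul_mem (Unitary.star_mem hw) hx) hu
  obtain ⟨r, hr⟩ := exists_conj p hv
  refine ⟨r, UEquiv.symm ⟨_, hv, hr⟩, ?_⟩
  have key := hsw _ hp hp'
  apply Unitization.inr_injective (R := ℂ)
  rw [Unitization.inr_mul, hr, Unitization.inr_zero]
  have h0 : w * Q * star w * (s * (u * P * star u) * star s) = 0 := by
    rw [← hq']
    calc w * Q * star w * e * (s * (u * P * star u) * star s)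
        = w * Q * star w * (e * s) * (u * P * star u) * star s := by simp only [mul_assoc]
      _ = 0 := by rw [h3, mul_zero, zero_mul, zero_mul]
  calc Q * (star w * x * u * P * star (star w * x * u))
      = (star w * w) * Q * star w * (x * (u * P * star u) * star x) * w := by
        rw [Unitary.star_mul_self_of_mem hw, one_mul]
        simp only [star_mul, star_star, mul_assoc]
    _ = star w * (w * Q * star w * (s * (u * P * star u) * star s)) * w := by
        rw [key]; simp only [mul_assoc]
    _ = 0 := by rw [h0, mul_zero, zero_mul]

theorem HasRoom.uequiv_of_partialIsometry (hB : HasRoom B) {p q : Proj B} {v : Unitization ℂ B}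
    (hvp : star v * v = ((p : B) : Unitization ℂ B)) (hvq : v * star v = ((q : B) : Unitization ℂ B))
    (hv : v * ((p : B) : Unitization ℂ B) = v) : UEquiv p q := by
  obtain ⟨e, s, h1, h2, h3, -, u, hu, w, hw, hp, hq⟩ := hB.exists_corner p q
  obtain ⟨x, hx, hsw⟩ := exists_unitary_swap h1 h2 h3
  set P : Unitization ℂ B := ((p : B) : Unitization ℂ B) with hP
  set Q : Unitization ℂ B := ((q : B) : Unitization ℂ B) with hQ
  have hPs : star P = P := (isStarProjection_inr.2 p.2).isSelfAdjoint
  have hPP : P * P = P := (isStarProjection_inr.2 p.2).isIdempotentElem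
  have huu := Unitary.star_mul_self_of_mem hu
  have hww := Unitary.star_mul_self_of_mem hw
  have hes : star e = e := by rw [← h1, star_mul, star_star]
  have hse : star s * e = 0 := by rw [← hes, ← star_mul, h3, star_zero]
  set P' := u * P * star u with hP'
  have hP's : star P' = P' := by rw [hP', star_mul, star_mul, star_star, hPs, mul_assoc]
  have hp' : P' * e = P' := by
    have := congrArg star hp
    rwa [star_mul, hP's, hes] at this
  have hP'P' : P' * P' = P' := by
    calc P' * P' = u * P * (star u * u) * P * star u := by simp only [hP', mul_assoc]
      _ = P' := by rw [huu, mul_one, mul_assoc u, hPP]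
  set v' := w * v * star u with hv'
  have hv'P : v' * P' = v' := by
    calc v' * P' = w * (v * (star u * u) * P) * star u := by simp only [hv', hP', mul_assoc]
      _ = v' := by rw [huu, mul_one, hv]
  have hv'e : v' * e = v' := by rw [← hv'P, mul_assoc, hp']
  have hv'v' : star v' * v' = P' := by
    calc star v' * v' = u * star v * (star w * w) * v * star u := by
          simp only [hv', star_mul, star_star, mul_assoc]
      _ = P' := by rw [hww, mul_one, mul_assoc u, hvp]
  have hv'v'' : v' * star v' = w * Q * star w := by
    calc v' * star v' = w * (v * (star u * u) * star v) * star w := by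
          simp only [hv', star_mul, star_star, mul_assoc]
      _ = _ := by rw [huu, mul_one, hvq]
  have hev' : e * v' = v' := by
    have : v' = w * Q * star w * v' := by rw [← hv'v'', mul_assoc, hv'v', hv'P]
    rw [this, ← mul_assoc, hq]
  set r := s * P' * star s with hr
  set v₂ := v' * star s with hv₂
  have k1 : star v₂ * v₂ = r := by
    rw [hv₂, star_mul, star_star, hr, ← hv'v']; simp only [mul_assoc]
  have k2 : v₂ * r = v₂ := by
    calc v₂ * r = v' * (star s * s) * P' * star s := by simp only [hv₂, hr, mul_assoc]
      _ = v₂ := by rw [h1, hv'e, hv'P]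
  have k3 : r * v₂ = 0 := by
    calc r * v₂ = s * P' * (star s * v') * star s := by simp only [hv₂, hr, mul_assoc]
      _ = 0 := by rw [← hev', ← mul_assoc (star s), hse, zero_mul, mul_zero, zero_mul]
  have k4 : r * r = r := by
    calc r * r = s * (P' * (star s * s) * P') * star s := by simp only [hr, mul_assoc]
      _ = r := by rw [h1, hp', hP'P']
  have k5 : v₂ * star v₂ = w * Q * star w := by
    calc v₂ * star v₂ = v' * (star s * s) * star v' := by
          simp only [hv₂, star_mul, star_star, mul_assoc]
      _ = _ := by rw [h1, hv'e, hv'v'']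
  obtain ⟨y, hy, hyr⟩ := exists_unitary_swap k1 k2 k3
  have e1 : y * r * star y = w * Q * star w := by
    rw [hyr r k4 k4, k2, k5]
  have e2 : x * P' * star x = r := hsw _ hp hp'
  refine UEquiv.symm ⟨star w * y * x * u, mul_mem (mul_mem (mul_mem (Unitary.star_mem hw) hy) hx) hu,
    ?_⟩
  calc Q = (star w * w) * Q * (star w * w) := by rw [hww, one_mul, mul_one]
    _ = star w * (w * Q * star w) * w := by simp only [mul_assoc]
    _ = star w * (y * (x * (u * P * star u) * star x) * star y) * w := by rw [← hP', e2, e1]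
    _ = _ := by simp only [hP, star_mul, star_star, mul_assoc]

theorem HasRoom.add_congr (hB : HasRoom B) {p q p' q' : Proj B} (h : (p : B) * q = 0)
    (h' : (p' : B) * q' = 0) (hp : UEquiv p p') (hq : UEquiv q q') :
    UEquiv (p.add q h) (p'.add q' h') := by
  obtain ⟨u, hu, hp⟩ := hp.symm
  obtain ⟨w, hw, hq⟩ := hq.symm
  have idem : ∀ a : Proj B, ((a : B) : Unitization ℂ B) * ((a : B) : Unitization ℂ B) =
    ((a : B) : Unitization ℂ B) := fun a => (isStarProjection_inr.2 a.2).isIdempotentElem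
  have hstar : ∀ a : Proj B, star ((a : B) : Unitization ℂ B) = ((a : B) : Unitization ℂ B) :=
    fun a => (isStarProjection_inr.2 a.2).isSelfAdjoint
  have horth : ∀ {a b : Proj B}, (a : B) * b = 0 →
      ((a : B) : Unitization ℂ B) * ((b : B) : Unitization ℂ B) = 0 := fun {a b} hab => by
    rw [← Unitization.inr_mul, hab, Unitization.inr_zero]
  have e1 := horth h
  have e2 := horth (Proj.mul_comm_zero h)
  have e1' := horth h'
  have e2' := horth (Proj.mul_comm_zero h')
  have huu := Unitary.star_mul_self_of_mem hu
  have hww := Unitary.star_mul_self_of_mem hw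
  set P : Unitization ℂ B := ((p : B) : Unitization ℂ B) with hP
  set Q : Unitization ℂ B := ((q : B) : Unitization ℂ B) with hQ
  set P' : Unitization ℂ B := ((p' : B) : Unitization ℂ B) with hP'
  set Q' : Unitization ℂ B := ((q' : B) : Unitization ℂ B) with hQ'
  have f1 : u * P = P' * (u * P) := by
    rw [hp]
    calc u * P = u * (P * P) := by rw [idem p]
      _ = u * P * (star u * u) * P := by rw [huu, mul_one, mul_assoc]
      _ = _ := by simp only [mul_assoc]
  have f2 : w * Q = Q' * (w * Q) := by
    rw [hq]
    calc w * Q = w * (Q * Q) := by rw [idem q]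
      _ = w * Q * (star w * w) * Q := by rw [hww, mul_one, mul_assoc]
      _ = _ := by simp only [mul_assoc]
  have f1' : star (u * P) = star (u * P) * P' := by
    conv_lhs => rw [f1]
    rw [star_mul, hstar p']
  have f2' : star (w * Q) = star (w * Q) * Q' := by
    conv_lhs => rw [f2]
    rw [star_mul, hstar q']
  have cross1 : star (u * P) * (w * Q) = 0 := by
    rw [f1', f2, mul_assoc, ← mul_assoc P', e1', zero_mul, mul_zero]
  have cross2 : star (w * Q) * (u * P) = 0 := by
    rw [f2', f1, mul_assoc, ← mul_assoc Q', e2', zero_mul, mul_zero]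
  have d1 : star (u * P) * (u * P) = P := by
    rw [star_mul, hstar p, mul_assoc, ← mul_assoc (star u), huu, one_mul, idem p]
  have d2 : star (w * Q) * (w * Q) = Q := by
    rw [star_mul, hstar q, mul_assoc, ← mul_assoc (star w), hww, one_mul, idem q]
  have c1 : u * P * star (u * P) = P' := by
    rw [star_mul, hstar p, hp, ← mul_assoc, mul_assoc u, idem p]
  have c2 : w * Q * star (w * Q) = Q' := by
    rw [star_mul, hstar q, hq, ← mul_assoc, mul_assoc w, idem q]
  have c3 : u * P * star (w * Q) = 0 := by
    rw [star_mul, hstar q, ← mul_assoc, mul_assoc u, e1, mul_zero, zero_mul]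
  have c4 : w * Q * star (u * P) = 0 := by
    rw [star_mul, hstar p, ← mul_assoc, mul_assoc w, e2, mul_zero, zero_mul]
  refine hB.uequiv_of_partialIsometry (v := u * P + w * Q) ?_ ?_ ?_
  · rw [star_add, add_mul, mul_add, mul_add, d1, d2, cross1, cross2, add_zero, zero_add]
    simp [Proj.add, hP, hQ]
  · rw [star_add, add_mul, mul_add, mul_add, c1, c2, c3, c4, add_zero, zero_add]
    simp [Proj.add, hP', hQ']
  · have : (((p.add q h : Proj B) : B) : Unitization ℂ B) = P + Q := by simp [Proj.add, hP, hQ]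
    rw [this, add_mul, mul_add, mul_add, mul_assoc, mul_assoc, mul_assoc, mul_assoc, idem p, e1, e2,
      idem q, mul_zero, mul_zero, add_zero, zero_add]

end Equivalence

/-! ### Operator K-theory -/

section Stab

variable {A : Type u} [CStarAlgebra A]

/-- The element `1 ⊗ k` of the stabilization. -/
def oneTmul (k : Compacts) : Stab A := CTensor.tmul 1 k

theorem oneTmul_mul (k l : Compacts) : oneTmul (A := A) k * oneTmul l = oneTmul (k * l) := by
  rw [oneTmul, oneTmul, oneTmul, CTensor.tmul, CTensor.tmul, CTensor.tmul, ← CTensor.mk_mul,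
    AlgTensor.tmul_mul_tmul, one_mul]

theorem star_oneTmul (k : Compacts) : star (oneTmul (A := A) k) = oneTmul (star k) := by
  rw [oneTmul, oneTmul, CTensor.tmul, CTensor.tmul, ← CTensor.mk_star, AlgTensor.star_tmul,
    star_one]

/-- `trunc n` as an element of the compact operators. -/
def ctrunc (n : ℕ) : Compacts := ⟨trunc n, isCompactOperator_trunc n⟩

/-- `shift n` as an element of the compact operators. -/
def cshift (n : ℕ) : Compacts := ⟨shift n, isCompactOperator_shift n⟩

theorem tendsto_ctrunc_mul (k : Compacts) : Tendsto (fun n => ctrunc n * k) atTop (𝓝 k) :=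
  tendsto_subtype_rng.2 (tendsto_trunc_mul k.2)

theorem norm_oneTmul_ctrunc_le (n : ℕ) : ‖oneTmul (A := A) (ctrunc n)‖ ≤ 1 := by
  refine IsStarProjection.norm_le _ ⟨?_, ?_⟩
  · show _ * _ = _
    rw [oneTmul_mul]; congr 1; exact Subtype.ext (trunc_mul_trunc n)
  · show star _ = _
    rw [star_oneTmul]; congr 1; exact Subtype.ext (star_trunc n)

theorem tendsto_oneTmul_mul (b : Stab A) :
    Tendsto (fun n => oneTmul (ctrunc n) * b) atTop (𝓝 b) := by
  have halg : ∀ x : AlgTensor A Compacts,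
      Tendsto (fun n => oneTmul (ctrunc n) * CTensor.mk x) atTop (𝓝 (CTensor.mk x)) := fun x => by
    induction x using AlgTensor.induction_on with
    | zero => simp only [map_zero, mul_zero]; exact tendsto_const_nhds
    | add x y hx hy => simpa only [map_add, mul_add] using hx.add hy
    | tmul a k =>
      have h1 : ∀ n, oneTmul (ctrunc n) * CTensor.mk (AlgTensor.tmul a k) =
          CTensor.mk (AlgTensor.tmul a (ctrunc n * k)) := fun n => by
        rw [oneTmul, CTensor.tmul, ← CTensor.mk_mul, AlgTensor.tmul_mul_tmul, one_mul]
      simp only [h1]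
      rw [tendsto_iff_norm_sub_tendsto_zero]
      have h2 := (tendsto_iff_norm_sub_tendsto_zero.1 (tendsto_ctrunc_mul k)).const_mul ‖a‖
      rw [mul_zero] at h2
      refine squeeze_zero (fun _ => norm_nonneg _) (fun n => ?_) h2
      rw [← map_sub, ← AlgTensor.tmul_sub, CTensor.norm_mk]
      exact AlgTensor.norm_tmul_le _ _
  rw [Metric.tendsto_atTop]
  intro ε hε
  obtain ⟨x, hx⟩ : ∃ x : AlgTensor A Compacts, dist b (CTensor.mk x) < ε / 3 := by
    obtain ⟨_, ⟨x, rfl⟩, hx⟩ := Metric.mem_closure_iff.1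
      (CTensor.isDenseInducing_mk.dense b) (ε / 3) (by positivity)
    exact ⟨x, hx⟩
  obtain ⟨N, hN⟩ := Metric.tendsto_atTop.1 (halg x) (ε / 3) (by positivity)
  refine ⟨N, fun n hn => ?_⟩
  have h1 := hN n hn
  have h2 : dist (oneTmul (ctrunc n) * b) (oneTmul (ctrunc n) * CTensor.mk x) ≤
      dist b (CTensor.mk x) := by
    rw [dist_eq_norm, dist_eq_norm, ← mul_sub]
    exact (norm_mul_le _ _).trans
      (mul_le_of_le_one_left (norm_nonneg _) (norm_oneTmul_ctrunc_le n))
  have h3 := dist_triangle4 (oneTmul (ctrunc n) * b) (oneTmul (ctrunc n) * CTensor.mk x)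
    (CTensor.mk x) b
  rw [dist_comm (CTensor.mk x) b] at h3
  linarith

variable (A) in
theorem hasRoom_stab : HasRoom (Stab A) := by
  intro b c ε hε
  have hb := (tendsto_iff_norm_sub_tendsto_zero.1 (tendsto_oneTmul_mul b)).eventually_le_const hε
  have hc := (tendsto_iff_norm_sub_tendsto_zero.1 (tendsto_oneTmul_mul c)).eventually_le_const hε
  obtain ⟨n, hn, hn'⟩ := (hb.and hc).exists
  refine ⟨oneTmul (ctrunc n), oneTmul (cshift n), ?_, ?_, ?_, ?_, ?_⟩
  · rw [star_oneTmul, oneTmul_mul]; congr 1; exact Subtype.ext (star_shift_mul_shift n)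
  · rw [oneTmul_mul]; congr 1; exact Subtype.ext (shift_mul_trunc n)
  · rw [oneTmul_mul]
    have : ctrunc n * cshift n = 0 := Subtype.ext (trunc_mul_shift n)
    rw [this, oneTmul, CTensor.tmul]
    have : AlgTensor.tmul (1 : A) (0 : Compacts) = 0 := TensorProduct.tmul_zero _ _
    rw [this, map_zero]
  · rwa [norm_sub_rev]
  · rwa [norm_sub_rev]

end Stab

section K0

/-- The set `V(A)` of unitary equivalence classes of projections in `A ⊗ 𝒦`. -/
def V (A : Type u) [CStarAlgebra A] : Type u := Quotient (projSetoid (Stab A))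

variable {A : Type u} {B : Type v} {C : Type w} [CStarAlgebra A] [CStarAlgebra B] [CStarAlgebra C]

namespace V

/-- The class of a projection. -/
def mk (p : Proj (Stab A)) : V A := Quotient.mk (projSetoid (Stab A)) p

theorem mk_eq_mk {p q : Proj (Stab A)} : mk p = mk q ↔ UEquiv p q :=
  ⟨fun h => Quotient.exact h, fun h => Quotient.sound (s := projSetoid (Stab A)) h⟩

theorem ind {motive : V A → Prop} (h : ∀ p, motive (mk p)) (x : V A) : motive x :=
  Quotient.ind h x

theorem exists_orthogonal (p q : Proj (Stab A)) : ∃ r : Proj (Stab A), UEquiv q r ∧ (p : Stab A) * r = 0 :=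
  (hasRoom_stab A).exists_orthogonal q p

/-- Addition in `V(A)`: add orthogonal representatives. -/
instance : Add (V A) where
  add := Quotient.map₂ (sa := projSetoid (Stab A)) (sb := projSetoid (Stab A))
    (sc := projSetoid (Stab A))
    (fun p q => p.add (exists_orthogonal p q).choose (exists_orthogonal p q).choose_spec.2)
    fun p p' hp q q' hq => (hasRoom_stab A).add_congr _ _ hp
      (((exists_orthogonal p q).choose_spec.1.symm.trans hq).trans
        (exists_orthogonal p' q').choose_spec.1)

theorem mk_add_mk {p q : Proj (Stab A)} (h : (p : Stab A) * q = 0) :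
    mk p + mk q = mk (p.add q h) :=
  mk_eq_mk.2 ((hasRoom_stab A).add_congr _ _ (UEquiv.refl p)
    (exists_orthogonal p q).choose_spec.1.symm)

/-- The zero projection. -/
def zeroProj (B : Type u) [NonUnitalCStarAlgebra B] : Proj B := ⟨0, .zero B⟩

instance : Zero (V A) := ⟨mk (zeroProj _)⟩

theorem zero_def : (0 : V A) = mk (zeroProj _) := rfl

protected theorem add_comm (x y : V A) : x + y = y + x := by
  induction x using ind with | _ p
  induction y using ind with | _ q
  obtain ⟨r, hr, hpr⟩ := exists_orthogonal p q
  rw [mk_eq_mk.2 hr, mk_add_mk hpr, mk_add_mk (Proj.mul_comm_zero hpr)]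
  congr 1
  exact Subtype.ext (add_comm _ _)

protected theorem zero_add (x : V A) : 0 + x = x := by
  induction x using ind with | _ p
  rw [zero_def, mk_add_mk (p := zeroProj _) (q := p) (zero_mul _)]
  congr 1
  exact Subtype.ext (zero_add _)

protected theorem add_assoc (x y z : V A) : x + y + z = x + (y + z) := by
  induction x using ind with | _ p
  induction y using ind with | _ q
  induction z using ind with | _ r
  obtain ⟨q', hq, hpq⟩ := exists_orthogonal p q
  obtain ⟨r', hr, hpr⟩ := exists_orthogonal (p.add q' hpq) r
  have h : ((p : Stab A) + q') * r' = 0 := hpr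
  have h1 : (p : Stab A) * r' = 0 := by
    have := congrArg (fun x => (p : Stab A) * x) h
    simpa only [mul_add, ← mul_assoc, add_mul, p.2.isIdempotentElem.eq, hpq, zero_mul, add_zero,
      mul_zero] using this
  have h2 : (q' : Stab A) * r' = 0 := by rwa [add_mul, h1, zero_add] at h
  rw [mk_eq_mk.2 hq, mk_eq_mk.2 hr, mk_add_mk hpq, mk_add_mk hpr, mk_add_mk h2,
    mk_add_mk (p := p) (q := q'.add r' h2) (by
      show (p : Stab A) * (q' + r') = 0
      rw [mul_add, hpq, h1, add_zero])]
  congr 1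
  exact Subtype.ext (add_assoc _ _ _)

instance : AddCommMonoid (V A) where
  add_assoc := V.add_assoc
  zero_add := V.zero_add
  add_zero x := by rw [V.add_comm, V.zero_add]
  add_comm := V.add_comm
  nsmul := nsmulRec

end V

/-- The image of a projection under a *-homomorphism. -/
def Proj.map {B : Type u} {C : Type v} [NonUnitalCStarAlgebra B] [NonUnitalCStarAlgebra C]
    (φ : B →⋆ₙₐ[ℂ] C) (p : Proj B) : Proj C := ⟨φ p, p.2.map φ⟩

theorem UEquiv.map {B : Type u} {C : Type v} [NonUnitalCStarAlgebra B] [NonUnitalCStarAlgebra C]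
    (φ : B →⋆ₙₐ[ℂ] C) {p q : Proj B} (h : UEquiv p q) : UEquiv (p.map φ) (q.map φ) := by
  obtain ⟨w, hw, h⟩ := h
  refine ⟨Unitization.starMap φ w, Unitary.map_mem _ hw, ?_⟩
  have := congrArg (Unitization.starMap φ) h
  rwa [map_mul, map_mul, map_star, Unitization.starMap_inr, Unitization.starMap_inr] at this

/-- A unital *-homomorphism as a *-homomorphism of possibly non-unital algebras. -/
abbrev toNonUnital (φ : A →⋆ₐ[ℂ] B) : A →⋆ₙₐ[ℂ] B := φ

/-- The homomorphism `V(φ) : V(A) → V(B)`, `[P] ↦ [(φ ⊗ id)(P)]`. -/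
def V.map (φ : A →⋆ₐ[ℂ] B) : V A →+ V B where
  toFun := Quotient.map (sa := projSetoid (Stab A)) (sb := projSetoid (Stab B))
    (Proj.map (Stab.map (φ : A →⋆ₙₐ[ℂ] B))) fun _ _ h => h.map _
  map_zero' := V.mk_eq_mk.2 (by
    have : Proj.map (Stab.map (φ : A →⋆ₙₐ[ℂ] B)) (V.zeroProj _) = V.zeroProj _ :=
      Subtype.ext (map_zero _)
    rw [this]; exact UEquiv.refl _)
  map_add' x y := by
    induction x using V.ind with | _ p
    induction y using V.ind with | _ q
    obtain ⟨r, hr, hpr⟩ := V.exists_orthogonal p q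
    rw [V.mk_eq_mk.2 hr, V.mk_add_mk hpr]
    refine Eq.trans ?_ (V.mk_add_mk (p := Proj.map (Stab.map (φ : A →⋆ₙₐ[ℂ] B)) p)
      (q := Proj.map (Stab.map (φ : A →⋆ₙₐ[ℂ] B)) r) ?_).symm
    · exact congrArg V.mk (Subtype.ext (map_add _ _ _))
    · show Stab.map _ _ * Stab.map _ _ = _
      rw [← map_mul, hpr, map_zero]

theorem V.map_mk (φ : A →⋆ₐ[ℂ] B) (p : Proj (Stab A)) :
    V.map φ (V.mk p) = V.mk (p.map (Stab.map (φ : A →⋆ₙₐ[ℂ] B))) := rfl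

/-- Operator `K₀` of a unital C*-algebra: the universal group of `V(A)`. -/
abbrev K0 (A : Type u) [CStarAlgebra A] : Type u := Algebra.GrothendieckAddGroup (V A)

namespace K0

/-- The class `[P]` in `K₀(A)` of a projection `P` in `A ⊗ 𝒦`. -/
def mk (p : Proj (Stab A)) : K0 A := Algebra.GrothendieckAddGroup.of (V.mk p)

/-- The homomorphism `K₀(φ)`. -/
def map (φ : A →⋆ₐ[ℂ] B) : K0 A →+ K0 B :=
  Algebra.GrothendieckAddGroup.lift (Algebra.GrothendieckAddGroup.of.comp (V.map φ))

theorem map_mk (φ : A →⋆ₐ[ℂ] B) (p : Proj (Stab A)) :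
    map φ (mk p) = mk (p.map (Stab.map (φ : A →⋆ₙₐ[ℂ] B))) :=
  DFunLike.congr_fun (Algebra.GrothendieckAddGroup.lift.symm_apply_apply
    (Algebra.GrothendieckAddGroup.of.comp (V.map φ))) (V.mk p)

theorem hom_ext {G : Type*} [AddCommGroup G] {f g : K0 A →+ G} (h : ∀ p, f (mk p) = g (mk p)) :
    f = g := by
  refine Algebra.GrothendieckAddGroup.lift.symm.injective (AddMonoidHom.ext fun x => ?_)
  induction x using V.ind with | _ p
  exact h p

theorem map_id : map (StarAlgHom.id ℂ A) = AddMonoidHom.id (K0 A) :=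
  hom_ext fun p => by
    rw [map_mk]
    exact congrArg mk (Subtype.ext (CTensor.map_id (p : Stab A)))

theorem _root_.OpK.Stab.map_map (ψ : B →⋆ₐ[ℂ] C) (φ : A →⋆ₐ[ℂ] B) (x : Stab A) :
    Stab.map ((ψ.comp φ : A →⋆ₐ[ℂ] C) : A →⋆ₙₐ[ℂ] C) x =
      Stab.map (ψ : B →⋆ₙₐ[ℂ] C) (Stab.map (φ : A →⋆ₙₐ[ℂ] B) x) :=
  CTensor.map_comp (B := Compacts) (ψ : B →⋆ₙₐ[ℂ] C) (φ : A →⋆ₙₐ[ℂ] B) x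

theorem map_comp (ψ : B →⋆ₐ[ℂ] C) (φ : A →⋆ₐ[ℂ] B) : map (ψ.comp φ) = (map ψ).comp (map φ) :=
  hom_ext fun p => by
    rw [AddMonoidHom.comp_apply, map_mk, map_mk, map_mk]
    exact congrArg mk (Subtype.ext (Stab.map_map ψ φ (p : Stab A)))

end K0

/-- The projection `B⁺ → ℂ` from the unitization of `B` onto the scalars. -/
def scalarHom (B : Type u) [NonUnitalCStarAlgebra B] : Unitization ℂ B →⋆ₐ[ℂ] ℂ :=
  { Unitization.fstHom ℂ B with map_star' := fun _ => rfl }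

theorem scalarHom_apply (B : Type u) [NonUnitalCStarAlgebra B] (x : Unitization ℂ B) :
    scalarHom B x = x.fst := rfl

theorem scalarHom_starMap {B : Type u} {C : Type v} [NonUnitalCStarAlgebra B]
    [NonUnitalCStarAlgebra C] (φ : B →⋆ₙₐ[ℂ] C) :
    (scalarHom C).comp (Unitization.starMap φ) = scalarHom B := by
  refine StarAlgHom.ext fun x => ?_
  rw [StarAlgHom.comp_apply, scalarHom_apply, scalarHom_apply]
  induction x using Unitization.ind with | _ r b
  rw [map_add, Unitization.starMap_inl, Unitization.starMap_inr]
  simp [Unitization.algebraMap_eq_inl]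

/-- Operator `K₀` of a possibly non-unital C*-algebra `B`: the kernel of `K₀(B⁺) → K₀(ℂ)`. -/
def K0nu (B : Type u) [NonUnitalCStarAlgebra B] : AddSubgroup (K0 (Unitization ℂ B)) :=
  (K0.map (scalarHom B)).ker

/-- The homomorphism `K₀(φ)` for a *-homomorphism of possibly non-unital C*-algebras. -/
def K0nu.map {B : Type u} {C : Type v} [NonUnitalCStarAlgebra B] [NonUnitalCStarAlgebra C]
    (φ : B →⋆ₙₐ[ℂ] C) : K0nu B →+ K0nu C :=
  ((K0.map (Unitization.starMap φ)).comp (K0nu B).subtype).codRestrict (K0nu C) fun x => by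
    have h : K0.map (scalarHom B) x = 0 := x.2
    rw [← scalarHom_starMap φ, K0.map_comp] at h
    exact h

theorem K0nu.coe_map {B : Type u} {C : Type v} [NonUnitalCStarAlgebra B] [NonUnitalCStarAlgebra C]
    (φ : B →⋆ₙₐ[ℂ] C) (x : K0nu B) :
    (K0nu.map φ x : K0 (Unitization ℂ C)) = K0.map (Unitization.starMap φ) x := rfl

end K0

/-! ### Topological K-theory -/

/-- The total space of a family of sets `E x`. -/
structure Total {X : Type u} (E : X → Type) : Type u where
  base : X
  vec : E base

/-- A complex vector bundle over `X` (of finite, locally constant rank): a family of complex vector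
spaces and a topology on its total space that is locally that of a product `U × ℂⁿ`. The map in
`locally_trivial` is a fibrewise linear bijection of `U × ℂⁿ` with the part of the total space over
`U`. -/
structure CVect (X : Type u) [TopologicalSpace X] : Type (max u 1) where
  fiber : X → Type
  [addCommGroup : ∀ x, AddCommGroup (fiber x)]
  [module : ∀ x, Module ℂ (fiber x)]
  [topology : TopologicalSpace (Total fiber)]
  locally_trivial : ∀ x, ∃ (U : Set X) (n : ℕ) (φ : ∀ y : U, (Fin n → ℂ) ≃ₗ[ℂ] fiber y),
    IsOpen U ∧ x ∈ U ∧
      IsOpenEmbedding fun p : U × (Fin n → ℂ) => (⟨p.1, φ p.1 p.2⟩ : Total fiber)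

namespace CVect

attribute [instance] CVect.addCommGroup CVect.module CVect.topology

variable {X : Type u} {Y : Type v} {Z : Type w} [TopologicalSpace X] [TopologicalSpace Y]
  [TopologicalSpace Z]

theorem continuous_base (E : CVect X) : Continuous (Total.base : Total E.fiber → X) := by
  rw [continuous_iff_continuousAt]
  intro t
  obtain ⟨U, n, φ, hU, hx, he⟩ := E.locally_trivial t.base
  obtain ⟨w, hw⟩ := (φ ⟨t.base, hx⟩).surjective t.vec
  have ht : (⟨t.base, φ ⟨t.base, hx⟩ w⟩ : Total E.fiber) = t := by rw [hw]
  rw [← ht]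
  exact (he.continuousAt_iff (x := (⟨t.base, hx⟩, w))).1
    (continuous_subtype_val.comp continuous_fst).continuousAt

/-- The map of total spaces induced by fibrewise maps. -/
def totalMap {E F : X → Type} (φ : ∀ x, E x → F x) (t : Total E) : Total F := ⟨t.base, φ _ t.vec⟩

/-- Isomorphism of vector bundles: a fibrewise linear homeomorphism of total spaces. -/
def Iso (E F : CVect X) : Prop :=
  ∃ φ : ∀ x, E.fiber x ≃ₗ[ℂ] F.fiber x,
    Continuous (totalMap fun x => φ x) ∧ Continuous (totalMap fun x => (φ x).symm)

theorem Iso.refl (E : CVect X) : Iso E E :=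
  ⟨fun _ => LinearEquiv.refl ℂ _, continuous_id, continuous_id⟩

theorem Iso.symm {E F : CVect X} (h : Iso E F) : Iso F E := by
  obtain ⟨φ, h1, h2⟩ := h
  exact ⟨fun x => (φ x).symm, h2, h1⟩

theorem Iso.trans {E F G : CVect X} (h : Iso E F) (h' : Iso F G) : Iso E G := by
  obtain ⟨φ, h1, h2⟩ := h
  obtain ⟨ψ, h3, h4⟩ := h'
  exact ⟨fun x => (φ x).trans (ψ x), h3.comp h1, h2.comp h4⟩

/-- The inclusion of the total space of the fibrewise product of two bundles into the product of
the two total spaces. -/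
def prodIncl (E F : CVect X) (t : Total fun x => E.fiber x × F.fiber x) :
    Total E.fiber × Total F.fiber := (⟨t.base, t.vec.1⟩, ⟨t.base, t.vec.2⟩)

/-- The direct sum of vector bundles, with the topology of the fibre product. -/
def directSum (E F : CVect X) : CVect X where
  fiber x := E.fiber x × F.fiber x
  topology := TopologicalSpace.induced (prodIncl E F) inferInstance
  locally_trivial x := by
    obtain ⟨U, n, φ, hU, hx, he⟩ := E.locally_trivial x
    obtain ⟨U', n', φ', hU', hx', he'⟩ := F.locally_trivial x
    let _ : TopologicalSpace (Total fun x => E.fiber x × F.fiber x) :=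
      TopologicalSpace.induced (prodIncl E F) inferInstance
    have hincl : IsInducing (prodIncl E F) := ⟨rfl⟩
    let sp : (Fin (n + n') → ℂ) ≃L[ℂ] (Fin n → ℂ) × (Fin n' → ℂ) :=
      ContinuousLinearEquiv.ofFinrankEq (by simp)
    refine ⟨U ∩ U', n + n', fun y => sp.toLinearEquiv.trans
      ((φ ⟨y, y.2.1⟩).prodCongr (φ' ⟨y, y.2.2⟩)), hU.inter hU', ⟨hx, hx'⟩, ?_⟩
    set e := fun p : U × (Fin n → ℂ) => (⟨p.1, φ p.1 p.2⟩ : Total E.fiber) with he_def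
    set e' := fun p : U' × (Fin n' → ℂ) => (⟨p.1, φ' p.1 p.2⟩ : Total F.fiber) with he'_def
    let g : (U ∩ U' : Set X) × (Fin (n + n') → ℂ) → (U × (Fin n → ℂ)) × (U' × (Fin n' → ℂ)) :=
      fun p => ((⟨p.1, p.1.2.1⟩, (sp p.2).1), (⟨p.1, p.1.2.2⟩, (sp p.2).2))
    have hg : IsEmbedding g := by
      refine IsEmbedding.of_comp (g := fun q : (U × (Fin n → ℂ)) × (U' × (Fin n' → ℂ)) =>
        ((q.1.1 : X), (q.1.2, q.2.2))) (by fun_prop) (by fun_prop) ?_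
      exact IsEmbedding.subtypeVal.prodMap sp.toHomeomorph.isEmbedding
    have hcomp := (he.isEmbedding.prodMap he'.isEmbedding).comp hg
    have hcont : Continuous fun p : (U ∩ U' : Set X) × (Fin (n + n') → ℂ) =>
        (⟨p.1, (φ ⟨p.1, p.1.2.1⟩ (sp p.2).1, φ' ⟨p.1, p.1.2.2⟩ (sp p.2).2)⟩ :
          Total fun x => E.fiber x × F.fiber x) := hincl.continuous_iff.2 hcomp.continuous
    refine ⟨IsEmbedding.of_comp hcont hincl.continuous hcomp, ?_⟩
    convert (he.isOpen_range.prod he'.isOpen_range).preimage hincl.continuous using 1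
    ext t
    constructor
    · rintro ⟨p, rfl⟩
      exact ⟨⟨(⟨p.1, p.1.2.1⟩, (sp p.2).1), rfl⟩, ⟨(⟨p.1, p.1.2.2⟩, (sp p.2).2), rfl⟩⟩
    · obtain ⟨y, v, w⟩ := t
      rintro ⟨⟨⟨⟨y₁, hy₁⟩, a⟩, ha⟩, ⟨⟨⟨y₂, hy₂⟩, b⟩, hb⟩⟩
      simp only [he_def, he'_def, prodIncl, Total.mk.injEq] at ha hb
      obtain ⟨rfl, ha⟩ := ha
      obtain ⟨rfl, hb⟩ := hb
      refine ⟨(⟨y₂, hy₁, hy₂⟩, sp.symm (a, b)), ?_⟩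
      rw [← eq_of_heq ha, ← eq_of_heq hb]
      show (⟨y₂, _⟩ : Total _) = _
      congr 1
      show (φ _ (sp (sp.symm (a, b))).1, φ' _ (sp (sp.symm (a, b))).2) = _
      rw [ContinuousLinearEquiv.apply_symm_apply]

theorem isInducing_prodIncl (E F : CVect X) :
    @IsInducing (Total (directSum E F).fiber) _ _ _ (prodIncl E F) := ⟨rfl⟩

theorem continuous_directSum_iff {E F : CVect X} {α : Type*} [TopologicalSpace α]
    {f : α → Total (directSum E F).fiber} : Continuous f ↔
      Continuous (fun a => (⟨(f a).base, (f a).vec.1⟩ : Total E.fiber)) ∧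
      Continuous (fun a => (⟨(f a).base, (f a).vec.2⟩ : Total F.fiber)) :=
  (isInducing_prodIncl E F).continuous_iff.trans continuous_prodMk

theorem continuous_fst (E F : CVect X) : Continuous fun t : Total (directSum E F).fiber =>
    (⟨t.base, t.vec.1⟩ : Total E.fiber) := (continuous_directSum_iff.1 continuous_id).1

theorem continuous_snd (E F : CVect X) : Continuous fun t : Total (directSum E F).fiber =>
    (⟨t.base, t.vec.2⟩ : Total F.fiber) := (continuous_directSum_iff.1 continuous_id).2

theorem Iso.directSum {E E' F F' : CVect X} (h : Iso E E') (h' : Iso F F') :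
    Iso (directSum E F) (directSum E' F') := by
  obtain ⟨φ, h1, h2⟩ := h
  obtain ⟨ψ, h3, h4⟩ := h'
  exact ⟨fun x => (φ x).prodCongr (ψ x),
    continuous_directSum_iff.2 ⟨h1.comp (continuous_fst E F), h3.comp (continuous_snd E F)⟩,
    continuous_directSum_iff.2 ⟨h2.comp (continuous_fst E' F'), h4.comp (continuous_snd E' F')⟩⟩

theorem iso_directSum_comm (E F : CVect X) : Iso (directSum E F) (directSum F E) :=
  ⟨fun _ => LinearEquiv.prodComm ℂ _ _,
    continuous_directSum_iff.2 ⟨continuous_snd E F, continuous_fst E F⟩,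
    continuous_directSum_iff.2 ⟨continuous_snd F E, continuous_fst F E⟩⟩

theorem iso_directSum_assoc (E F G : CVect X) :
    Iso (directSum (directSum E F) G) (directSum E (directSum F G)) :=
  ⟨fun _ => LinearEquiv.prodAssoc ℂ _ _ _,
    continuous_directSum_iff.2 ⟨(continuous_fst E F).comp (continuous_fst _ G),
      continuous_directSum_iff.2 ⟨(continuous_snd E F).comp (continuous_fst _ G),
        continuous_snd _ G⟩⟩,
    continuous_directSum_iff.2 ⟨continuous_directSum_iff.2 ⟨continuous_fst E _,
      (continuous_fst F G).comp (continuous_snd E _)⟩,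
      (continuous_snd F G).comp (continuous_snd E _)⟩⟩

variable (X) in
/-- The zero vector bundle. -/
def zeroBundle : CVect X where
  fiber _ := PUnit
  topology := TopologicalSpace.induced Total.base inferInstance
  locally_trivial x := by
    let _ : TopologicalSpace (Total fun _ : X => PUnit) :=
      TopologicalSpace.induced Total.base inferInstance
    have hbase : IsInducing (Total.base : Total (fun _ : X => PUnit) → X) := ⟨rfl⟩
    refine ⟨Set.univ, 0, fun y => 0, isOpen_univ, Set.mem_univ x, ?_⟩
    have hemb : IsEmbedding fun p : ((Set.univ : Set X) : Type u) × (Fin 0 → ℂ) => (p.1 : X) :=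
      IsEmbedding.subtypeVal.comp (Homeomorph.prodUnique _ _).isEmbedding
    refine ⟨IsEmbedding.of_comp (hbase.continuous_iff.2 hemb.continuous) hbase.continuous hemb, ?_⟩
    convert isOpen_univ
    exact Set.eq_univ_of_forall fun t => ⟨(⟨t.base, trivial⟩, 0), rfl⟩

theorem iso_zero_directSum (E : CVect X) : Iso (directSum (zeroBundle X) E) E :=
  ⟨fun x => (LinearEquiv.uniqueProd : (PUnit × E.fiber x) ≃ₗ[ℂ] E.fiber x), continuous_snd _ E,
    continuous_directSum_iff.2 ⟨continuous_induced_rng.2 (continuous_base E), continuous_id⟩⟩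

/-- The map from the total space of the pullback to the product. -/
def pullbackIncl (f : Y → X) (E : CVect X) (t : Total fun y => E.fiber (f y)) :
    Y × Total E.fiber := (t.base, ⟨f t.base, t.vec⟩)

/-- The pullback of a vector bundle along a continuous map. -/
def pullback (f : C(Y, X)) (E : CVect X) : CVect Y where
  fiber y := E.fiber (f y)
  topology := TopologicalSpace.induced (pullbackIncl f E) inferInstance
  locally_trivial y := by
    obtain ⟨U, n, φ, hU, hx, he⟩ := E.locally_trivial (f y)
    let _ : TopologicalSpace (Total fun y => E.fiber (f y)) :=
      TopologicalSpace.induced (pullbackIncl f E) inferInstance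
    have hincl : IsInducing (pullbackIncl f E) := ⟨rfl⟩
    refine ⟨f ⁻¹' U, n, fun y => φ ⟨f y, y.2⟩, hU.preimage f.continuous, hx, ?_⟩
    let g : (f ⁻¹' U : Set Y) × (Fin n → ℂ) → Y × (U × (Fin n → ℂ)) :=
      fun p => (p.1, (⟨f p.1, p.1.2⟩, p.2))
    have hg : IsEmbedding g := by
      refine IsEmbedding.of_comp (g := fun q : Y × (U × (Fin n → ℂ)) => (q.1, q.2.2))
        (by fun_prop) (by fun_prop) ?_
      exact IsEmbedding.subtypeVal.prodMap IsEmbedding.id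
    have hcomp := (IsEmbedding.id.prodMap he.isEmbedding).comp hg
    have hcont : Continuous fun p : (f ⁻¹' U : Set Y) × (Fin n → ℂ) =>
        (⟨p.1, φ ⟨f p.1, p.1.2⟩ p.2⟩ : Total fun y => E.fiber (f y)) :=
      hincl.continuous_iff.2 hcomp.continuous
    refine ⟨IsEmbedding.of_comp hcont hincl.continuous hcomp, ?_⟩
    have hbase : Continuous (Total.base : Total (fun y => E.fiber (f y)) → Y) :=
      _root_.continuous_fst.comp hincl.continuous
    convert (hU.preimage f.continuous).preimage hbase using 1
    ext t
    constructor
    · rintro ⟨p, rfl⟩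
      exact p.1.2
    · intro ht
      refine ⟨(⟨t.base, ht⟩, (φ ⟨f t.base, ht⟩).symm t.vec), ?_⟩
      show (⟨t.base, φ ⟨f t.base, ht⟩ ((φ ⟨f t.base, ht⟩).symm t.vec)⟩ : Total _) = t
      rw [LinearEquiv.apply_symm_apply]

theorem isInducing_pullbackIncl (f : C(Y, X)) (E : CVect X) :
    @IsInducing (Total (pullback f E).fiber) _ _ _ (pullbackIncl f E) := ⟨rfl⟩

theorem continuous_pullback_iff {f : C(Y, X)} {E : CVect X} {α : Type*} [TopologicalSpace α]
    {g : α → Total (pullback f E).fiber} : Continuous g ↔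
      Continuous (fun a => (g a).base) ∧
      Continuous (fun a => (⟨f (g a).base, (g a).vec⟩ : Total E.fiber)) :=
  (isInducing_pullbackIncl f E).continuous_iff.trans continuous_prodMk

theorem continuous_pullback_map (f : C(Y, X)) (E : CVect X) :
    Continuous fun t : Total (pullback f E).fiber => (⟨f t.base, t.vec⟩ : Total E.fiber) :=
  (continuous_pullback_iff.1 continuous_id).2

theorem Iso.pullback (f : C(Y, X)) {E F : CVect X} (h : Iso E F) :
    Iso (pullback f E) (pullback f F) := by
  obtain ⟨φ, h1, h2⟩ := h
  exact ⟨fun y => φ (f y),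
    continuous_pullback_iff.2 ⟨continuous_base _, h1.comp (continuous_pullback_map f E)⟩,
    continuous_pullback_iff.2 ⟨continuous_base _, h2.comp (continuous_pullback_map f F)⟩⟩

theorem iso_pullback_directSum (f : C(Y, X)) (E F : CVect X) :
    Iso (pullback f (directSum E F)) (directSum (pullback f E) (pullback f F)) :=
  ⟨fun _ => LinearEquiv.refl ℂ _,
    continuous_directSum_iff.2
      ⟨continuous_pullback_iff.2 ⟨continuous_base _,
        (continuous_fst E F).comp (continuous_pullback_map f _)⟩,
      continuous_pullback_iff.2 ⟨continuous_base _,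
        (continuous_snd E F).comp (continuous_pullback_map f _)⟩⟩,
    continuous_pullback_iff.2 ⟨continuous_base _, continuous_directSum_iff.2
      ⟨(continuous_pullback_map f E).comp (continuous_fst _ _),
        (continuous_pullback_map f F).comp (continuous_snd _ _)⟩⟩⟩

theorem iso_pullback_zero (f : C(Y, X)) : Iso (pullback f (zeroBundle X)) (zeroBundle Y) :=
  ⟨fun _ => LinearEquiv.refl ℂ _, continuous_induced_rng.2 (continuous_base _),
    continuous_pullback_iff.2 ⟨continuous_base _,
      continuous_induced_rng.2 (f.continuous.comp (continuous_base _))⟩⟩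

theorem iso_pullback_id (E : CVect X) : Iso (pullback (ContinuousMap.id X) E) E :=
  ⟨fun _ => LinearEquiv.refl ℂ _, continuous_pullback_map _ E,
    continuous_pullback_iff.2 ⟨continuous_base _, continuous_id⟩⟩

theorem iso_pullback_comp (f : C(Y, X)) (g : C(Z, Y)) (E : CVect X) :
    Iso (pullback (f.comp g) E) (pullback g (pullback f E)) :=
  ⟨fun _ => LinearEquiv.refl ℂ _,
    continuous_pullback_iff.2 ⟨continuous_base _, continuous_pullback_iff.2
      ⟨g.continuous.comp (continuous_base _), continuous_pullback_map (f.comp g) E⟩⟩,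
    continuous_pullback_iff.2 ⟨continuous_base _,
      (continuous_pullback_map f E).comp (continuous_pullback_map g _)⟩⟩

/-- The vector bundle with fibre `{v ∈ ℂ | p x * v = v}` at `x`, topologized as a subspace of
`X × ℂ`, for a continuous function `p` with `p x ∈ {0, 1}`: it is the trivial line bundle over the
set where `p x = 1`, and `0` elsewhere. -/
def ofIdempotent (p : C(X, ℂ)) (hp : p * p = p) : CVect X where
  fiber x := LinearMap.eqLocus (p x • LinearMap.id : ℂ →ₗ[ℂ] ℂ) LinearMap.id
  topology := TopologicalSpace.induced (fun t => (t.base, (t.vec : ℂ))) inferInstance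
  locally_trivial x := by
    let _ : TopologicalSpace
        (Total fun x => LinearMap.eqLocus (p x • LinearMap.id : ℂ →ₗ[ℂ] ℂ) LinearMap.id) :=
      TopologicalSpace.induced (fun t => (t.base, (t.vec : ℂ))) inferInstance
    have hincl : IsInducing fun t : Total fun x =>
      LinearMap.eqLocus (p x • LinearMap.id : ℂ →ₗ[ℂ] ℂ) LinearMap.id => (t.base, (t.vec : ℂ)) :=
      ⟨rfl⟩
    have hbase : Continuous (Total.base : Total (fun x =>
      LinearMap.eqLocus (p x • LinearMap.id : ℂ →ₗ[ℂ] ℂ) LinearMap.id) → X) :=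
      _root_.continuous_fst.comp hincl.continuous
    have hp01 : ∀ y, p y = 0 ∨ p y = 1 := fun y => by
      have : p y * p y = p y := congrArg (fun f : C(X, ℂ) => f y) hp
      rcases eq_or_ne (p y) 0 with h | h
      · exact Or.inl h
      · exact Or.inr (mul_left_cancel₀ h (by rw [this, mul_one]))
    rcases hp01 x with hx | hx
    · have hU : IsOpen {y | p y ≠ 1} := isOpen_ne.preimage p.continuous
      have hsub : ∀ y : {y | p y ≠ 1}, Subsingleton
          (LinearMap.eqLocus (p y • LinearMap.id : ℂ →ₗ[ℂ] ℂ) LinearMap.id) := fun y =>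
        ⟨fun v w => by
          have h0 : p y = 0 := (hp01 y).resolve_right y.2
          have key : ∀ v : LinearMap.eqLocus (p y • LinearMap.id : ℂ →ₗ[ℂ] ℂ) LinearMap.id,
              (v : ℂ) = 0 := fun v => by
            have := v.2
            simp only [LinearMap.mem_eqLocus, h0, zero_smul, LinearMap.zero_apply,
              LinearMap.id_apply] at this
            exact this.symm
          exact Subtype.ext ((key v).trans (key w).symm)⟩
      refine ⟨{y | p y ≠ 1}, 0, fun y => 0, hU, by simp [hx], ?_⟩
      have hemb : IsEmbedding fun q : {y | p y ≠ 1} × (Fin 0 → ℂ) => (q.1 : X) :=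
        IsEmbedding.subtypeVal.comp (Homeomorph.prodUnique _ _).isEmbedding
      refine ⟨IsEmbedding.of_comp (hincl.continuous_iff.2 ?_) hbase hemb, ?_⟩
      · exact (hemb.continuous).prodMk continuous_const
      · convert hU.preimage hbase using 1
        ext t
        constructor
        · rintro ⟨q, rfl⟩
          exact q.1.2
        · intro ht
          obtain ⟨y, v⟩ := t
          have := hsub ⟨y, ht⟩
          exact ⟨(⟨y, ht⟩, 0), congrArg (Total.mk y) (Subsingleton.elim _ _)⟩
    · have hU : IsOpen {y | p y ≠ 0} := isOpen_ne.preimage p.continuous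
      have hmem : ∀ (y : {y | p y ≠ 0}) (c : ℂ),
          c ∈ LinearMap.eqLocus (p y • LinearMap.id : ℂ →ₗ[ℂ] ℂ) LinearMap.id := fun y c => by
        have h1 : p y = 1 := (hp01 y).resolve_left y.2
        simp [h1]
      refine ⟨{y | p y ≠ 0}, 1, fun y => (LinearEquiv.funUnique (Fin 1) ℂ ℂ).trans
        { toFun := fun c => ⟨c, hmem y c⟩
          invFun := fun v => v
          map_add' := fun _ _ => rfl
          map_smul' := fun _ _ => rfl
          left_inv := fun _ => rfl
          right_inv := fun _ => rfl }, hU, by simp [hx], ?_⟩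
      have hemb : IsEmbedding fun q : {y | p y ≠ 0} × (Fin 1 → ℂ) => ((q.1 : X), q.2 0) :=
        IsEmbedding.subtypeVal.prodMap (Homeomorph.funUnique (Fin 1) ℂ).isEmbedding
      refine ⟨IsEmbedding.of_comp (hincl.continuous_iff.2 hemb.continuous) hincl.continuous hemb, ?_⟩
      convert hU.preimage hbase using 1
      ext t
      constructor
      · rintro ⟨q, rfl⟩
        exact q.1.2
      · intro ht
        exact ⟨(⟨t.base, ht⟩, fun _ => t.vec), rfl⟩

variable (X) in
/-- Isomorphism of vector bundles as a setoid. -/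
def setoid : Setoid (CVect X) := ⟨Iso, Iso.refl, Iso.symm, Iso.trans⟩

end CVect

/-- The monoid `V(X)` of isomorphism classes of complex vector bundles. -/
def VTop (X : Type u) [TopologicalSpace X] : Type (max u 1) := Quotient (CVect.setoid X)

namespace VTop

variable {X : Type u} {Y : Type v} {Z : Type w} [TopologicalSpace X] [TopologicalSpace Y]
  [TopologicalSpace Z]

/-- The isomorphism class of a vector bundle. -/
def mk (E : CVect X) : VTop X := Quotient.mk (CVect.setoid X) E

theorem sound {E F : CVect X} (h : CVect.Iso E F) : mk E = mk F :=
  Quotient.sound (s := CVect.setoid X) h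

theorem ind {motive : VTop X → Prop} (h : ∀ E, motive (mk E)) (x : VTop X) : motive x :=
  Quotient.ind h x

instance : Add (VTop X) where
  add := Quotient.map₂ (sa := CVect.setoid X) (sb := CVect.setoid X) (sc := CVect.setoid X)
    CVect.directSum fun _ _ h _ _ h' => h.directSum h'

instance : Zero (VTop X) := ⟨mk (CVect.zeroBundle X)⟩

theorem mk_add_mk (E F : CVect X) : mk E + mk F = mk (E.directSum F) := rfl

protected theorem add_comm (x y : VTop X) : x + y = y + x := by
  induction x using ind with | _ E
  induction y using ind with | _ F
  exact sound (CVect.iso_directSum_comm E F)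

protected theorem zero_add (x : VTop X) : 0 + x = x := by
  induction x using ind with | _ E
  exact sound (CVect.iso_zero_directSum E)

instance : AddCommMonoid (VTop X) where
  add_assoc x y z := by
    induction x using ind with | _ E
    induction y using ind with | _ F
    induction z using ind with | _ G
    exact sound (CVect.iso_directSum_assoc E F G)
  zero_add := VTop.zero_add
  add_zero x := by rw [VTop.add_comm, VTop.zero_add]
  add_comm := VTop.add_comm
  nsmul := nsmulRec

/-- Pullback of isomorphism classes of vector bundles. -/
def map (f : C(Y, X)) : VTop X →+ VTop Y where
  toFun := Quotient.map (sa := CVect.setoid X) (sb := CVect.setoid Y) (CVect.pullback f)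
    fun _ _ h => h.pullback f
  map_zero' := sound (CVect.iso_pullback_zero f)
  map_add' x y := by
    induction x using ind with | _ E
    induction y using ind with | _ F
    exact sound (CVect.iso_pullback_directSum f E F)

end VTop

/-- The topological K-group of `X`: the universal group of the monoid of isomorphism classes of
complex vector bundles. -/
abbrev KTop (X : Type u) [TopologicalSpace X] : Type (max u 1) :=
  Algebra.GrothendieckAddGroup (VTop X)

namespace KTop

variable {X : Type u} {Y : Type v} {Z : Type w} [TopologicalSpace X] [TopologicalSpace Y]
  [TopologicalSpace Z]

/-- The class of a vector bundle. -/
def mk (E : CVect X) : KTop X := Algebra.GrothendieckAddGroup.of (VTop.mk E)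

/-- The homomorphism induced by a continuous map, by pullback of vector bundles. -/
def map (f : C(Y, X)) : KTop X →+ KTop Y :=
  Algebra.GrothendieckAddGroup.lift (Algebra.GrothendieckAddGroup.of.comp (VTop.map f))

theorem map_mk (f : C(Y, X)) (E : CVect X) : map f (mk E) = mk (E.pullback f) :=
  DFunLike.congr_fun (Algebra.GrothendieckAddGroup.lift.symm_apply_apply
    (Algebra.GrothendieckAddGroup.of.comp (VTop.map f))) (VTop.mk E)

theorem hom_ext {G : Type*} [AddCommGroup G] {f g : KTop X →+ G} (h : ∀ E, f (mk E) = g (mk E)) :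
    f = g := by
  refine Algebra.GrothendieckAddGroup.lift.symm.injective (AddMonoidHom.ext fun x => ?_)
  induction x using VTop.ind with | _ E
  exact h E

theorem map_id : map (ContinuousMap.id X) = AddMonoidHom.id (KTop X) :=
  hom_ext fun E => by
    rw [map_mk]
    exact congrArg Algebra.GrothendieckAddGroup.of (VTop.sound (CVect.iso_pullback_id E))

theorem map_comp (f : C(Y, X)) (g : C(Z, Y)) : map (f.comp g) = (map g).comp (map f) :=
  hom_ext fun E => by
    rw [AddMonoidHom.comp_apply, map_mk, map_mk, map_mk]
    exact congrArg Algebra.GrothendieckAddGroup.of (VTop.sound (CVect.iso_pullback_comp f g E))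

end KTop

/-! ### The diagram of finite-dimensional commutative subalgebras and its colimit -/

/-- The objects of `S_f(A)`: the finite-dimensional, commutative, unital C*-subalgebras of `A`.
(Such *-subalgebras are automatically closed.) -/
structure Sf (A : Type u) [CStarAlgebra A] : Type u where
  alg : StarSubalgebra ℂ A
  comm : ∀ x ∈ alg, ∀ y ∈ alg, x * y = y * x
  finiteDimensional : FiniteDimensional ℂ alg

section Sf

variable {A : Type u} {B : Type v} {C : Type w} [CStarAlgebra A] [CStarAlgebra B] [CStarAlgebra C]

namespace Sf

instance (U : Sf A) : FiniteDimensional ℂ U.alg := U.finiteDimensional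
instance (U : Sf A) : CompleteSpace U.alg := FiniteDimensional.complete ℂ U.alg

/-- The morphisms of `S_f(A)`: the maps `U → V` that are restrictions of inner automorphisms
`x ↦ w x w*` of `A`, with `w` unitary. -/
abbrev Hom (U V : Sf A) : Type u :=
  {f : U.alg →⋆ₐ[ℂ] V.alg // ∃ w ∈ unitary A, ∀ x : U.alg, (f x : A) = w * x * star w}

/-- The Gelfand spectrum of an object of `S_f(A)`. -/
abbrev Spec (U : Sf A) : Type u := WeakDual.characterSpace ℂ U.alg

/-- The map of Gelfand spectra induced by a *-homomorphism. -/
abbrev specMap {U : Sf A} {V : Sf B} (f : U.alg →⋆ₐ[ℂ] V.alg) : C(V.Spec, U.Spec) :=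
  WeakDual.CharacterSpace.compContinuousMap f

/-- The functor `S_f(A) → S_f(B)` induced by a unital *-homomorphism, `U ↦ φ(U)`. -/
def image (φ : A →⋆ₐ[ℂ] B) (U : Sf A) : Sf B where
  alg := U.alg.map φ
  comm := by
    rintro _ ⟨x, hx, rfl⟩ _ ⟨y, hy, rfl⟩
    show φ x * φ y = φ y * φ x
    rw [← map_mul, U.comm x hx y hy, map_mul]
  finiteDimensional := by
    have h : FiniteDimensional ℂ (U.alg.toSubalgebra.toSubmodule.map (φ : A →ₗ[ℂ] B)) := by
      have : FiniteDimensional ℂ U.alg.toSubalgebra.toSubmodule := U.finiteDimensional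
      infer_instance
    exact h

/-- The restriction `U → φ(U)` of `φ`. -/
def restrict (φ : A →⋆ₐ[ℂ] B) (U : Sf A) : U.alg →⋆ₐ[ℂ] (U.image φ).alg :=
  (φ.comp U.alg.subtype).codRestrict (U.alg.map φ) fun x => ⟨x, x.2, rfl⟩

end Sf

/-- The topological K-functor evaluated along the Gelfand spectra of `S_f(A)`, on objects. -/
abbrev KSpec (U : Sf A) : Type (max u 1) := KTop U.Spec

open Classical in
/-- The relations defining the colimit: `x` in the group of `U` is identified with its image in the
group of `V`, for every morphism `U → V`. -/
def colimRel (A : Type u) [CStarAlgebra A] : AddSubgroup (DirectSum (Sf A) KSpec) :=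
  AddSubgroup.closure {d | ∃ (U V : Sf A) (f : Sf.Hom U V) (x : KSpec U),
    d = DirectSum.of KSpec U x - DirectSum.of KSpec V (KTop.map (Sf.specMap f.1) x)}

/-- The colimit of the topological K-functor over the diagram `G_f(A)` of the Gelfand spectra of
the finite-dimensional commutative unital C*-subalgebras of `A`. -/
def Kf (A : Type u) [CStarAlgebra A] : Type (max u 1) := DirectSum (Sf A) KSpec ⧸ colimRel A

namespace Kf

instance : AddCommGroup (Kf A) :=
  inferInstanceAs (AddCommGroup (DirectSum (Sf A) KSpec ⧸ colimRel A))

open Classical in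
/-- The canonical map of the colimit. -/
def ι (U : Sf A) : KSpec U →+ Kf A :=
  (QuotientAddGroup.mk' (colimRel A)).comp (DirectSum.of KSpec U)

theorem ι_map {U V : Sf A} (f : Sf.Hom U V) (x : KSpec U) :
    ι V (KTop.map (Sf.specMap f.1) x) = ι U x := by
  refine (QuotientAddGroup.eq_iff_sub_mem.2 ?_).symm
  exact AddSubgroup.subset_closure ⟨U, V, f, x, rfl⟩

open Classical in
/-- The universal property of the colimit. -/
def lift {G : Type*} [AddCommGroup G] (g : ∀ U : Sf A, KSpec U →+ G)
    (hg : ∀ (U V : Sf A) (f : Sf.Hom U V) x, g V (KTop.map (Sf.specMap f.1) x) = g U x) :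
    Kf A →+ G :=
  QuotientAddGroup.lift (colimRel A) (DirectSum.toAddMonoid g) <| by
    rw [colimRel, AddSubgroup.closure_le]
    rintro _ ⟨U, V, f, x, rfl⟩
    show DirectSum.toAddMonoid g _ = 0
    rw [map_sub, DirectSum.toAddMonoid_of, DirectSum.toAddMonoid_of, hg, sub_self]

theorem lift_ι {G : Type*} [AddCommGroup G] (g : ∀ U : Sf A, KSpec U →+ G)
    (hg : ∀ (U V : Sf A) (f : Sf.Hom U V) x, g V (KTop.map (Sf.specMap f.1) x) = g U x)
    (U : Sf A) (x : KSpec U) : lift g hg (ι U x) = g U x := by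
  classical
  exact DirectSum.toAddMonoid_of _ _ _

theorem hom_ext {G : Type*} [AddCommGroup G] {f g : Kf A →+ G}
    (h : ∀ U x, f (ι U x) = g (ι U x)) : f = g := by
  classical
  refine QuotientAddGroup.addMonoidHom_ext _ (DirectSum.addHom_ext fun U x => h U x)

/-- The action of `φ` on a morphism of `S_f(A)`: the restriction of conjugation by `w` goes to the
restriction of conjugation by `φ(w)`. -/
theorem exists_hom_image (φ : A →⋆ₐ[ℂ] B) {U V : Sf A} (f : Sf.Hom U V) :
    ∃ g : Sf.Hom (U.image φ) (V.image φ),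
      g.1.comp (U.restrict φ) = (V.restrict φ).comp f.1 := by
  obtain ⟨f, w, hw, hf⟩ := f
  have hw' : φ w ∈ unitary B := Unitary.map_mem φ hw
  have hmem : ∀ y : (U.image φ).alg, φ w * y * star (φ w) ∈ (V.image φ).alg := by
    rintro ⟨_, x, hx, rfl⟩
    refine ⟨f ⟨x, hx⟩, (f ⟨x, hx⟩).2, ?_⟩
    have := congrArg φ (hf ⟨x, hx⟩)
    rw [map_mul, map_mul, map_star] at this
    exact this
  refine ⟨⟨(((Unitary.conjStarAlgAut ℂ B ⟨φ w, hw'⟩ : B ≃⋆ₐ[ℂ] B) : B →⋆ₐ[ℂ] B).comp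
    (U.image φ).alg.subtype).codRestrict _ hmem, φ w, hw', fun x => rfl⟩, ?_⟩
  refine StarAlgHom.ext fun x => Subtype.ext ?_
  have := congrArg φ (hf x)
  rw [map_mul, map_mul, map_star] at this
  exact this.symm

theorem specMap_comp {U : Sf A} {V : Sf B} {W : Sf C} (g : V.alg →⋆ₐ[ℂ] W.alg)
    (f : U.alg →⋆ₐ[ℂ] V.alg) :
    Sf.specMap (g.comp f) = (Sf.specMap f).comp (Sf.specMap g) := rfl

/-- The homomorphism of colimits induced by a unital *-homomorphism. -/
def map (φ : A →⋆ₐ[ℂ] B) : Kf A →+ Kf B :=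
  lift (fun U => (ι (U.image φ)).comp (KTop.map (Sf.specMap (U.restrict φ)))) fun U V f x => by
    obtain ⟨g, hg⟩ := exists_hom_image φ f
    have h1 : KTop.map (Sf.specMap (V.restrict φ)) (KTop.map (Sf.specMap f.1) x) =
        KTop.map (Sf.specMap g.1) (KTop.map (Sf.specMap (U.restrict φ)) x) := by
      rw [← AddMonoidHom.comp_apply, ← AddMonoidHom.comp_apply, ← KTop.map_comp, ← KTop.map_comp,
        ← specMap_comp, ← specMap_comp, hg]
    rw [AddMonoidHom.comp_apply, AddMonoidHom.comp_apply, h1, ι_map g]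

theorem map_ι (φ : A →⋆ₐ[ℂ] B) (U : Sf A) (x : KSpec U) :
    map φ (ι U x) = ι (U.image φ) (KTop.map (Sf.specMap (U.restrict φ)) x) := lift_ι _ _ _ _

/-- The class of an element of the group of `U` does not change under an inclusion. -/
theorem ι_incl {U V : Sf A} (f : U.alg →⋆ₐ[ℂ] V.alg) (hf : ∀ x, (f x : A) = x) (x : KSpec U) :
    ι V (KTop.map (Sf.specMap f) x) = ι U x :=
  ι_map ⟨f, 1, one_mem _, fun y => by rw [hf, one_mul, star_one, mul_one]⟩ x

theorem map_id : map (StarAlgHom.id ℂ A) = AddMonoidHom.id (Kf A) :=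
  hom_ext fun U x => by
    rw [map_ι]
    exact ι_incl (U.restrict (StarAlgHom.id ℂ A)) (fun _ => rfl) x

theorem map_comp (ψ : B →⋆ₐ[ℂ] C) (φ : A →⋆ₐ[ℂ] B) : map (ψ.comp φ) = (map ψ).comp (map φ) :=
  hom_ext fun U x => by
    rw [AddMonoidHom.comp_apply, map_ι, map_ι, map_ι]
    have hmem : ∀ y : (U.image (ψ.comp φ)).alg, (y : C) ∈ ((U.image φ).image ψ).alg := by
      rintro ⟨_, y, hy, rfl⟩
      exact ⟨φ y, ⟨y, hy, rfl⟩, rfl⟩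
    let j : (U.image (ψ.comp φ)).alg →⋆ₐ[ℂ] ((U.image φ).image ψ).alg :=
      (U.image (ψ.comp φ)).alg.subtype.codRestrict _ hmem
    have h1 : KTop.map (Sf.specMap ((U.image φ).restrict ψ))
          (KTop.map (Sf.specMap (U.restrict φ)) x) =
        KTop.map (Sf.specMap j) (KTop.map (Sf.specMap (U.restrict (ψ.comp φ))) x) := by
      rw [← AddMonoidHom.comp_apply, ← AddMonoidHom.comp_apply, ← KTop.map_comp, ← KTop.map_comp,
        ← specMap_comp, ← specMap_comp]
      rfl
    rw [h1, ι_incl j fun _ => rfl]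

end Kf

/-- The extension of `Kf` to a possibly non-unital C*-algebra `B`: the kernel of
`Kf(B⁺) → Kf(ℂ)`. -/
def Kfnu (B : Type u) [NonUnitalCStarAlgebra B] : AddSubgroup (Kf (Unitization ℂ B)) :=
  (Kf.map (scalarHom B)).ker

/-- The homomorphism `Kfnu(φ)` for a *-homomorphism of possibly non-unital C*-algebras. -/
def Kfnu.map {B : Type u} {C : Type v} [NonUnitalCStarAlgebra B] [NonUnitalCStarAlgebra C]
    (φ : B →⋆ₙₐ[ℂ] C) : Kfnu B →+ Kfnu C :=
  ((Kf.map (Unitization.starMap φ)).comp (Kfnu B).subtype).codRestrict (Kfnu C) fun x => by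
    have h : Kf.map (scalarHom B) x = 0 := x.2
    rw [← scalarHom_starMap φ, Kf.map_comp] at h
    exact h

/-- The two-parameter family `a p + b (1 - p)`. -/
def Sf.span (p : A) : ℂ × ℂ →ₗ[ℂ] A :=
  (LinearMap.toSpanSingleton ℂ A p).coprod (LinearMap.toSpanSingleton ℂ A (1 - p))

theorem Sf.span_apply (p : A) (a b : ℂ) : Sf.span p (a, b) = a • p + b • (1 - p) := rfl

theorem Sf.span_mul {p : A} (hp : IsStarProjection p) (a b c d : ℂ) :
    Sf.span p (a, b) * Sf.span p (c, d) = Sf.span p (a * c, b * d) := by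
  have h1 : p * p = p := hp.isIdempotentElem.eq
  have h2 : p * (1 - p) = 0 := by rw [mul_sub, mul_one, h1, sub_self]
  have h3 : (1 - p) * p = 0 := by rw [sub_mul, one_mul, h1, sub_self]
  have h4 : (1 - p) * (1 - p) = 1 - p := by rw [mul_sub, h3, mul_one, sub_zero]
  simp only [Sf.span_apply, add_mul, mul_add, smul_mul_smul_comm, h1, h2, h3, h4, smul_zero,
    add_zero, zero_add]

/-- The subalgebra `ℂ p + ℂ (1 - p)` generated by a projection `p` of a unital C*-algebra. -/
def Sf.ofProj (p : A) (hp : IsStarProjection p) : Sf A where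
  alg :=
    { carrier := Set.range (Sf.span p)
      mul_mem' := by
        rintro _ _ ⟨⟨a, b⟩, rfl⟩ ⟨⟨c, d⟩, rfl⟩
        exact ⟨(a * c, b * d), (Sf.span_mul hp a b c d).symm⟩
      add_mem' := by
        rintro _ _ ⟨x, rfl⟩ ⟨y, rfl⟩
        exact ⟨x + y, map_add _ _ _⟩
      algebraMap_mem' := fun r => ⟨(r, r), by
        rw [Sf.span_apply, ← smul_add, add_sub_cancel, Algebra.algebraMap_eq_smul_one]⟩
      star_mem' := by
        rintro _ ⟨⟨a, b⟩, rfl⟩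
        refine ⟨(star a, star b), ?_⟩
        rw [Sf.span_apply, Sf.span_apply, star_add, star_smul, star_smul, star_sub, star_one,
          hp.isSelfAdjoint.star_eq] }
  comm := by
    rintro _ ⟨⟨a, b⟩, rfl⟩ _ ⟨⟨c, d⟩, rfl⟩
    rw [Sf.span_mul hp, Sf.span_mul hp, mul_comm a, mul_comm b]
  finiteDimensional := by
    have h : FiniteDimensional ℂ (LinearMap.range (Sf.span p)) := inferInstance
    exact h

/-- The projection `p` as an element of `ℂ p + ℂ (1 - p)`. -/
def Sf.projElem (p : A) (hp : IsStarProjection p) : (Sf.ofProj p hp).alg :=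
  ⟨p, (1, 0), by rw [Sf.span_apply, one_smul, zero_smul, add_zero]⟩

theorem Sf.projElem_mul_self (p : A) (hp : IsStarProjection p) :
    Sf.projElem p hp * Sf.projElem p hp = Sf.projElem p hp :=
  Subtype.ext hp.isIdempotentElem.eq

/-- The Gelfand transform of `p`, as a function on the spectrum of `ℂ p + ℂ (1 - p)`. -/
def Sf.projFun (p : A) (hp : IsStarProjection p) : C((Sf.ofProj p hp).Spec, ℂ) :=
  ⟨fun χ => χ (Sf.projElem p hp), map_continuous (WeakDual.gelfandTransform ℂ _ (Sf.projElem p hp))⟩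

theorem Sf.projFun_mul_self (p : A) (hp : IsStarProjection p) :
    Sf.projFun p hp * Sf.projFun p hp = Sf.projFun p hp :=
  ContinuousMap.ext fun χ => (map_mul χ _ _).symm.trans (congrArg χ (Sf.projElem_mul_self p hp))

/-- The class `[(p)]` of a projection `p` of a unital C*-algebra: the class, in the colimit, of the
vector bundle over the spectrum of `ℂ p + ℂ (1 - p)` that has rank one over the characters `χ` with
`χ(p) = 1` and rank zero over those with `χ(p) = 0`. -/
def Kf.proj (p : A) (hp : IsStarProjection p) : Kf A :=
  Kf.ι (Sf.ofProj p hp) (KTop.mk (CVect.ofIdempotent (Sf.projFun p hp) (Sf.projFun_mul_self p hp)))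

/-- The class `[(P)]` in `Kf(B⁺)` of a projection `P` of a possibly non-unital C*-algebra `B`. -/
def Kf.projInr {B : Type u} [NonUnitalCStarAlgebra B] (P : Proj B) : Kf (Unitization ℂ B) :=
  Kf.proj (P : Unitization ℂ B) (P.2.map (Unitization.inrNonUnitalStarAlgHom ℂ B))

end Sf

end OpK

end

noncomputable section

namespace OpK

/-! ### Vector bundles over discrete spaces -/

namespace CVect

variable {X : Type u} [TopologicalSpace X]

/-! The comparison with `Kf`. The spectrum of a finite-dimensional commutative C*-algebra `U` is
finite and discrete, so a vector bundle on it amounts to its rank function, and K(Σ(U)) is free on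
the points of the spectrum, that is, on the minimal projections of `U`. Along a morphism x ↦ wxw*
the class of a minimal projection e goes to that of wew*, decomposed into minimal projections of the
target. Hence `Kf D` is the universal group on the projections of D subject to additivity on
orthogonal pairs and invariance under unitary conjugation: the classes [(p)] satisfy these relations
(`Kf.proj_add`, `Kf.proj_conj`) and generate (`Kf.hom_ext_proj`), and every function with the two
properties extends to the colimit (`IsDimension.lift`, `IsDimension.lift_proj`).

For B = A ⊗ 𝒦, a projection of B⁺ is p or 1 − p with p in B. The relations that define V(A) hold
among the classes [(p)], so [P] ↦ [(P)] is a homomorphism, `etaHom`. Conversely p ↦ [p], 1 − p ↦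
−[p] is a dimension function (`isDimension_relDim`). The map it induces is a left inverse of
`etaHom`, and the composite in the other order is x ↦ x − dim(π x)·[(1)] (`etaHom_lift_relDim`),
which is x on the kernel of π.

Stability. Put D = (A ⊗ 𝒦)⁺. The inverse of θ is induced by P ↦ P ⊗ e₀₀ (`K0stabIncl`). That a ↦ a ⊗
e₀₀ identifies D isometrically with a corner of D ⊗ 𝒦 needs a lower bound for the maximal norm,
which comes from a C*-seminorm built out of matrix compressions (`limSeminorm`,
`norm_le_norm_tmul_matUnit`). The way back uses a `Frame`: with e_N = 1 ⊗ `trunc N`, partial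
isometries S_i in A ⊗ 𝒦 with initial projection e_N and orthogonal ranges. The map `toBase`, y ↦ ∑
S_i y_ij S_j*, carries matrices over D into A ⊗ 𝒦 and is multiplicative on matrices that commute
with e_N ⊗ 1_m. As D is the scalars plus A ⊗ 𝒦, on which e_N is an approximate unit, every m × m
matrix asymptotically commutes with e_N ⊗ 1_m (`tendsto_commutator_diag`).

Injectivity: if p ⊗ e₀₀ and q ⊗ e₀₀ are stably equivalent over D, a partial isometry v joins
diag(1_n, p) to diag(1_n, q). For large N, `toBase` sends v to an approximate partial isometry,
which is corrected to an exact one; its end projections are c + S_n p S_n* and c + S_n q S_n* with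
the same c in A ⊗ 𝒦, so [c] + [p] = [c] + [q] in V(A).

Surjectivity: an element of the kernel is [R] − [1_n], where R can be conjugated to have scalar part
exactly 1_n. For large N, (1 − e_N) ⊗ 1_n is equivalent to a projection G ≤ R. The scalar part of G
lies below 1_n and is equivalent to it, hence equals it because matrix algebras are finite. So R − G
and e_N ⊗ 1_n have no scalar part; both come from A ⊗ 𝒦 (`V.exists_stabIncl_of_map_eq_zero`), and
their difference is the given element. -/

theorem finiteDimensional_fiber (E : CVect X) (x : X) : FiniteDimensional ℂ (E.fiber x) := by
  obtain ⟨U, n, φ, -, hx, -⟩ := E.locally_trivial x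
  exact (φ ⟨x, hx⟩).finiteDimensional

instance (E : CVect X) (x : X) : FiniteDimensional ℂ (E.fiber x) := E.finiteDimensional_fiber x

/-- The rank of a vector bundle, as a function on the base. -/
def rank (E : CVect X) (x : X) : ℕ := Module.finrank ℂ (E.fiber x)

theorem Iso.rank_eq {E F : CVect X} (h : Iso E F) : E.rank = F.rank := by
  obtain ⟨φ, -, -⟩ := h
  exact funext fun x => (φ x).finrank_eq

theorem rank_directSum (E F : CVect X) : (E.directSum F).rank = E.rank + F.rank :=
  funext fun _ => Module.finrank_prod

theorem rank_zeroBundle : (zeroBundle X).rank = 0 :=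
  funext fun _ => Module.finrank_zero_of_subsingleton (R := ℂ) (M := PUnit)

theorem rank_pullback {Y : Type v} [TopologicalSpace Y] (f : C(Y, X)) (E : CVect X) (y : Y) :
    (E.pullback f).rank y = E.rank (f y) := rfl

theorem rank_ofIdempotent_of_eq_one {p : C(X, ℂ)} (hp : p * p = p) {x : X} (hx : p x = 1) :
    (ofIdempotent p hp).rank x = 1 := by
  have : LinearMap.eqLocus (p x • LinearMap.id : ℂ →ₗ[ℂ] ℂ) LinearMap.id = ⊤ := by
    rw [hx, one_smul]; exact LinearMap.eqLocus_same _
  show Module.finrank ℂ (LinearMap.eqLocus (p x • LinearMap.id : ℂ →ₗ[ℂ] ℂ) LinearMap.id) = 1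
  rw [this, finrank_top, Module.finrank_self]

theorem rank_ofIdempotent_of_eq_zero {p : C(X, ℂ)} (hp : p * p = p) {x : X} (hx : p x = 0) :
    (ofIdempotent p hp).rank x = 0 := by
  have : LinearMap.eqLocus (p x • LinearMap.id : ℂ →ₗ[ℂ] ℂ) LinearMap.id = ⊥ := by
    rw [hx, zero_smul, eq_bot_iff]
    intro v hv
    have : (0 : ℂ) = v := hv
    exact this.symm
  show Module.finrank ℂ (LinearMap.eqLocus (p x • LinearMap.id : ℂ →ₗ[ℂ] ℂ) LinearMap.id) = 0
  rw [this, finrank_bot]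

/-- Over a discrete space, every fibrewise linear map is continuous. -/
theorem continuous_totalMap [DiscreteTopology X] (E F : CVect X)
    (ψ : ∀ x, E.fiber x →ₗ[ℂ] F.fiber x) :
    Continuous (totalMap fun x => ψ x : Total E.fiber → Total F.fiber) := by
  rw [continuous_iff_continuousAt]
  rintro ⟨x, v⟩
  obtain ⟨U, n, φ, hU, hx, he⟩ := E.locally_trivial x
  obtain ⟨w, rfl⟩ := (φ ⟨x, hx⟩).surjective v
  refine (he.continuousAt_iff (x := (⟨x, hx⟩, w))).1 (Continuous.continuousAt ?_)
  -- The base is discrete, so continuity is checked on each fibre separately; there, in local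
  -- trivializations, the map is linear between finite-dimensional spaces.
  refine continuous_prod_of_discrete_left.2 fun y => ?_
  obtain ⟨U', n', φ', hU', hx', he'⟩ := F.locally_trivial y
  let L : (Fin n → ℂ) →ₗ[ℂ] (Fin n' → ℂ) :=
    (φ' ⟨y, hx'⟩).symm.toLinearMap ∘ₗ ψ y ∘ₗ (φ y).toLinearMap
  have hL : Continuous L := LinearMap.continuous_of_finiteDimensional L
  have h := he'.continuous.comp ((Continuous.prodMk_right (⟨y, hx'⟩ : U')).comp hL)
  refine h.congr fun w => ?_
  show (⟨(y : X), φ' ⟨y, hx'⟩ ((φ' ⟨y, hx'⟩).symm (ψ y (φ y w)))⟩ : Total F.fiber) = _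
  rw [LinearEquiv.apply_symm_apply]
  rfl

/-- Any pointwise choice of linear isomorphisms is a bundle isomorphism, because fibrewise linear
maps over a discrete base are automatically continuous. -/
theorem iso_iff_rank_eq [DiscreteTopology X] {E F : CVect X} : Iso E F ↔ E.rank = F.rank := by
  refine ⟨Iso.rank_eq, fun h => ?_⟩
  let φ : ∀ x, E.fiber x ≃ₗ[ℂ] F.fiber x := fun x =>
    LinearEquiv.ofFinrankEq _ _ (congrFun h x)
  exact ⟨φ, continuous_totalMap E F fun x => (φ x).toLinearMap,
    continuous_totalMap F E fun x => (φ x).symm.toLinearMap⟩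

end CVect

namespace VTop

variable {X : Type u} [TopologicalSpace X]

/-- The rank of an isomorphism class of vector bundles. -/
def rank : VTop X →+ (X → ℕ) where
  toFun := Quotient.lift (s := CVect.setoid X) CVect.rank fun _ _ h => CVect.Iso.rank_eq h
  map_zero' := CVect.rank_zeroBundle
  map_add' x y := by
    induction x using ind with | _ E
    induction y using ind with | _ F
    exact CVect.rank_directSum E F

theorem rank_mk (E : CVect X) : rank (mk E) = E.rank := rfl

end VTop

namespace KTop

variable {X : Type u} [TopologicalSpace X]

theorem mk_eq_mk [DiscreteTopology X] {E F : CVect X} (h : E.rank = F.rank) : mk E = mk F :=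
  congrArg Algebra.GrothendieckAddGroup.of (VTop.sound (CVect.iso_iff_rank_eq.2 h))

theorem mk_directSum (E F : CVect X) : mk (E.directSum F) = mk E + mk F :=
  map_add Algebra.GrothendieckAddGroup.of (VTop.mk E) (VTop.mk F)

end KTop

/-! ### Spectra of finite-dimensional commutative C*-algebras -/

namespace Sf

variable {A : Type u} [CStarAlgebra A] (U : Sf A)

instance : CommCStarAlgebra U.alg where
  mul_comm x y := Subtype.ext (U.comm x x.2 y y.2)

/-- Distinct characters are linearly independent (Dedekind), and they live in the dual of a
finite-dimensional space. -/
instance : Finite U.Spec := by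
  have h := linearIndependent_monoidHom U.alg ℂ
  have h2 : LinearIndependent ℂ
      (fun χ : U.Spec => (WeakDual.CharacterSpace.toAlgHom χ : U.alg →ₐ[ℂ] ℂ).toLinearMap) := by
    have h3 := h.comp
      (fun χ : U.Spec => ((WeakDual.CharacterSpace.toAlgHom χ : U.alg →ₐ[ℂ] ℂ) : U.alg →* ℂ))
      fun χ χ' hh => WeakDual.CharacterSpace.ext fun x => DFunLike.congr_fun hh x
    exact LinearIndependent.of_comp (LinearMap.ltoFun ℂ U.alg ℂ ℂ) h3
  exact h2.finite

instance : DiscreteTopology U.Spec := inferInstance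

theorem ext_spec {x y : U.alg} (h : ∀ χ : U.Spec, χ x = χ y) : x = y :=
  (gelfandTransform_bijective U.alg).1 (ContinuousMap.ext h)

/-- The element of `U` whose Gelfand transform is the indicator function of `S`. -/
def indicator (S : Set U.Spec) : U.alg :=
  (gelfandStarTransform U.alg).symm ⟨S.indicator 1, continuous_of_discreteTopology⟩

open Classical in
theorem apply_indicator (S : Set U.Spec) (χ : U.Spec) :
    χ (U.indicator S) = if χ ∈ S then 1 else 0 := by
  have : gelfandStarTransform U.alg (U.indicator S) χ = S.indicator 1 χ := by
    rw [indicator, StarAlgEquiv.apply_symm_apply]; rfl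
  exact this.trans (by simp [Set.indicator_apply])

/-- A character takes only the values 0 and 1 on an idempotent. Thus the projections of `U`
correspond to the subsets of its spectrum, and the minimal ones to the points. -/
theorem eq_indicator {p : U.alg} (hp : p * p = p) : p = U.indicator {χ | χ p = 1} := by
  classical
  refine U.ext_spec fun χ => ?_
  rw [apply_indicator]
  have h : χ p * χ p = χ p := by rw [← map_mul, hp]
  rcases eq_or_ne (χ p) 1 with h1 | h1
  · simp [h1]
  · have h0 : χ p = 0 := by_contra fun h0 => h1 (mul_left_cancel₀ h0 (by rw [h, mul_one]))
    simp [h0]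

theorem isStarProjection_indicator (S : Set U.Spec) : IsStarProjection (U.indicator S : A) := by
  classical
  have h : IsStarProjection (U.indicator S) := by
    refine ⟨U.ext_spec fun χ => ?_, U.ext_spec fun χ => ?_⟩
    · rw [map_mul, apply_indicator]; split_ifs <;> simp
    · rw [map_star, apply_indicator]; split_ifs <;> simp
  exact h.map U.alg.subtype

theorem indicator_union {S T : Set U.Spec} (h : Disjoint S T) :
    U.indicator (S ∪ T) = U.indicator S + U.indicator T := by
  classical
  refine U.ext_spec fun χ => ?_
  rw [map_add, apply_indicator, apply_indicator, apply_indicator]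
  by_cases h1 : χ ∈ S <;> by_cases h2 : χ ∈ T
  · exact absurd h2 (Set.disjoint_left.1 h h1)
  all_goals simp [h1, h2]

theorem indicator_mul {S T : Set U.Spec} (h : Disjoint S T) :
    U.indicator S * U.indicator T = 0 := by
  classical
  refine U.ext_spec fun χ => ?_
  rw [map_mul, map_zero, apply_indicator, apply_indicator]
  by_cases h1 : χ ∈ S <;> by_cases h2 : χ ∈ T
  · exact absurd h2 (Set.disjoint_left.1 h h1)
  all_goals simp [h1, h2]

theorem indicator_empty : U.indicator ∅ = 0 := by
  classical
  exact U.ext_spec fun χ => by rw [map_zero, apply_indicator]; simp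

end Sf

/-! ### The universal property of the colimit -/

section KfUniversal

variable {A : Type u} {B : Type v} [CStarAlgebra A] [CStarAlgebra B] {G : Type*} [AddCommGroup G]

/-- The projection of `A` whose Gelfand transform is the indicator function of `S`. -/
def Sf.proj (U : Sf A) (S : Set U.Spec) : Proj A := ⟨U.indicator S, U.isStarProjection_indicator S⟩

theorem Sf.coe_proj (U : Sf A) (S : Set U.Spec) : (U.proj S : A) = U.indicator S := rfl

instance (U : Sf A) : Fintype U.Spec := Fintype.ofFinite _

/-- An abstract dimension function: additive on orthogonal projections and invariant under
conjugation by unitaries. -/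
structure IsDimension (d : Proj A → G) : Prop where
  add : ∀ (p q : Proj A) (h : (p : A) * q = 0), d (p.add q h) = d p + d q
  conj : ∀ (p q : Proj A), ∀ w ∈ unitary A, (q : A) = w * p * star w → d q = d p

namespace IsDimension

variable {d : Proj A → G}

theorem zero (hd : IsDimension d) : d (V.zeroProj A) = 0 := by
  have h := hd.add (V.zeroProj A) (V.zeroProj A) (mul_zero _)
  have h2 : (V.zeroProj A).add (V.zeroProj A) (mul_zero _) = V.zeroProj A :=
    Subtype.ext (add_zero _)
  rw [h2] at h
  exact left_eq_add.1 h

/-- The projections of distinct points are orthogonal, so additivity of `d` reduces every projection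
of `U` to minimal ones. -/
theorem proj_eq_sum (hd : IsDimension d) (U : Sf A) (S : Finset U.Spec) :
    d (U.proj S) = ∑ χ ∈ S, d (U.proj {χ}) := by
  classical
  induction S using Finset.induction_on with
  | empty =>
    rw [Finset.sum_empty, ← hd.zero]
    congr 1
    exact Subtype.ext (by simp [Sf.proj, Sf.indicator_empty, V.zeroProj])
  | insert χ S h ih =>
    have hdis : Disjoint ({χ} : Set U.Spec) (S : Set U.Spec) := by simpa using h
    rw [Finset.sum_insert h, ← ih,
      ← hd.add _ _ (congrArg Subtype.val (U.indicator_mul hdis))]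
    congr 1
    refine Subtype.ext ?_
    have := congrArg Subtype.val (U.indicator_union hdis)
    rw [Set.singleton_union, ← Finset.coe_insert] at this
    exact this

/-- The map on the K-group of the spectrum of `U` that is determined by a dimension function. -/
def onSpec (d : Proj A → G) (U : Sf A) : KSpec U →+ G :=
  Algebra.GrothendieckAddGroup.lift
    { toFun := fun x => ∑ χ, VTop.rank x χ • d (U.proj {χ})
      map_zero' := by simp
      map_add' := fun x y => by simp [add_smul, Finset.sum_add_distrib] }

theorem onSpec_mk (U : Sf A) (E : CVect U.Spec) :
    onSpec d U (KTop.mk E) = ∑ χ, E.rank χ • d (U.proj {χ}) :=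
  DFunLike.congr_fun (Algebra.GrothendieckAddGroup.lift.symm_apply_apply _) (VTop.mk E)

/-- This is the compatibility with the colimit relations. The rank of the pullback is constant on
the fibres of the map of spectra. The minimal projections of `V` over a point χ add up to the image
under `f` of the minimal projection of χ, and this image is a unitary conjugate of it; additivity
and conjugation invariance of `d` finish the argument. -/
theorem onSpec_map (hd : IsDimension d) {U V : Sf A} (f : Sf.Hom U V) (x : KSpec U) :
    onSpec d V (KTop.map (Sf.specMap f.1) x) = onSpec d U x := by
  classical
  suffices h : (onSpec d V).comp (KTop.map (Sf.specMap f.1)) = onSpec d U from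
    DFunLike.congr_fun h x
  refine KTop.hom_ext fun E => ?_
  rw [AddMonoidHom.comp_apply, KTop.map_mk, onSpec_mk, onSpec_mk,
    -- The sum over the spectrum of `V` is grouped by the image point in the spectrum of `U`.
    ← Finset.sum_fiberwise Finset.univ (Sf.specMap f.1)]
  refine Finset.sum_congr rfl fun χ _ => ?_
  have h1 : ∑ ψ with Sf.specMap f.1 ψ = χ,
      (E.pullback (Sf.specMap f.1)).rank ψ • d (V.proj {ψ}) =
      ∑ ψ with Sf.specMap f.1 ψ = χ, E.rank χ • d (V.proj {ψ}) :=
    Finset.sum_congr rfl fun ψ hψ => by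
      rw [CVect.rank_pullback, (Finset.mem_filter.1 hψ).2]
  rw [h1, ← Finset.smul_sum, ← hd.proj_eq_sum]
  congr 1
  obtain ⟨w, hw, hf⟩ := f.2
  refine hd.conj _ _ w hw ?_
  have h2 : V.indicator ((Finset.univ.filter fun ψ => Sf.specMap f.1 ψ = χ : Finset V.Spec) :
      Set V.Spec) = f.1 (U.indicator {χ}) := by
    refine V.ext_spec fun ψ => ?_
    have h3 : ψ (f.1 (U.indicator {χ})) = Sf.specMap f.1 ψ (U.indicator {χ}) := rfl
    rw [h3, Sf.apply_indicator, Sf.apply_indicator]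
    simp
  rw [Sf.coe_proj, Sf.coe_proj, ← hf]
  exact congrArg Subtype.val h2

/-- The homomorphism on the colimit that is determined by a dimension function. -/
def lift (hd : IsDimension d) : Kf A →+ G := Kf.lift (onSpec d) fun _ _ f x => hd.onSpec_map f x

end IsDimension

namespace Kf

/-- The class of the subset of the spectrum on which a projection is one. -/
theorem proj_eq_ι {p : A} (hp : IsStarProjection p) {U : Sf A} (hpU : p ∈ U.alg)
    (E : CVect U.Spec) (h1 : ∀ χ : U.Spec, χ ⟨p, hpU⟩ = 1 → E.rank χ = 1)
    (h0 : ∀ χ : U.Spec, χ ⟨p, hpU⟩ = 0 → E.rank χ = 0) : proj p hp = ι U (KTop.mk E) := by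
  have hmem : ∀ x : (Sf.ofProj p hp).alg, (x : A) ∈ U.alg := by
    rintro ⟨_, ⟨a, b⟩, rfl⟩
    exact add_mem (SMulMemClass.smul_mem a hpU)
      (SMulMemClass.smul_mem b (sub_mem (one_mem _) hpU))
  -- The inclusion of ℂp + ℂ(1 − p) in `U` is conjugation by 1, hence a morphism of the diagram; the
  -- class can be pulled back to the spectrum of `U`, where comparing ranks suffices.
  rw [proj, ← ι_incl ((Sf.ofProj p hp).alg.subtype.codRestrict U.alg hmem) fun _ => rfl,
    KTop.map_mk]
  congr 1
  refine KTop.mk_eq_mk (funext fun χ => ?_)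
  rw [CVect.rank_pullback]
  have h : χ ⟨p, hpU⟩ * χ ⟨p, hpU⟩ = χ ⟨p, hpU⟩ := by
    rw [← map_mul]; congr 1; exact Subtype.ext hp.isIdempotentElem
  rcases eq_or_ne (χ ⟨p, hpU⟩) 0 with h2 | h2
  · rw [h0 χ h2]
    exact CVect.rank_ofIdempotent_of_eq_zero _ h2
  · have h3 : χ ⟨p, hpU⟩ = 1 := mul_left_cancel₀ h2 (by rw [h, mul_one])
    rw [h1 χ h3]
    exact CVect.rank_ofIdempotent_of_eq_one _ h3

/-- The line bundle over the subset of the spectrum where the idempotent `p` is one. -/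
def lineBundle {U : Sf A} (p : U.alg) (hp : p * p = p) : CVect U.Spec :=
  CVect.ofIdempotent (WeakDual.gelfandTransform ℂ U.alg p) (by rw [← map_mul, hp])

theorem rank_lineBundle_of_eq_one {U : Sf A} {p : U.alg} (hp : p * p = p) {χ : U.Spec}
    (h : χ p = 1) : (lineBundle p hp).rank χ = 1 := CVect.rank_ofIdempotent_of_eq_one _ h

theorem rank_lineBundle_of_eq_zero {U : Sf A} {p : U.alg} (hp : p * p = p) {χ : U.Spec}
    (h : χ p = 0) : (lineBundle p hp).rank χ = 0 := CVect.rank_ofIdempotent_of_eq_zero _ h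

theorem proj_eq_ι_lineBundle {p : A} (hp : IsStarProjection p) {U : Sf A} (hpU : p ∈ U.alg) :
    proj p hp = ι U (KTop.mk (lineBundle ⟨p, hpU⟩ (Subtype.ext hp.isIdempotentElem))) :=
  proj_eq_ι hp hpU _ (fun _ h => rank_lineBundle_of_eq_one _ h)
    fun _ h => rank_lineBundle_of_eq_zero _ h

theorem apply_eq_zero_or_one {U : Sf A} {p : U.alg} (hp : p * p = p) (χ : U.Spec) :
    χ p = 0 ∨ χ p = 1 := by
  have h : χ p * χ p = χ p := by rw [← map_mul, hp]
  rcases eq_or_ne (χ p) 0 with h2 | h2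
  · exact Or.inl h2
  · exact Or.inr (mul_left_cancel₀ h2 (by rw [h, mul_one]))

/-- The bundle obtained lives on the spectrum of the image algebra, which contains φ(p). Its ranks
are the values of the characters at φ(p), so it represents the class of φ(p). -/
theorem map_proj (φ : A →⋆ₐ[ℂ] B) {p : A} (hp : IsStarProjection p) :
    map φ (proj p hp) = proj (φ p) (hp.map φ) := by
  have hpU : p ∈ (Sf.ofProj p hp).alg := (Sf.projElem p hp).2
  have hpU' : φ p ∈ ((Sf.ofProj p hp).image φ).alg := ⟨p, hpU, rfl⟩
  have hf : (Sf.ofProj p hp).restrict φ (Sf.projElem p hp) = ⟨φ p, hpU'⟩ := rfl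
  rw [proj, map_ι, KTop.map_mk]
  refine (proj_eq_ι (hp.map φ) hpU' _ (fun χ h => ?_) fun χ h => ?_).symm
  · rw [CVect.rank_pullback]
    refine CVect.rank_ofIdempotent_of_eq_one (Sf.projFun_mul_self p hp) ?_
    exact (congrArg χ hf).trans h
  · rw [CVect.rank_pullback]
    refine CVect.rank_ofIdempotent_of_eq_zero (Sf.projFun_mul_self p hp) ?_
    exact (congrArg χ hf).trans h

/-- Conjugation by w carries ℂp + ℂ(1 − p) into ℂq + ℂ(1 − q) and is itself a morphism of the
diagram, so the colimit identifies the two classes. Here the morphisms other than inclusions are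
used. -/
theorem proj_conj {p q : A} (hp : IsStarProjection p) (hq : IsStarProjection q) {w : A}
    (hw : w ∈ unitary A) (h : q = w * p * star w) : proj q hq = proj p hp := by
  have hmem : ∀ x : (Sf.ofProj p hp).alg, w * x * star w ∈ (Sf.ofProj q hq).alg := by
    rintro ⟨_, ⟨a, b⟩, rfl⟩
    refine ⟨(a, b), ?_⟩
    show Sf.span q (a, b) = w * Sf.span p (a, b) * star w
    rw [Sf.span_apply, Sf.span_apply, h, mul_add, add_mul, mul_smul_comm, smul_mul_assoc,
      mul_smul_comm, smul_mul_assoc, mul_sub, sub_mul, mul_one, Unitary.mul_star_self_of_mem hw]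
  let f : Sf.Hom (Sf.ofProj p hp) (Sf.ofProj q hq) :=
    ⟨((Unitary.conjStarAlgAut ℂ A ⟨w, hw⟩ : A ≃⋆ₐ[ℂ] A) : A →⋆ₐ[ℂ] A).comp
      (Sf.ofProj p hp).alg.subtype |>.codRestrict _ hmem, w, hw, fun _ => rfl⟩
  have hf : f.1 (Sf.projElem p hp) = Sf.projElem q hq := Subtype.ext h.symm
  conv_rhs => rw [proj, ← ι_map f, KTop.map_mk]
  refine proj_eq_ι hq (Sf.projElem q hq).2 _ (fun χ h => ?_) fun χ h => ?_
  · refine CVect.rank_ofIdempotent_of_eq_one (Sf.projFun_mul_self p hp) ?_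
    exact (congrArg χ hf).trans h
  · refine CVect.rank_ofIdempotent_of_eq_zero (Sf.projFun_mul_self p hp) ?_
    exact (congrArg χ hf).trans h

end Kf

/-- The finite-dimensional commutative subalgebra that is the image of a *-homomorphism. -/
def Sf.range {n : ℕ} (f : (Fin n → ℂ) →⋆ₐ[ℂ] A) : Sf A where
  alg := f.range
  comm := by
    rintro _ ⟨x, rfl⟩ _ ⟨y, rfl⟩
    show f x * f y = f y * f x
    rw [← map_mul, mul_comm, map_mul]
  finiteDimensional := by
    have h : FiniteDimensional ℂ (LinearMap.range (f : (Fin n → ℂ) →ₗ[ℂ] A)) := inferInstance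
    exact h

/-- The *-homomorphism `ℂ³ → A` given by two orthogonal projections. -/
def orthogonalHom {p q : A} (hp : IsStarProjection p) (hq : IsStarProjection q) (h : p * q = 0) :
    (Fin 3 → ℂ) →⋆ₐ[ℂ] A where
  toFun x := x 0 • p + x 1 • q + x 2 • (1 - p - q)
  map_one' := by simp
  map_zero' := by simp
  map_add' x y := by simp only [Pi.add_apply, add_smul]; abel
  map_mul' x y := by
    have h1 : p * p = p := hp.isIdempotentElem
    have h2 : q * q = q := hq.isIdempotentElem
    have h3 : q * p = 0 := Proj.mul_comm_zero (p := ⟨p, hp⟩) (q := ⟨q, hq⟩) h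
    have a1 : p * (1 - p - q) = 0 := by simp [mul_sub, h1, h]
    have a2 : q * (1 - p - q) = 0 := by simp [mul_sub, h2, h3]
    have a3 : (1 - p - q) * p = 0 := by simp [sub_mul, h1, h3]
    have a4 : (1 - p - q) * q = 0 := by simp [sub_mul, h2, h]
    have a5 : (1 - p - q) * (1 - p - q) = 1 - p - q := by
      conv_lhs => rw [mul_sub, mul_sub, a3, a4, mul_one, sub_zero, sub_zero]
    simp only [add_mul, mul_add, smul_mul_smul_comm, h1, h2, h3, h, a1, a2, a3, a4, a5, smul_zero,
      add_zero, zero_add, Pi.mul_apply]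
  commutes' r := by
    simp only [Pi.algebraMap_apply, ← smul_add, Algebra.algebraMap_eq_smul_one, smul_eq_mul, mul_one]
    congr 1; abel
  map_star' x := by
    simp [hp.isSelfAdjoint.star_eq, hq.isSelfAdjoint.star_eq]

namespace Kf

/-- The three classes are represented over one algebra, the span of p, q and 1 − p − q. A character
χ satisfies χ(p)χ(q) = 0, so the direct sum of the two line bundles has rank one exactly where χ(p +
q) = 1. -/
theorem proj_add {p q : A} (hp : IsStarProjection p) (hq : IsStarProjection q) (h : p * q = 0) :
    proj (p + q) (hp.add hq h) = proj p hp + proj q hq := by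
  set f := orthogonalHom hp hq h with hf
  have hpU : p ∈ (Sf.range f).alg := ⟨Pi.single 0 1, by
    show (Pi.single 0 1 : Fin 3 → ℂ) 0 • p + _ • q + _ • (1 - p - q) = p
    simp⟩
  have hqU : q ∈ (Sf.range f).alg := ⟨Pi.single 1 1, by
    show (Pi.single 1 1 : Fin 3 → ℂ) 0 • p + _ • q + _ • (1 - p - q) = q
    simp⟩
  rw [proj_eq_ι_lineBundle hp hpU, proj_eq_ι_lineBundle hq hqU, ← map_add, ← KTop.mk_directSum]
  set P : (Sf.range f).alg := ⟨p, hpU⟩ with hP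
  set Q : (Sf.range f).alg := ⟨q, hqU⟩ with hQ
  have hPP : P * P = P := Subtype.ext hp.isIdempotentElem
  have hQQ : Q * Q = Q := Subtype.ext hq.isIdempotentElem
  have hPQ : P * Q = 0 := Subtype.ext h
  have hmem : p + q ∈ (Sf.range f).alg := add_mem hpU hqU
  have hval : ∀ χ : (Sf.range f).Spec, χ ⟨p + q, hmem⟩ = χ P + χ Q := fun χ => map_add χ P Q
  have hmul : ∀ χ : (Sf.range f).Spec, χ P * χ Q = 0 := fun χ => by rw [← map_mul, hPQ, map_zero]
  refine proj_eq_ι _ hmem _ (fun χ hχ => ?_) fun χ hχ => ?_ <;>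
    rw [hval] at hχ <;> rw [CVect.rank_directSum, Pi.add_apply] <;>
    rcases apply_eq_zero_or_one hPP χ with h1 | h1 <;>
    rcases apply_eq_zero_or_one hQQ χ with h2 | h2 <;>
    first
    | rw [rank_lineBundle_of_eq_zero _ h1, rank_lineBundle_of_eq_zero _ h2]
    | rw [rank_lineBundle_of_eq_zero _ h1, rank_lineBundle_of_eq_one _ h2]
    | rw [rank_lineBundle_of_eq_one _ h1, rank_lineBundle_of_eq_zero _ h2]
    | skip
  -- The remaining value patterns are impossible: they contradict either the assumed value of χ at p
  -- + q or χ(p)χ(q) = 0.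
  all_goals have := hmul χ
  all_goals simp [h1, h2] at hχ this

/-- Every class is a combination of classes of projections. -/
theorem ι_mk (U : Sf A) (E : CVect U.Spec) :
    ι U (KTop.mk E) = ∑ χ, E.rank χ • proj (U.proj {χ} : A) (U.proj {χ}).2 := by
  classical
  have hidem : ∀ χ : U.Spec, U.indicator {χ} * U.indicator {χ} = U.indicator {χ} := fun χ =>
    Subtype.ext (U.isStarProjection_indicator {χ}).isIdempotentElem
  have h1 : ∀ χ, proj (U.proj {χ} : A) (U.proj {χ}).2 =
      ι U (KTop.mk (lineBundle (U.indicator {χ}) (hidem χ))) :=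
    fun χ => proj_eq_ι_lineBundle (U.proj {χ}).2 (U.indicator {χ}).2
  have h2 : ∀ F : VTop U.Spec, ∃ E, VTop.mk E = F := fun F => Quotient.exists_rep F
  -- An actual bundle representing the sum, in the monoid, of `E.rank χ` copies of the line bundle
  -- at each point χ. It has the same ranks as `E`, and therefore the same class.
  obtain ⟨F, hF⟩ := h2 (∑ χ, E.rank χ • VTop.mk (lineBundle (U.indicator {χ}) (hidem χ)))
  have h3 : KTop.mk F = ∑ χ, E.rank χ • KTop.mk (lineBundle (U.indicator {χ}) (hidem χ)) := by
    have := congrArg Algebra.GrothendieckAddGroup.of hF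
    rw [map_sum] at this
    refine this.trans (Finset.sum_congr rfl fun χ _ => map_nsmul _ _ _)
  have h4 : E.rank = F.rank := by
    rw [← VTop.rank_mk F, hF, map_sum]
    funext ψ
    rw [Finset.sum_apply, Finset.sum_eq_single ψ]
    · rw [map_nsmul, Pi.smul_apply, VTop.rank_mk, rank_lineBundle_of_eq_one, smul_eq_mul, mul_one]
      rw [Sf.apply_indicator]; simp
    · intro χ _ hχ
      rw [map_nsmul, Pi.smul_apply, VTop.rank_mk, rank_lineBundle_of_eq_zero, smul_zero]
      rw [Sf.apply_indicator]; simpa using hχ.symm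
    · simp
  rw [KTop.mk_eq_mk h4, h3, map_sum]
  exact Finset.sum_congr rfl fun χ _ => by rw [h1, map_nsmul]

/-- By `ι_mk`, the classes of projections generate the colimit. -/
theorem hom_ext_proj {f g : Kf A →+ G}
    (h : ∀ (p : A) (hp : IsStarProjection p), f (proj p hp) = g (proj p hp)) : f = g := by
  refine hom_ext fun U x => ?_
  suffices hs : f.comp (ι U) = g.comp (ι U) from DFunLike.congr_fun hs x
  refine KTop.hom_ext fun E => ?_
  rw [AddMonoidHom.comp_apply, AddMonoidHom.comp_apply, ι_mk, map_sum, map_sum]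
  exact Finset.sum_congr rfl fun χ _ => by rw [map_nsmul, map_nsmul, h]

end Kf

/-- The bundle that defines the class of p has rank one exactly at the characters with χ(p) = 1, and
the minimal projections of these characters add up to p. -/
theorem IsDimension.lift_proj {d : Proj A → G} (hd : IsDimension d) (p : Proj A) :
    hd.lift (Kf.proj p p.2) = d p := by
  classical
  rw [IsDimension.lift, Kf.proj, Kf.lift_ι, IsDimension.onSpec_mk]
  set U := Sf.ofProj (p : A) p.2 with hU
  set P : U.alg := Sf.projElem (p : A) p.2 with hP
  have hPP : P * P = P := Sf.projElem_mul_self (p : A) p.2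
  have h1 : U.proj (Finset.univ.filter fun χ : U.Spec => χ P = 1 : Finset U.Spec) = p := by
    refine Subtype.ext ?_
    have := congrArg Subtype.val (U.eq_indicator hPP)
    rw [Sf.coe_proj, Finset.coe_filter]
    simp only [Finset.mem_univ, true_and]
    exact this.symm
  conv_rhs => rw [← h1, hd.proj_eq_sum, Finset.sum_filter]
  refine Finset.sum_congr rfl fun χ _ => ?_
  rcases Kf.apply_eq_zero_or_one hPP χ with h | h
  · rw [CVect.rank_ofIdempotent_of_eq_zero _ h, zero_smul, if_neg (by simp [h])]
  · rw [CVect.rank_ofIdempotent_of_eq_one _ h, one_smul, if_pos h]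

end KfUniversal

/-! ### The isomorphism of `K₀` with `Kf` of the stabilization -/

section Eta

variable {A : Type u} [CStarAlgebra A]

/-- Equivalence of projections of `B` is conjugation by a unitary of B⁺, and such unitaries are
exactly the ones allowed in the diagram of B⁺. -/
theorem Kf.projInr_congr {B : Type u} [NonUnitalCStarAlgebra B] {p q : Proj B} (h : UEquiv p q) :
    Kf.projInr p = Kf.projInr q := by
  obtain ⟨w, hw, h⟩ := h
  exact Kf.proj_conj _ _ hw h

theorem Kf.projInr_add {B : Type u} [NonUnitalCStarAlgebra B] {p q : Proj B}
    (h : (p : B) * q = 0) : Kf.projInr (p.add q h) = Kf.projInr p + Kf.projInr q := by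
  refine Eq.trans ?_ (Kf.proj_add (isStarProjection_inr.2 p.2) (isStarProjection_inr.2 q.2)
    (by rw [← Unitization.inr_mul, h, Unitization.inr_zero]))
  simp only [Kf.projInr, Proj.add, Unitization.inr_add]

theorem Kf.projInr_eq {B : Type u} [NonUnitalCStarAlgebra B] (p : Proj B) :
    Kf.projInr p = Kf.proj ((p : B) : Unitization ℂ B) (isStarProjection_inr.2 p.2) := rfl

theorem Kf.map_projInr {B C : Type u} [NonUnitalCStarAlgebra B] [NonUnitalCStarAlgebra C]
    (φ : B →⋆ₙₐ[ℂ] C) (p : Proj B) :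
    Kf.map (Unitization.starMap φ) (Kf.projInr p) = Kf.projInr (p.map φ) := by
  rw [Kf.projInr_eq, Kf.map_proj]
  simp only [Kf.projInr, Proj.map, Unitization.starMap_inr]

theorem Kf.proj_zero : Kf.proj (0 : A) (.zero A) = 0 := by
  have h := Kf.proj_add (IsStarProjection.zero A) (.zero A) (mul_zero _)
  simp only [add_zero] at h
  exact left_eq_add.1 h

theorem Kf.map_scalarHom_projInr {B : Type u} [NonUnitalCStarAlgebra B] (p : Proj B) :
    Kf.map (scalarHom B) (Kf.projInr p) = 0 := by
  rw [Kf.projInr_eq, Kf.map_proj]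
  simp only [scalarHom_apply, Unitization.fst_inr, Kf.proj_zero]

variable (A) in
/-- The homomorphism `[P] ↦ [(P)]` from `K₀(A)` to `Kf((A ⊗ 𝒦)⁺)`. -/
def etaHom : K0 A →+ Kf (Unitization ℂ (Stab A)) :=
  Algebra.GrothendieckAddGroup.lift
    { toFun := Quotient.lift (s := projSetoid (Stab A)) Kf.projInr fun _ _ h => Kf.projInr_congr h
      map_zero' := by
        show Kf.projInr (V.zeroProj (Stab A)) = 0
        simp only [Kf.projInr, V.zeroProj, Unitization.inr_zero, Kf.proj_zero]
      map_add' := fun x y => by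
        induction x using V.ind with | _ p
        induction y using V.ind with | _ q
        obtain ⟨r, hr, hpr⟩ := V.exists_orthogonal p q
        rw [V.mk_eq_mk.2 hr, V.mk_add_mk hpr]
        exact Kf.projInr_add hpr }

theorem etaHom_mk (p : Proj (Stab A)) : etaHom A (K0.mk p) = Kf.projInr p :=
  DFunLike.congr_fun (Algebra.GrothendieckAddGroup.lift.symm_apply_apply _) (V.mk p)

theorem K0.mk_add {p q : Proj (Stab A)} (h : (p : Stab A) * q = 0) :
    K0.mk (p.add q h) = K0.mk p + K0.mk q := by
  rw [K0.mk, ← V.mk_add_mk h, map_add]; rfl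

theorem K0.mk_congr {p q : Proj (Stab A)} (h : UEquiv p q) : K0.mk p = K0.mk q :=
  congrArg Algebra.GrothendieckAddGroup.of (V.mk_eq_mk.2 h)

/-- The elements of a unital algebra with a star-projection as scalar part. -/
theorem fst_eq_zero_or_one {B : Type u} [NonUnitalCStarAlgebra B] (p : Proj (Unitization ℂ B)) :
    (p : Unitization ℂ B).fst = 0 ∨ (p : Unitization ℂ B).fst = 1 := by
  have h : (p : Unitization ℂ B).fst * (p : Unitization ℂ B).fst = (p : Unitization ℂ B).fst := by
    rw [← Unitization.fst_mul]; exact congrArg (fun x => x.fst) p.2.isIdempotentElem.eq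
  rcases eq_or_ne (p : Unitization ℂ B).fst 0 with h2 | h2
  · exact Or.inl h2
  · exact Or.inr (mul_left_cancel₀ h2 (by rw [h, mul_one]))

theorem exists_proj_inr {B : Type u} [NonUnitalCStarAlgebra B] {x : Unitization ℂ B}
    (hx : IsStarProjection x) (h : x.fst = 0) : ∃ p : Proj B, x = ((p : B) : Unitization ℂ B) := by
  have h1 : x = ((x.snd : B) : Unitization ℂ B) := Unitization.ext (by simpa using h) (by simp)
  exact ⟨⟨x.snd, isStarProjection_inr.1 (h1 ▸ hx)⟩, h1⟩

/-- A projection of `B⁺` is a projection of `B` or the complement of one. -/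
theorem exists_proj_inr_or {B : Type u} [NonUnitalCStarAlgebra B] (x : Proj (Unitization ℂ B)) :
    ∃ p : Proj B, (x : Unitization ℂ B) = ((p : B) : Unitization ℂ B) ∨
      (x : Unitization ℂ B) = 1 - ((p : B) : Unitization ℂ B) := by
  rcases fst_eq_zero_or_one x with h | h
  · obtain ⟨p, hp⟩ := exists_proj_inr x.2 h
    exact ⟨p, Or.inl hp⟩
  · obtain ⟨p, hp⟩ := exists_proj_inr x.2.one_sub (by
      show (1 : ℂ) - (x : Unitization ℂ B).fst = 0
      rw [h, sub_self])
    exact ⟨p, Or.inr (by rw [← hp, sub_sub_cancel])⟩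

/-- The relative dimension of a projection of `(A ⊗ 𝒦)⁺`: the class of a projection of `A ⊗ 𝒦`, and
minus the class of the complement for the other projections. -/
def relDim (x : Proj (Unitization ℂ (Stab A))) : K0 A :=
  open Classical in
  if (x : Unitization ℂ (Stab A)) = (((exists_proj_inr_or x).choose : Stab A) : Unitization ℂ _)
  then K0.mk (exists_proj_inr_or x).choose else - K0.mk (exists_proj_inr_or x).choose

theorem inr_ne_one_sub_inr {B : Type u} [NonUnitalCStarAlgebra B] (a b : B) :
    (a : Unitization ℂ B) ≠ 1 - (b : Unitization ℂ B) := fun h => by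
  have := congrArg (scalarHom B) h
  rw [map_sub, map_one] at this
  simp [scalarHom_apply] at this

theorem relDim_inr {x : Proj (Unitization ℂ (Stab A))} {p : Proj (Stab A)}
    (h : (x : Unitization ℂ (Stab A)) = ((p : Stab A) : Unitization ℂ (Stab A))) :
    relDim x = K0.mk p := by
  have h' := (exists_proj_inr_or x).choose_spec
  rw [relDim]
  rcases h' with h' | h'
  · rw [if_pos h']
    congr 1
    exact Subtype.ext (Unitization.inr_injective (R := ℂ) (h'.symm.trans h))
  · exact absurd (h.symm.trans h') (inr_ne_one_sub_inr _ _)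

theorem relDim_one_sub_inr {x : Proj (Unitization ℂ (Stab A))} {p : Proj (Stab A)}
    (h : (x : Unitization ℂ (Stab A)) = 1 - ((p : Stab A) : Unitization ℂ (Stab A))) :
    relDim x = - K0.mk p := by
  have h' := (exists_proj_inr_or x).choose_spec
  rw [relDim]
  rcases h' with h' | h'
  · exact absurd (h'.symm.trans h) (inr_ne_one_sub_inr _ _)
  · rw [if_neg fun h2 => inr_ne_one_sub_inr _ _ (h2.symm.trans h')]
    congr 2
    exact Subtype.ext (Unitization.inr_injective (R := ℂ) (sub_right_injective (h'.symm.trans h)))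

/-- Additivity depends on the scalar parts. Two projections with scalar part 1 are never orthogonal.
If p is orthogonal to 1 − q, then p ≤ q and p + (1 − q) = 1 − (q − p), so the claim becomes −[q − p]
= [p] − [q], which is additivity in V(A) for q = p + (q − p). Conjugation by a unitary preserves the
scalar part, so it respects the case distinction. -/
theorem isDimension_relDim : IsDimension (relDim (A := A)) where
  add x y h := by
    obtain ⟨p, hp | hp⟩ := exists_proj_inr_or x <;> obtain ⟨q, hq | hq⟩ := exists_proj_inr_or y
    · have hpq : (p : Stab A) * q = 0 := by
        apply Unitization.inr_injective (R := ℂ)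
        rw [Unitization.inr_mul, ← hp, ← hq, h, Unitization.inr_zero]
      rw [relDim_inr hp, relDim_inr hq, ← K0.mk_add hpq]
      refine relDim_inr ?_
      simp [Proj.add, hp, hq]
    · have hpq : (p : Stab A) * q = p := by
        apply Unitization.inr_injective (R := ℂ)
        have : ((p : Stab A) : Unitization ℂ (Stab A)) * (1 - ((q : Stab A) : Unitization ℂ _)) = 0 := by
          rw [← hp, ← hq, h]
        rw [mul_sub, mul_one, sub_eq_zero] at this
        rw [Unitization.inr_mul, ← this]
      have hqp : (q : Stab A) * p = p := by
        have := congrArg star hpq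
        rwa [star_mul, p.2.isSelfAdjoint.star_eq, q.2.isSelfAdjoint.star_eq] at this
      let r : Proj (Stab A) := ⟨q - p, p.2.sub_of_mul_eq_left q.2 hpq⟩
      have hpr : (p : Stab A) * r = 0 := by
        show (p : Stab A) * (q - p) = 0
        rw [mul_sub, hpq, p.2.isIdempotentElem.eq, sub_self]
      have hq' : q = p.add r hpr := Subtype.ext (by simp [Proj.add, r])
      have : relDim (x.add y h) = - K0.mk r := by
        refine relDim_one_sub_inr ?_
        simp [Proj.add, hp, hq, r]
        abel
      rw [this, relDim_inr hp, relDim_one_sub_inr hq, hq', K0.mk_add hpr]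
      abel
    · have hpq : (p : Stab A) * q = q := by
        apply Unitization.inr_injective (R := ℂ)
        have : (1 - ((p : Stab A) : Unitization ℂ _)) * ((q : Stab A) : Unitization ℂ (Stab A)) = 0 := by
          rw [← hp, ← hq, h]
        rw [sub_mul, one_mul, sub_eq_zero] at this
        rw [Unitization.inr_mul, ← this]
      have hqp : (q : Stab A) * p = q := by
        have := congrArg star hpq
        rwa [star_mul, p.2.isSelfAdjoint.star_eq, q.2.isSelfAdjoint.star_eq] at this
      let r : Proj (Stab A) := ⟨p - q, q.2.sub_of_mul_eq_left p.2 hqp⟩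
      have hqr : (q : Stab A) * r = 0 := by
        show (q : Stab A) * (p - q) = 0
        rw [mul_sub, hqp, q.2.isIdempotentElem.eq, sub_self]
      have hp' : p = q.add r hqr := Subtype.ext (by simp [Proj.add, r])
      have : relDim (x.add y h) = - K0.mk r := by
        refine relDim_one_sub_inr ?_
        simp [Proj.add, hp, hq, r]
        abel
      rw [this, relDim_one_sub_inr hp, relDim_inr hq, hp', K0.mk_add hqr]
      abel
    · rw [hp, hq] at h
      have := congrArg (scalarHom (Stab A)) h
      rw [map_mul, map_sub, map_sub, map_one] at this
      simp [scalarHom_apply] at this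
  conj x y w hw h := by
    obtain ⟨p, hp | hp⟩ := exists_proj_inr_or x
    · obtain ⟨q, hq⟩ := exists_conj p hw
      rw [relDim_inr hp, relDim_inr (h.trans (by rw [hp, hq]))]
      exact K0.mk_congr ⟨w, hw, hq⟩
    · obtain ⟨q, hq⟩ := exists_conj p hw
      rw [relDim_one_sub_inr hp, relDim_one_sub_inr (p := q) (h.trans (by
        rw [hp, hq, mul_sub, sub_mul, mul_one, Unitary.mul_star_self_of_mem hw]))]
      exact congrArg _ (K0.mk_congr ⟨w, hw, hq⟩)

/-- The dimension of a projection of `ℂ`. -/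
theorem isDimension_complex :
    IsDimension fun p : Proj ℂ => open Classical in if (p : ℂ) = 0 then (0 : ℤ) else 1 where
  add p q h := by
    rcases mul_eq_zero.1 h with h | h <;> simp [Proj.add, h]
  conj p q w hw h := by
    have : (q : ℂ) = p := by
      rw [h, mul_comm w, mul_assoc, Unitary.mul_star_self_of_mem hw, mul_one]
    simp [this]

/-- It suffices to test on classes of projections. For p in A ⊗ 𝒦 the correction vanishes; for 1 − p
the left side is −[(p)] = [(1 − p)] − [(1)], and the scalar part has dimension 1. On the kernel of
the scalar projection the correction disappears, which makes `etaHom` surjective onto it. -/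
theorem etaHom_lift_relDim (x : Kf (Unitization ℂ (Stab A))) :
    etaHom A (isDimension_relDim.lift x) = x -
      isDimension_complex.lift (Kf.map (scalarHom (Stab A)) x) • Kf.proj 1 (.one _) := by
  let F : Kf (Unitization ℂ (Stab A)) →+ Kf (Unitization ℂ (Stab A)) :=
    (etaHom A).comp isDimension_relDim.lift
  let G : Kf (Unitization ℂ (Stab A)) →+ Kf (Unitization ℂ (Stab A)) :=
    AddMonoidHom.id _ - ((zmultiplesHom _ (Kf.proj (1 : Unitization ℂ (Stab A)) (.one _))).comp
      (isDimension_complex.lift.comp (Kf.map (scalarHom (Stab A)))))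
  suffices h : F = G from DFunLike.congr_fun h x
  refine Kf.hom_ext_proj fun p hp => ?_
  show etaHom A (isDimension_relDim.lift (Kf.proj p hp)) = Kf.proj p hp -
    isDimension_complex.lift (Kf.map (scalarHom (Stab A)) (Kf.proj p hp)) • Kf.proj 1 (.one _)
  rw [Kf.map_proj, isDimension_relDim.lift_proj ⟨p, hp⟩,
    isDimension_complex.lift_proj ⟨_, hp.map (scalarHom (Stab A))⟩]
  obtain ⟨q, hq | hq⟩ := exists_proj_inr_or ⟨p, hp⟩
  · rw [relDim_inr hq, etaHom_mk]
    simp only at hq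
    subst hq
    simp [scalarHom_apply, Kf.projInr]
  · rw [relDim_one_sub_inr hq, map_neg, etaHom_mk]
    simp only at hq
    subst hq
    have h1 := Kf.proj_add hp (isStarProjection_inr.2 q.2) (by
      rw [sub_mul, one_mul, (isStarProjection_inr.2 q.2).isIdempotentElem.eq, sub_self])
    simp only [sub_add_cancel] at h1
    have h2 : scalarHom (Stab A) (1 - ((q : Stab A) : Unitization ℂ (Stab A))) = 1 := by
      rw [map_sub, map_one, scalarHom_apply, Unitization.fst_inr, sub_zero]
    simp [h2, Kf.projInr_eq, h1]

theorem etaHom_mem (x : K0 A) : etaHom A x ∈ Kfnu (Stab A) := by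
  suffices h : (Kf.map (scalarHom (Stab A))).comp (etaHom A) = 0 from DFunLike.congr_fun h x
  refine K0.hom_ext fun p => ?_
  rw [AddMonoidHom.comp_apply, etaHom_mk, Kf.map_scalarHom_projInr]; rfl

theorem relDim_etaHom (x : K0 A) : isDimension_relDim.lift (etaHom A x) = x := by
  suffices h : isDimension_relDim.lift.comp (etaHom A) = AddMonoidHom.id _ from
    DFunLike.congr_fun h x
  refine K0.hom_ext fun p => ?_
  rw [AddMonoidHom.comp_apply, etaHom_mk]
  exact (isDimension_relDim.lift_proj ⟨_, isStarProjection_inr.2 p.2⟩).trans (relDim_inr rfl)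

variable (A) in
/-- The isomorphism of `K₀(A)` with `Kf(A ⊗ 𝒦)`. -/
def eta : K0 A ≃+ Kfnu (Stab A) where
  toFun x := ⟨etaHom A x, etaHom_mem x⟩
  invFun x := isDimension_relDim.lift (x : Kf (Unitization ℂ (Stab A)))
  left_inv x := relDim_etaHom x
  right_inv x := by
    refine Subtype.ext ?_
    have h : Kf.map (scalarHom (Stab A)) x = 0 := x.2
    refine (etaHom_lift_relDim (x : Kf (Unitization ℂ (Stab A)))).trans ?_
    rw [h, map_zero, zero_smul, sub_zero]
  map_add' x y := Subtype.ext (map_add (etaHom A) x y)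

theorem coe_eta (x : K0 A) : (eta A x : Kf (Unitization ℂ (Stab A))) = etaHom A x := rfl

theorem eta_map {B : Type u} [CStarAlgebra B] (φ : A →⋆ₐ[ℂ] B) (x : K0 A) :
    eta B (K0.map φ x) = Kfnu.map (Stab.map (φ : A →⋆ₙₐ[ℂ] B)) (eta A x) := by
  refine Subtype.ext ?_
  show etaHom B (K0.map φ x) =
    Kf.map (Unitization.starMap (Stab.map (φ : A →⋆ₙₐ[ℂ] B))) (etaHom A x)
  suffices h : (etaHom B).comp (K0.map φ) =
      (Kf.map (Unitization.starMap (Stab.map (φ : A →⋆ₙₐ[ℂ] B)))).comp (etaHom A) from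
    DFunLike.congr_fun h x
  refine K0.hom_ext fun p => ?_
  rw [AddMonoidHom.comp_apply, AddMonoidHom.comp_apply, K0.map_mk, etaHom_mk, etaHom_mk,
    Kf.map_projInr]

end Eta

/-! ### Matrix coefficients and a faithful C*-seminorm -/

section MatrixCoeff

open scoped ComplexOrder

/-- The matrix unit `e i j` as a compact operator. -/
def matUnit (i j : ℕ) : Compacts :=
  ⟨InnerProductSpace.rankOne ℂ (ebasis i) (ebasis j), isCompactOperator_rankOne _ _⟩

theorem matUnit_mul (i j k l : ℕ) :
    matUnit i j * matUnit k l = if j = k then matUnit i l else 0 := by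
  refine Subtype.ext ((rankOne_mul_rankOne i j k l).trans ?_)
  split_ifs <;> rfl

theorem matUnit_mul_same (i j l : ℕ) : matUnit i j * matUnit j l = matUnit i l := by
  rw [matUnit_mul, if_pos rfl]

theorem star_matUnit (i j : ℕ) : star (matUnit i j) = matUnit j i := Subtype.ext (star_rankOne i j)

theorem ctrunc_eq_sum (n : ℕ) : ctrunc n = ∑ i ∈ Finset.range n, matUnit i i := by
  refine Subtype.ext ?_
  show trunc n = ((∑ i ∈ Finset.range n, matUnit i i : Compacts) : Ell2 →L[ℂ] Ell2)
  rw [AddSubmonoidClass.coe_finsetSum]; rfl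

/-- The matrix coefficients of a compact operator. -/
def coeff (i j : ℕ) : Compacts →ₗ[ℂ] ℂ where
  toFun k := ⟪ebasis i, (k : Ell2 →L[ℂ] Ell2) (ebasis j)⟫_ℂ
  map_add' _ _ := inner_add_right _ _ _
  map_smul' _ _ := inner_smul_right _ _ _

theorem coeff_star (i j : ℕ) (k : Compacts) : coeff i j (star k) = star (coeff j i k) := by
  show ⟪ebasis i, (star (k : Ell2 →L[ℂ] Ell2)) (ebasis j)⟫_ℂ = _
  rw [ContinuousLinearMap.star_eq_adjoint, ContinuousLinearMap.adjoint_inner_right]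
  exact (inner_conj_symm _ _).symm

theorem rankOne_mul_mul_rankOne (i j k l : ℕ) (T : Ell2 →L[ℂ] Ell2) :
    InnerProductSpace.rankOne ℂ (ebasis i) (ebasis j) * T *
      InnerProductSpace.rankOne ℂ (ebasis k) (ebasis l) =
    ⟪ebasis j, T (ebasis k)⟫_ℂ • InnerProductSpace.rankOne ℂ (ebasis i) (ebasis l) := by
  ext1 v
  simp [InnerProductSpace.rankOne_apply, smul_smul, mul_comm]

theorem matUnit_mul_mul_matUnit (i j k l : ℕ) (T : Compacts) :
    matUnit i j * T * matUnit k l = coeff j k T • matUnit i l :=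
  Subtype.ext (rankOne_mul_mul_rankOne i j k l T)

theorem coeff_mul_ctrunc_mul (i j n : ℕ) (k l : Compacts) :
    coeff i j (k * (ctrunc n * l)) = ∑ m ∈ Finset.range n, coeff i m k * coeff m j l := by
  rw [ctrunc_eq_sum, Finset.sum_mul, Finset.mul_sum, map_sum]
  refine Finset.sum_congr rfl fun m _ => ?_
  show ⟪ebasis i, (k : Ell2 →L[ℂ] Ell2) (InnerProductSpace.rankOne ℂ (ebasis m) (ebasis m)
    ((l : Ell2 →L[ℂ] Ell2) (ebasis j)))⟫_ℂ = _
  rw [InnerProductSpace.rankOne_apply, map_smul, inner_smul_right, mul_comm]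
  rfl

/-- The inclusion of the matrix algebra in the operators on `ℓ²`. -/
def matIncl (n : ℕ) : CStarMatrix (Fin n) (Fin n) ℂ →⋆ₙₐ[ℂ] Ell2 →L[ℂ] Ell2 where
  toFun M := ∑ i, ∑ j, M i j • InnerProductSpace.rankOne ℂ (ebasis (i : ℕ)) (ebasis (j : ℕ))
  map_smul' c M := by simp only [CStarMatrix.smul_apply, smul_assoc, Finset.smul_sum]; rfl
  map_zero' := by simp
  map_add' M N := by simp [add_smul, Finset.sum_add_distrib]
  map_mul' M N := by
    rw [Finset.sum_mul]
    refine Finset.sum_congr rfl fun i _ => ?_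
    rw [Finset.sum_mul]
    simp only [CStarMatrix.mul_apply, Finset.sum_smul]
    rw [Finset.sum_comm]
    refine Finset.sum_congr rfl fun m _ => ?_
    rw [Finset.mul_sum]
    symm
    rw [Finset.sum_eq_single m]
    · simp only [Finset.mul_sum, smul_mul_smul_comm, rankOne_mul_rankOne, if_true]
    · intro k _ hk
      have hk' : (m : ℕ) ≠ k := fun h => hk (Fin.ext h.symm)
      simp only [Finset.mul_sum, smul_mul_smul_comm, rankOne_mul_rankOne, if_neg hk', smul_zero,
        Finset.sum_const_zero]
    · simp
  map_star' M := by
    simp only [star_sum, star_smul, star_rankOne, CStarMatrix.star_apply]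
    exact Finset.sum_comm

theorem inner_matIncl (n : ℕ) (M : CStarMatrix (Fin n) (Fin n) ℂ) (i j : Fin n) :
    ⟪ebasis (i : ℕ), matIncl n M (ebasis (j : ℕ))⟫_ℂ = M i j := by
  have horth := fun i j => orthonormal_iff_ite.1 ebasis.orthonormal i j
  have h1 : matIncl n M (ebasis (j : ℕ)) = ∑ i, M i j • ebasis (i : ℕ) := by
    show (∑ i, ∑ j, M i j • InnerProductSpace.rankOne ℂ (ebasis (i : ℕ)) (ebasis (j : ℕ)) :
      Ell2 →L[ℂ] Ell2) (ebasis (j : ℕ)) = _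
    simp [InnerProductSpace.rankOne_apply, horth, Fin.val_inj]
  rw [h1, inner_sum]
  simp [inner_smul_right, horth, Fin.val_inj]

theorem matIncl_injective (n : ℕ) : Function.Injective (matIncl n) := fun M N h =>
  CStarMatrix.ext fun i j => by rw [← inner_matIncl n M, h, inner_matIncl]

/-- The compression of a compact operator to a matrix. -/
def compress (n : ℕ) (k : Compacts) : CStarMatrix (Fin n) (Fin n) ℂ :=
  CStarMatrix.ofMatrix fun i j => coeff i j k

theorem matIncl_compress (n : ℕ) (k : Compacts) :
    matIncl n (compress n k) = trunc n * k * trunc n := by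
  rw [trunc, Finset.sum_range, Finset.sum_mul, Finset.sum_mul_sum]
  simp only [rankOne_mul_mul_rankOne]
  rfl

/-- An injective *-homomorphism is isometric, so the norm may be computed in the operators on ℓ²,
where the compression is `trunc n * k * trunc n`. -/
theorem norm_compress_le (n : ℕ) (k : Compacts) : ‖compress n k‖ ≤ ‖k‖ := by
  rw [← NonUnitalStarAlgHom.norm_map (matIncl n) (matIncl_injective n), matIncl_compress]
  calc ‖trunc n * (k : Ell2 →L[ℂ] Ell2) * trunc n‖
      ≤ 1 * ‖(k : Ell2 →L[ℂ] Ell2)‖ * 1 := by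
        refine (norm_mul_le _ _).trans (mul_le_mul ((norm_mul_le _ _).trans ?_) (norm_trunc_le n)
          (norm_nonneg _) (by positivity))
        exact mul_le_mul_of_nonneg_right (norm_trunc_le n) (norm_nonneg _)
    _ = ‖k‖ := by rw [one_mul, mul_one]; rfl

section Algebraic

variable {D : Type u} [CStarAlgebra D]

/-- The slice of an element of the algebraic tensor product by matrix coefficients. -/
def algSlice (i j : ℕ) : AlgTensor D Compacts →ₗ[ℂ] D :=
  (TensorProduct.lift (LinearMap.mk₂ ℂ (fun (a : D) (k : Compacts) => coeff i j k • a)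
    (fun _ _ _ => smul_add _ _ _) (fun _ _ _ => smul_comm _ _ _)
    (fun _ _ _ => by rw [map_add, add_smul]) (fun _ _ _ => by rw [map_smul, smul_assoc])) :
    D ⊗[ℂ] Compacts →ₗ[ℂ] D)

theorem algSlice_tmul (i j : ℕ) (a : D) (k : Compacts) :
    algSlice i j (AlgTensor.tmul a k) = coeff i j k • a := TensorProduct.lift.tmul _ _

/-- The compression of an element of the algebraic tensor product to a matrix. -/
def algCompress (n : ℕ) : AlgTensor D Compacts →ₗ[ℂ] CStarMatrix (Fin n) (Fin n) D where
  toFun x := CStarMatrix.ofMatrix fun i j => algSlice i j x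
  map_add' x y := CStarMatrix.ext fun i j => map_add (algSlice (D := D) i j) x y
  map_smul' c x := CStarMatrix.ext fun i j => map_smul (algSlice (D := D) i j) c x

theorem algCompress_apply (n : ℕ) (x : AlgTensor D Compacts) (i j : Fin n) :
    algCompress n x i j = algSlice i j x := rfl

/-- The embedding of `D` in the diagonal matrices. -/
def diagHom (D : Type u) [CStarAlgebra D] (n : ℕ) : D →⋆ₙₐ[ℂ] CStarMatrix (Fin n) (Fin n) D where
  toFun a := CStarMatrix.ofMatrix (Matrix.diagonal fun _ => a)
  map_smul' c a := CStarMatrix.ext fun i j => by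
    simp [Matrix.diagonal_apply]
  map_zero' := CStarMatrix.ext fun i j => by simp
  map_add' a b := CStarMatrix.ext fun i j => by
    simp only [CStarMatrix.add_apply, CStarMatrix.ofMatrix_apply, Matrix.diagonal_apply]
    split_ifs <;> simp
  map_mul' a b := CStarMatrix.ext fun i j => by
    simp [CStarMatrix.mul_apply, Matrix.diagonal_apply]
  map_star' a := CStarMatrix.ext fun i j => by
    simp only [CStarMatrix.star_apply, CStarMatrix.ofMatrix_apply, Matrix.diagonal_apply, eq_comm]
    split_ifs <;> simp

theorem algCompress_star (n : ℕ) (x : AlgTensor D Compacts) :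
    algCompress n (star x) = star (algCompress n x) := by
  induction x using AlgTensor.induction_on with
  | zero => simp
  | add x y hx hy => rw [star_add, map_add, hx, hy, map_add, star_add]
  | tmul a k =>
    refine CStarMatrix.ext fun i j => ?_
    rw [CStarMatrix.star_apply, algCompress_apply, algCompress_apply, AlgTensor.star_tmul,
      algSlice_tmul, algSlice_tmul, star_smul, coeff_star]

/-- Multiplying two n × n compressions sums over the first n intermediate indices only, which
amounts to inserting `ctrunc n` between the factors. The defect of multiplicativity is therefore
governed by `l - ctrunc n * l`. -/
theorem algCompress_tmul_mul_tmul (n : ℕ) (a b : D) (k l : Compacts) :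
    algCompress n (AlgTensor.tmul a k) * algCompress n (AlgTensor.tmul b l) =
      algCompress n (AlgTensor.tmul (a * b) (k * (ctrunc n * l))) := by
  refine CStarMatrix.ext fun i j => ?_
  rw [CStarMatrix.mul_apply, algCompress_apply, algSlice_tmul, coeff_mul_ctrunc_mul,
    Finset.sum_range, Finset.sum_smul]
  refine Finset.sum_congr rfl fun m _ => ?_
  rw [algCompress_apply, algCompress_apply, algSlice_tmul, algSlice_tmul, smul_mul_smul_comm]

end Algebraic

variable {D : Type u} [CStarAlgebra D] [PartialOrder D] [StarOrderedRing D]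

/-- The compression of a ⊗ k is the product of the diagonal matrix of a and the scalar matrix of k.
Both come from *-homomorphisms, which are contractive. -/
theorem norm_algCompress_tmul_le (n : ℕ) (a : D) (k : Compacts) :
    ‖algCompress n (AlgTensor.tmul a k)‖ ≤ ‖a‖ * ‖k‖ := by
  let ι : ℂ →⋆ₙₐ[ℂ] D := (StarAlgHom.ofId ℂ D : ℂ →⋆ₐ[ℂ] D)
  have h : algCompress n (AlgTensor.tmul a k) =
      diagHom D n a * CStarMatrix.mapₙₐ ι (compress n k) := by
    refine CStarMatrix.ext fun i j => ?_
    rw [algCompress_apply, algSlice_tmul, CStarMatrix.mul_apply, Finset.sum_eq_single i]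
    · show _ = (Matrix.diagonal fun _ => a : Matrix (Fin n) (Fin n) D) i i *
        algebraMap ℂ D (coeff i j k)
      rw [Matrix.diagonal_apply_eq, Algebra.algebraMap_eq_smul_one, mul_smul_comm, mul_one]
    · intro m _ hm
      show (Matrix.diagonal fun _ => a : Matrix (Fin n) (Fin n) D) i m * _ = 0
      rw [Matrix.diagonal_apply_ne _ hm.symm, zero_mul]
    · simp
  rw [h]
  refine (norm_mul_le _ _).trans (mul_le_mul (NonUnitalStarAlgHom.norm_apply_le _ _) ?_
    (norm_nonneg _) (norm_nonneg _))
  exact (NonUnitalStarAlgHom.norm_apply_le _ _).trans (norm_compress_le n k)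

/-- On elementary tensors the error is at most a constant times ‖l − `ctrunc n` l‖, which tends to
zero as l is compact. With the C*-identity in matrices over D, this turns limits of compression
norms into C*-seminorms. -/
theorem tendsto_algCompress_mul (x y : AlgTensor D Compacts) :
    Tendsto (fun n => ‖algCompress n (x * y) - algCompress n x * algCompress n y‖) atTop (𝓝 0) := by
  have hadd : ∀ f g : ∀ n : ℕ, CStarMatrix (Fin n) (Fin n) D,
      Tendsto (fun n => ‖f n‖) atTop (𝓝 0) → Tendsto (fun n => ‖g n‖) atTop (𝓝 0) →
      Tendsto (fun n => ‖f n + g n‖) atTop (𝓝 0) := fun f g hf hg => by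
    have := hf.add hg
    rw [add_zero] at this
    exact squeeze_zero (fun _ => norm_nonneg _) (fun n => norm_add_le _ _) this
  induction x using AlgTensor.induction_on with
  | zero => simp
  | add x x' hx hx' =>
    refine (hadd _ _ hx hx').congr fun n => ?_
    congr 1
    rw [add_mul, map_add, map_add, add_mul]; abel
  | tmul a k =>
    induction y using AlgTensor.induction_on with
    | zero => simp
    | add y y' hy hy' =>
      refine (hadd _ _ hy hy').congr fun n => ?_
      congr 1
      rw [mul_add, map_add, map_add, mul_add]; abel
    | tmul b l =>
      have h1 : Tendsto (fun n => ‖a * b‖ * (‖k‖ * ‖l - ctrunc n * l‖)) atTop (𝓝 0) := by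
        have := tendsto_iff_norm_sub_tendsto_zero.1 (tendsto_ctrunc_mul l)
        simp only [norm_sub_rev _ l] at this
        simpa using (this.const_mul ‖k‖).const_mul ‖a * b‖
      refine squeeze_zero (fun _ => norm_nonneg _) (fun n => ?_) h1
      rw [algCompress_tmul_mul_tmul, AlgTensor.tmul_mul_tmul, ← map_sub, ← AlgTensor.tmul_sub,
        ← mul_sub]
      exact (norm_algCompress_tmul_le n _ _).trans
        (mul_le_mul_of_nonneg_left (norm_mul_le _ _) (norm_nonneg _))

theorem exists_norm_algCompress_le (x : AlgTensor D Compacts) :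
    ∃ C, ∀ n, ‖algCompress n x‖ ≤ C := by
  induction x using AlgTensor.induction_on with
  | zero => exact ⟨0, by simp⟩
  | tmul a k => exact ⟨_, fun n => norm_algCompress_tmul_le n a k⟩
  | add x y hx hy =>
    obtain ⟨C, hC⟩ := hx
    obtain ⟨C', hC'⟩ := hy
    exact ⟨C + C', fun n => by
      rw [map_add]; exact (norm_add_le _ _).trans (add_le_add (hC n) (hC' n))⟩

/-- Boundedness is enough for convergence along an ultrafilter, so no monotonicity of the norms in n
is needed. -/
theorem exists_tendsto_norm_algCompress (x : AlgTensor D Compacts) :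
    ∃ r, Tendsto (fun n => ‖algCompress n x‖) (hyperfilter ℕ) (𝓝 r) := by
  obtain ⟨C, hC⟩ := exists_norm_algCompress_le x
  obtain ⟨r, -, hr⟩ := (isCompact_Icc (a := (0 : ℝ)) (b := C)).ultrafilter_le_nhds
    ((hyperfilter ℕ).map fun n => ‖algCompress n x‖)
    (le_principal_iff.2 (mem_map.2 (univ_mem' fun n => ⟨norm_nonneg _, hC n⟩)))
  exact ⟨r, hr⟩

/-- The limit of the norms of the compressions along an ultrafilter. -/
def limNorm (x : AlgTensor D Compacts) : ℝ := (exists_tendsto_norm_algCompress x).choose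

theorem tendsto_limNorm (x : AlgTensor D Compacts) :
    Tendsto (fun n => ‖algCompress n x‖) (hyperfilter ℕ) (𝓝 (limNorm x)) :=
  (exists_tendsto_norm_algCompress x).choose_spec

theorem tendsto_norm_mul (x y : AlgTensor D Compacts) :
    Tendsto (fun n => ‖algCompress n x * algCompress n y‖) (hyperfilter ℕ)
      (𝓝 (limNorm (x * y))) := by
  have h := (tendsto_algCompress_mul x y).mono_left Nat.hyperfilter_le_atTop
  have h1 : Tendsto (fun n => ‖algCompress n x * algCompress n y‖ - ‖algCompress n (x * y)‖)
      (hyperfilter ℕ) (𝓝 0) := by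
    refine squeeze_zero_norm (fun n => ?_) h
    rw [norm_sub_rev]
    exact abs_norm_sub_norm_le _ _
  have h2 := h1.add (tendsto_limNorm (x * y))
  rw [zero_add] at h2
  exact h2.congr fun n => by ring

/-- The C*-seminorm that is the limit of the norms of the compressions. -/
def limSeminorm : AlgTensor.CStarSeminorm D Compacts where
  toFun := limNorm
  nonneg x := ge_of_tendsto' (tendsto_limNorm x) fun _ => norm_nonneg _
  add_le x y := le_of_tendsto_of_tendsto' (tendsto_limNorm (x + y))
    ((tendsto_limNorm x).add (tendsto_limNorm y)) fun n => by rw [map_add]; exact norm_add_le _ _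
  smul c x := tendsto_nhds_unique (tendsto_limNorm (c • x))
    (((tendsto_limNorm x).const_mul ‖c‖).congr fun n => by rw [map_smul, norm_smul])
  mul_le x y := le_of_tendsto_of_tendsto' (tendsto_norm_mul x y)
    ((tendsto_limNorm x).mul (tendsto_limNorm y)) fun n => norm_mul_le _ _
  star_mul_self x := tendsto_nhds_unique (tendsto_norm_mul (star x) x)
    (((tendsto_limNorm x).mul (tendsto_limNorm x)).congr fun n => by
      rw [algCompress_star, CStarRing.norm_star_mul_self])
  tmul_le a k := le_of_tendsto' (tendsto_limNorm _) fun n => norm_algCompress_tmul_le n a k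

theorem coeff_matUnit_self (i j : ℕ) : coeff i j (matUnit i j) = 1 := by
  show ⟪ebasis i, InnerProductSpace.rankOne ℂ (ebasis i) (ebasis j) (ebasis j)⟫_ℂ = 1
  have h := fun i => ebasis.orthonormal.norm_eq_one i
  simp [InnerProductSpace.rankOne_apply, h]

/-- The maximal norm dominates `limSeminorm`, and for n > max(i, j) the compression of a ⊗ e_ij has
a among its entries. This lower bound makes the corner embedding injective. -/
theorem norm_le_norm_tmul_matUnit {D : Type u} [CStarAlgebra D] (a : D) (i j : ℕ) :
    ‖a‖ ≤ ‖AlgTensor.tmul a (matUnit i j)‖ := by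
  let _ := CStarAlgebra.spectralOrder D
  have _ := CStarAlgebra.spectralOrderedRing D
  refine le_trans ?_ (AlgTensor.le_maxNorm limSeminorm _)
  refine ge_of_tendsto (tendsto_limNorm _) (Nat.hyperfilter_le_atTop ?_)
  filter_upwards [eventually_gt_atTop (max i j)] with n hn
  have h := CStarMatrix.norm_entry_le_norm (M := algCompress n (AlgTensor.tmul a (matUnit i j)))
    (i := ⟨i, (le_max_left _ _).trans_lt hn⟩) (j := ⟨j, (le_max_right _ _).trans_lt hn⟩)
  rwa [algCompress_apply, algSlice_tmul, coeff_matUnit_self, one_smul] at h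

end MatrixCoeff

/-! ### The corner of a stabilization -/

section Corner

variable {D : Type u} [CStarAlgebra D]

/-- Elementary tensors in the stabilization, as a bilinear map. -/
def stabTmul : D →ₗ[ℂ] Compacts →ₗ[ℂ] Stab D :=
  LinearMap.mk₂ ℂ (fun a k => (CTensor.tmul a k : Stab D))
    (fun a b k => by
      rw [CTensor.tmul, CTensor.tmul, CTensor.tmul, ← map_add]
      exact congrArg CTensor.mk (TensorProduct.add_tmul a b k))
    (fun c a k => by
      rw [CTensor.tmul, CTensor.tmul, ← CTensor.mk_smul]
      exact congrArg CTensor.mk (TensorProduct.smul_tmul' c a k))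
    (fun a k l => by
      rw [CTensor.tmul, CTensor.tmul, CTensor.tmul, ← map_add, ← AlgTensor.tmul_add])
    (fun c a k => by
      rw [CTensor.tmul, CTensor.tmul, ← CTensor.mk_smul]
      exact congrArg CTensor.mk (TensorProduct.tmul_smul c a k))

theorem stabTmul_eq_mk (a : D) (k : Compacts) : stabTmul a k = CTensor.mk (AlgTensor.tmul a k) := rfl

theorem stabTmul_one (k : Compacts) : stabTmul (1 : D) k = oneTmul k := rfl

theorem stabTmul_mul (a b : D) (k l : Compacts) :
    stabTmul a k * stabTmul b l = stabTmul (a * b) (k * l) := by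
  simp only [stabTmul_eq_mk]
  rw [← CTensor.mk_mul, AlgTensor.tmul_mul_tmul]

theorem star_stabTmul (a : D) (k : Compacts) : star (stabTmul a k) = stabTmul (star a) (star k) := by
  simp only [stabTmul_eq_mk]
  rw [← CTensor.mk_star, AlgTensor.star_tmul]

theorem norm_stabTmul_le (a : D) (k : Compacts) : ‖stabTmul a k‖ ≤ ‖a‖ * ‖k‖ := by
  rw [stabTmul_eq_mk, CTensor.norm_mk]
  exact AlgTensor.norm_tmul_le a k

theorem stabMap_stabTmul {D' : Type v} [CStarAlgebra D'] (φ : D →⋆ₙₐ[ℂ] D') (a : D) (k : Compacts) :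
    Stab.map φ (stabTmul a k) = stabTmul (φ a) k := CTensor.map_mk φ _

theorem isStarProjection_ctrunc (n : ℕ) : IsStarProjection (ctrunc n) :=
  ⟨Subtype.ext (trunc_mul_trunc n), Subtype.ext (star_trunc n)⟩

theorem isStarProjection_matUnit (n : ℕ) : IsStarProjection (matUnit n n) :=
  ⟨matUnit_mul_same n n n, star_matUnit n n⟩

theorem _root_.IsStarProjection.stabTmul {a : D} {k : Compacts} (ha : IsStarProjection a)
    (hk : IsStarProjection k) : IsStarProjection (OpK.stabTmul a k) := by
  constructor
  · show _ * _ = _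
    rw [stabTmul_mul, ha.isIdempotentElem.eq, hk.isIdempotentElem.eq]
  · show star _ = _
    rw [star_stabTmul, ha.isSelfAdjoint.star_eq, hk.isSelfAdjoint.star_eq]

/-- A uniformly bounded sequence of additive maps that tends to zero on elementary tensors tends to
zero everywhere. -/
theorem tendsto_zero_of_stabTmul {F : Type*} [SeminormedAddCommGroup F] (T : ℕ → Stab D →+ F)
    (M : ℝ) (hT : ∀ n y, ‖T n y‖ ≤ M * ‖y‖)
    (h : ∀ a k, Tendsto (fun n => T n (stabTmul a k)) atTop (𝓝 0)) (y : Stab D) :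
    Tendsto (fun n => T n y) atTop (𝓝 0) := by
  have halg : ∀ x : AlgTensor D Compacts,
      Tendsto (fun n => T n (CTensor.mk x)) atTop (𝓝 0) := fun x => by
    induction x using AlgTensor.induction_on with
    | zero => simp only [map_zero]; exact tendsto_const_nhds
    | add x y hx hy => simpa using hx.add hy
    | tmul a k => exact h a k
  have hM : 0 ≤ |M| := abs_nonneg M
  rw [Metric.tendsto_atTop]
  intro ε hε
  obtain ⟨x, hx⟩ : ∃ x : AlgTensor D Compacts, dist y (CTensor.mk x) < ε / (2 * (|M| + 1)) := by
    obtain ⟨_, ⟨x, rfl⟩, hx⟩ := Metric.mem_closure_iff.1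
      (CTensor.isDenseInducing_mk.dense y) (ε / (2 * (|M| + 1))) (by positivity)
    exact ⟨x, hx⟩
  obtain ⟨N, hN⟩ := Metric.tendsto_atTop.1 (halg x) (ε / 2) (by positivity)
  refine ⟨N, fun n hn => ?_⟩
  have h1 := hN n hn
  rw [dist_zero_right] at h1 ⊢
  have h2 : ‖T n (y - CTensor.mk x)‖ ≤ ε / 2 := by
    refine (hT n _).trans ?_
    rw [dist_eq_norm, lt_div_iff₀ (by positivity)] at hx
    have h3 : M * ‖y - CTensor.mk x‖ ≤ |M| * ‖y - CTensor.mk x‖ :=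
      mul_le_mul_of_nonneg_right (le_abs_self M) (norm_nonneg _)
    nlinarith [norm_nonneg (y - CTensor.mk x)]
  have h3 : T n y = T n (y - CTensor.mk x) + T n (CTensor.mk x) := by rw [← map_add, sub_add_cancel]
  rw [h3]
  linarith [norm_add_le (T n (y - CTensor.mk x)) (T n (CTensor.mk x))]

/-- The embedding of `D` in a corner of its stabilization. -/
def cornerHom (D : Type u) [CStarAlgebra D] : D →⋆ₙₐ[ℂ] Stab D where
  toFun a := stabTmul a (matUnit 0 0)
  map_smul' c a := by rw [map_smul]; rfl
  map_zero' := by rw [map_zero]; rfl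
  map_add' a b := by rw [map_add]; rfl
  map_mul' a b := by rw [stabTmul_mul, matUnit_mul_same]
  map_star' a := by rw [star_stabTmul, star_matUnit]

theorem cornerHom_apply (a : D) : cornerHom D a = stabTmul a (matUnit 0 0) := rfl

theorem cornerHom_injective : Function.Injective (cornerHom D) := by
  rw [injective_iff_map_eq_zero]
  intro a ha
  have h := norm_le_norm_tmul_matUnit a 0 0
  rw [← CTensor.norm_mk, ← stabTmul_eq_mk, ← cornerHom_apply, ha, norm_zero] at h
  exact norm_le_zero_iff.1 h

theorem norm_cornerHom (a : D) : ‖cornerHom D a‖ = ‖a‖ :=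
  NonUnitalStarAlgHom.norm_map (cornerHom D) cornerHom_injective a

theorem stabMap_cornerHom {D' : Type v} [CStarAlgebra D'] (φ : D →⋆ₙₐ[ℂ] D') (a : D) :
    Stab.map φ (cornerHom D a) = cornerHom D' (φ a) := stabMap_stabTmul φ a _

/-- The range of the isometry `cornerHom` is closed, so by density it suffices to treat elementary
tensors; there e₀₀ k e₀₀ is a scalar multiple of e₀₀. Thus the e₀₀-corner of D ⊗ 𝒦 is D itself. -/
theorem exists_cornerHom_eq (y : Stab D) :
    ∃ a, cornerHom D a = oneTmul (matUnit 0 0) * y * oneTmul (matUnit 0 0) := by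
  have hc : IsClosed (Set.range (cornerHom D)) :=
    (NonUnitalStarAlgHom.isometry (cornerHom D) cornerHom_injective).isClosedEmbedding.isClosed_range
  have hcont : Continuous fun y : Stab D =>
      oneTmul (matUnit 0 0) * y * oneTmul (matUnit 0 0) := by fun_prop
  refine CTensor.induction_on y (hc.preimage hcont) fun x => ?_
  induction x using AlgTensor.induction_on with
  | zero => exact ⟨0, by simp⟩
  | add x y hx hy =>
    obtain ⟨a, ha⟩ := hx
    obtain ⟨b, hb⟩ := hy
    exact ⟨a + b, by rw [map_add, ha, hb, map_add, mul_add, add_mul]⟩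
  | tmul a k =>
    refine ⟨coeff 0 0 k • a, ?_⟩
    rw [← stabTmul_eq_mk, ← stabTmul_one, stabTmul_mul, stabTmul_mul, one_mul, mul_one,
      matUnit_mul_mul_matUnit, cornerHom_apply, map_smul, map_smul]
    rfl

end Corner

/-- By the C*-identity it is enough that (vp − v)*(vp − v) = 0, which is expanded using v*v = p. -/
theorem mul_eq_self_of_star_mul_self {B : Type u} [NonUnitalCStarAlgebra B] {v p : B}
    (hp : IsStarProjection p) (h : star v * v = p) : v * p = v := by
  have hpp : p * p = p := hp.isIdempotentElem
  have h0 : star (v * p - v) * (v * p - v) = 0 := by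
    calc star (v * p - v) * (v * p - v)
        = p * (star v * v) * p - p * (star v * v) - ((star v * v) * p - star v * v) := by
          rw [star_sub, star_mul, hp.isSelfAdjoint.star_eq]
          simp only [sub_mul, mul_sub, mul_assoc]
          abel
      _ = 0 := by rw [h, hpp, hpp]; simp
  exact sub_eq_zero.1 (CStarRing.star_mul_self_eq_zero_iff _ |>.1 h0)

/-! ### Moving matrices over `D` into `D` -/

/-- A sequence of partial isometries with initial projection `e` and orthogonal ranges. -/
structure Frame (D : Type u) [CStarAlgebra D] where
  e : D
  S : ℕ → D
  star_mul_self : ∀ i, star (S i) * S i = e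
  star_mul_of_ne : ∀ i j, i ≠ j → star (S i) * S j = 0
  mul_e : ∀ i, S i * e = S i

namespace Frame

variable {D : Type u} [CStarAlgebra D] (F : Frame D) (m : ℕ)

theorem isStarProjection_e : IsStarProjection F.e := by
  constructor
  · show F.e * F.e = F.e
    nth_rw 1 [← F.star_mul_self 0]
    rw [mul_assoc, F.mul_e, F.star_mul_self]
  · show star F.e = F.e
    rw [← F.star_mul_self 0, star_mul, star_star]

/-- The row of partial isometries. -/
def row : Stab D := ∑ i ∈ Finset.range m, stabTmul (F.S i) (matUnit 0 i)

/-- The diagonal matrix with entries `e`. -/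
def diag : Stab D := stabTmul F.e (ctrunc m)

theorem isStarProjection_diag : IsStarProjection (F.diag m) :=
  F.isStarProjection_e.stabTmul (isStarProjection_ctrunc m)

/-- Orthogonality of the ranges of the `S i` removes the off-diagonal terms. So the row is a partial
isometry from `diag m` into the corner of 1 ⊗ e₀₀, which is a copy of D. -/
theorem star_row_mul_row : star (F.row m) * F.row m = F.diag m := by
  rw [row, star_sum, Finset.sum_mul_sum, diag, ctrunc_eq_sum, map_sum]
  refine Finset.sum_congr rfl fun i hi => ?_
  rw [Finset.sum_eq_single i]
  · rw [star_stabTmul, stabTmul_mul, F.star_mul_self, star_matUnit, matUnit_mul_same]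
  · intro j _ hj
    rw [star_stabTmul, stabTmul_mul, F.star_mul_of_ne i j hj.symm, map_zero]; rfl
  · exact fun h => absurd hi h

theorem row_mul_diag : F.row m * F.diag m = F.row m :=
  mul_eq_self_of_star_mul_self (F.isStarProjection_diag m) (F.star_row_mul_row m)

theorem diag_mul_star_row : F.diag m * star (F.row m) = star (F.row m) := by
  have := congrArg star (F.row_mul_diag m)
  rwa [star_mul, (F.isStarProjection_diag m).isSelfAdjoint.star_eq] at this

theorem matUnit_mul_row : oneTmul (matUnit 0 0) * F.row m = F.row m := by
  rw [row, Finset.mul_sum]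
  refine Finset.sum_congr rfl fun i _ => ?_
  rw [← stabTmul_one, stabTmul_mul, one_mul, matUnit_mul_same]

theorem star_row_mul_matUnit : star (F.row m) * oneTmul (matUnit 0 0) = star (F.row m) := by
  have := congrArg star (F.matUnit_mul_row m)
  rwa [star_mul, star_oneTmul, star_matUnit] at this

theorem norm_row_le : ‖F.row m‖ ≤ 1 := by
  have h : ‖F.row m‖ * ‖F.row m‖ ≤ 1 := by
    rw [← CStarRing.norm_star_mul_self, star_row_mul_row]
    exact IsStarProjection.norm_le _ (F.isStarProjection_diag m)
  nlinarith [norm_nonneg (F.row m)]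

theorem exists_toBase (y : Stab D) : ∃ a, cornerHom D a = F.row m * y * star (F.row m) := by
  obtain ⟨a, ha⟩ := exists_cornerHom_eq (F.row m * y * star (F.row m))
  refine ⟨a, ha.trans ?_⟩
  rw [← mul_assoc, ← mul_assoc, matUnit_mul_row, mul_assoc, star_row_mul_matUnit]

/-- The compression of an element of `D ⊗ 𝒦` to a matrix, as an element of `D`. -/
def toBase (y : Stab D) : D := (F.exists_toBase m y).choose

theorem cornerHom_toBase (y : Stab D) :
    cornerHom D (F.toBase m y) = F.row m * y * star (F.row m) := (F.exists_toBase m y).choose_spec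

theorem toBase_add (y z : Stab D) : F.toBase m (y + z) = F.toBase m y + F.toBase m z := by
  apply cornerHom_injective
  rw [map_add]
  simp only [cornerHom_toBase, mul_add, add_mul]

theorem toBase_sub (y z : Stab D) : F.toBase m (y - z) = F.toBase m y - F.toBase m z := by
  apply cornerHom_injective
  rw [map_sub]
  simp only [cornerHom_toBase, mul_sub, sub_mul]

theorem toBase_star (y : Stab D) : F.toBase m (star y) = star (F.toBase m y) := by
  apply cornerHom_injective
  rw [map_star]
  simp only [cornerHom_toBase, star_mul, star_star, mul_assoc]

/-- The inserted `diag m` is the only obstruction to multiplicativity: `toBase m` is multiplicative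
as soon as one factor commutes with it. -/
theorem toBase_mul (y z : Stab D) :
    F.toBase m y * F.toBase m z = F.toBase m (y * F.diag m * z) := by
  apply cornerHom_injective
  rw [map_mul]
  simp only [cornerHom_toBase, ← star_row_mul_row, mul_assoc]

theorem toBase_diag_mul (y : Stab D) : F.toBase m (F.diag m * y) = F.toBase m y := by
  apply cornerHom_injective
  simp only [cornerHom_toBase, ← mul_assoc, row_mul_diag]

theorem toBase_mul_diag (y : Stab D) : F.toBase m (y * F.diag m) = F.toBase m y := by
  apply cornerHom_injective
  simp only [cornerHom_toBase, mul_assoc, diag_mul_star_row]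

theorem norm_toBase_le (y : Stab D) : ‖F.toBase m y‖ ≤ ‖y‖ := by
  rw [← norm_cornerHom, cornerHom_toBase]
  have h := F.norm_row_le m
  calc ‖F.row m * y * star (F.row m)‖ ≤ ‖F.row m‖ * ‖y‖ * ‖star (F.row m)‖ :=
        (norm_mul_le _ _).trans (mul_le_mul_of_nonneg_right (norm_mul_le _ _) (norm_nonneg _))
    _ ≤ 1 * ‖y‖ * 1 := by rw [norm_star]; gcongr
    _ = ‖y‖ := by ring

theorem isStarProjection_toBase {y : Stab D} (hy : IsStarProjection y)
    (h : Commute (F.diag m) y) : IsStarProjection (F.toBase m y) := by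
  constructor
  · show _ * _ = _
    rw [toBase_mul, mul_assoc, h.eq, ← mul_assoc, hy.isIdempotentElem.eq, toBase_mul_diag]
  · show star _ = _
    rw [← toBase_star, hy.isSelfAdjoint.star_eq]

theorem toBase_stabTmul_matUnit (a : D) {i : ℕ} (hi : i < m) :
    F.toBase m (stabTmul a (matUnit i i)) = F.S i * a * star (F.S i) := by
  apply cornerHom_injective
  have h1 : F.row m * stabTmul a (matUnit i i) = stabTmul (F.S i * a) (matUnit 0 i) := by
    rw [row, Finset.sum_mul, Finset.sum_eq_single i]
    · rw [stabTmul_mul, matUnit_mul_same]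
    · intro j _ hj
      rw [stabTmul_mul, matUnit_mul, if_neg hj, map_zero]
    · exact fun h => absurd (Finset.mem_range.2 hi) h
  have h2 : stabTmul (F.S i * a) (matUnit 0 i) * star (F.row m) =
      stabTmul (F.S i * a * star (F.S i)) (matUnit 0 0) := by
    rw [row, star_sum, Finset.mul_sum, Finset.sum_eq_single i]
    · rw [star_stabTmul, stabTmul_mul, star_matUnit, matUnit_mul_same]
    · intro j _ hj
      rw [star_stabTmul, stabTmul_mul, star_matUnit, matUnit_mul, if_neg hj.symm, map_zero]
    · exact fun h => absurd (Finset.mem_range.2 hi) h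
  rw [cornerHom_toBase, h1, h2, cornerHom_apply]

/-- A *-homomorphism that kills the frame kills the compressions. -/
theorem map_toBase {D' : Type v} [CStarAlgebra D'] (φ : D →⋆ₙₐ[ℂ] D') (hφ : ∀ i, φ (F.S i) = 0)
    (y : Stab D) : φ (F.toBase m y) = 0 := by
  apply cornerHom_injective
  rw [← stabMap_cornerHom, cornerHom_toBase, map_mul, map_mul, row, map_sum]
  have : ∀ i ∈ Finset.range m, Stab.map φ (stabTmul (F.S i) (matUnit 0 i)) = 0 := fun i _ => by
    rw [stabMap_stabTmul, hφ, map_zero]; rfl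
  rw [Finset.sum_eq_zero this, zero_mul, zero_mul, map_zero]

end Frame

/-! ### Murray–von Neumann equivalence -/

section MvN

/-- Murray–von Neumann equivalence is stable under small perturbations. -/
theorem exists_partialIsometry_of_norm_lt {D : Type u} [CStarAlgebra D] {p q x : D}
    (hp : IsStarProjection p) (hq : IsStarProjection q) (hxp : x * p = x) (hqx : q * x = x)
    (h1 : ‖star x * x - p‖ < 1) (h2 : ‖x * star x - q‖ < 1) :
    ∃ v : D, star v * v = p ∧ v * star v = q := by
  let _ := CStarAlgebra.spectralOrder D
  have _ := CStarAlgebra.spectralOrderedRing D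
  have hpp : p * p = p := hp.isIdempotentElem
  have hps : star p = p := hp.isSelfAdjoint
  have hpx : p * star x = star x := by rw [← hps, ← star_mul, hxp]
  have hxq : star x * q = star x := by
    rw [← hq.isSelfAdjoint.star_eq, ← star_mul, hqx]
  have hunit : ∀ a b : D, ‖a - b‖ < 1 → IsUnit (a + (1 - b)) := fun a b h => by
    have h' : ‖b - a‖ < 1 := by rwa [norm_sub_rev]
    have := (Units.oneSub (b - a) h').isUnit
    rw [Units.val_oneSub] at this
    convert this using 1; abel
  -- This element commutes with p and is at distance less than one from 1, hence invertible. On the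
  -- corner of p it is x*x, so x T^(-1/2) is the isometric part of the polar decomposition of x.
  set T := star x * x + (1 - p) with hT
  have hTpos : IsStrictlyPositive T := IsStrictlyPositive.iff_of_unital.2
    ⟨add_nonneg (star_mul_self_nonneg x) hp.one_sub.nonneg, hunit _ _ h1⟩
  have hpT : p * T = star x * x := by
    rw [hT, mul_add, mul_sub, mul_one, hpp, sub_self, add_zero, ← mul_assoc, hpx]
  have hTp : T * p = star x * x := by
    rw [hT, add_mul, sub_mul, one_mul, hpp, sub_self, add_zero, mul_assoc, hxp]
  have hcomm : Commute p T := hpT.trans hTp.symm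
  set c := T ^ (-(1 / 2) : ℝ) with hc
  have hcs : star c = c := (CFC.rpow_nonneg (a := T) (y := -(1 / 2))).isSelfAdjoint
  have hTc : Commute T c := by
    rw [hc, CFC.rpow_def]
    exact (Commute.cfc_nnreal (Commute.refl T) _).symm
  have hpc : Commute p c := by
    rw [hc, CFC.rpow_def]
    exact (Commute.cfc_nnreal hcomm.symm _).symm
  have hccT : c * c * T = 1 := by
    have h1 : c * c = T ^ (-1 : ℝ) := by
      rw [hc, ← CFC.rpow_add hTpos.isUnit]; norm_num
    have h2 : T ^ (-1 : ℝ) * T = 1 := by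
      have := CFC.rpow_neg_mul_rpow (a := T) 1 hTpos
      rwa [CFC.rpow_one T hTpos.nonneg] at this
    rw [h1, h2]
  refine ⟨x * c, ?_, ?_⟩
  · calc star (x * c) * (x * c) = c * (star x * x) * c := by
          rw [star_mul, hcs]; simp only [mul_assoc]
      _ = c * (p * (T * c)) := by rw [← hpT]; simp only [mul_assoc]
      _ = p * (c * c * T) := by rw [hTc.eq, ← mul_assoc, ← hpc.eq]; simp only [mul_assoc]
      _ = p := by rw [hccT, mul_one]
  · set r := x * c * star (x * c) with hr
    have hrx : r * x = x := by
      calc r * x = x * (c * c * (star x * x)) := by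
            rw [hr, star_mul, hcs]; simp only [mul_assoc]
        _ = x * (c * c * T * p) := by rw [← hTp]; simp only [mul_assoc]
        _ = x := by rw [hccT, one_mul, hxp]
    have hrq : r * q = r := by
      rw [hr, star_mul, mul_assoc, mul_assoc (star c), hxq]
    -- Both r and q fix x from the left and r q = r; cancelling the invertible element x x* + 1 − q
    -- gives r = q.
    have key : r * (x * star x + (1 - q)) = q * (x * star x + (1 - q)) := by
      rw [mul_add, mul_add, mul_sub, mul_sub, hrq, hq.isIdempotentElem.eq, ← mul_assoc, hrx,
        ← mul_assoc, hqx]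
      simp
    exact (hunit _ _ h2).mul_right_cancel key

variable {B : Type u} [NonUnitalCStarAlgebra B]

/-- The unitary w is cut down to w*p, which belongs to `B` because `B` is an ideal in its
unitization. -/
theorem UEquiv.exists_partialIsometry {p q : Proj B} (h : UEquiv p q) :
    ∃ v : B, star v * v = p ∧ v * star v = q := by
  obtain ⟨w, hw, h⟩ := h
  have hp := isStarProjection_inr.2 p.2
  obtain ⟨v, hv⟩ : ∃ v : B, (v : Unitization ℂ B) = star w * ((p : B) : Unitization ℂ B) :=
    ⟨_, Unitization.ext (by simp) rfl⟩
  have hw1 := Unitary.star_mul_self_of_mem hw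
  have hw2 := Unitary.mul_star_self_of_mem hw
  refine ⟨v, Unitization.inr_injective (R := ℂ) ?_, Unitization.inr_injective (R := ℂ) ?_⟩
  · rw [Unitization.inr_mul, Unitization.inr_star, hv, star_mul, star_star,
      hp.isSelfAdjoint.star_eq, mul_assoc, ← mul_assoc w, hw2, one_mul, hp.isIdempotentElem.eq]
  · rw [Unitization.inr_mul, Unitization.inr_star, hv, star_mul, star_star,
      hp.isSelfAdjoint.star_eq, mul_assoc, ← mul_assoc ((p : B) : Unitization ℂ B),
      hp.isIdempotentElem.eq, h]
    calc star w * (w * ((q : B) : Unitization ℂ B) * star w * w)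
        = (star w * w) * ((q : B) : Unitization ℂ B) * (star w * w) := by simp only [mul_assoc]
      _ = _ := by rw [hw1, one_mul, mul_one]

theorem HasRoom.uequiv_of_unitization (hB : HasRoom B) {p q : Proj B} {v : Unitization ℂ B}
    (hvp : star v * v = ((p : B) : Unitization ℂ B))
    (hvq : v * star v = ((q : B) : Unitization ℂ B)) : UEquiv p q :=
  hB.uequiv_of_partialIsometry hvp hvq
    (mul_eq_self_of_star_mul_self (isStarProjection_inr.2 p.2) hvp)

theorem HasRoom.uequiv_of_mul (hB : HasRoom B) {p q : Proj B} {v : B} (hvp : star v * v = p)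
    (hvq : v * star v = q) : UEquiv p q :=
  hB.uequiv_of_unitization (v := (v : Unitization ℂ B)) (by rw [← hvp]; simp) (by rw [← hvq]; simp)

theorem exists_uequiv_le (p : Proj B) {e : B} (he : IsStarProjection e)
    (h : ‖(p : B) - e * p‖ ≤ 1 / 4) : ∃ q : Proj B, UEquiv p q ∧ e * q = q := by
  obtain ⟨u, hu, hue⟩ := exists_unitary_le (isStarProjection_inr.2 p.2) (isStarProjection_inr.2 he)
    (by rwa [← Unitization.inr_mul, ← Unitization.inr_sub, Unitization.norm_inr])
  obtain ⟨q, hq⟩ := exists_conj p hu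
  refine ⟨q, UEquiv.symm ⟨u, hu, hq⟩, Unitization.inr_injective (R := ℂ) ?_⟩
  rw [Unitization.inr_mul, hq, hue]

end MvN

/-! ### Stability of `K₀` -/

section VLemmas

variable {A : Type u} [CStarAlgebra A]

theorem K0.mk_eq_of (p : Proj (Stab A)) : K0.mk p = Algebra.GrothendieckAddGroup.of (V.mk p) := rfl

theorem K0.exists_add_of (x : K0 A) : ∃ y z : V A,
    x + Algebra.GrothendieckAddGroup.of y = Algebra.GrothendieckAddGroup.of z := by
  obtain ⟨⟨z, y⟩, h⟩ := (AddLocalization.addMonoidOf (⊤ : AddSubmonoid (V A))).surj x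
  exact ⟨y, z, h⟩

theorem K0.of_eq_of_iff {x y : V A} : (Algebra.GrothendieckAddGroup.of x : K0 A) =
    Algebra.GrothendieckAddGroup.of y ↔ ∃ c : V A, c + x = c + y := by
  refine (AddLocalization.addMonoidOf (⊤ : AddSubmonoid (V A))).eq_iff_exists.trans ?_
  exact ⟨fun ⟨c, h⟩ => ⟨c, h⟩, fun ⟨c, h⟩ => ⟨⟨c, trivial⟩, h⟩⟩

theorem V.mk_eq_of_mul {p q : Proj (Stab A)} {v : Stab A} (hp : star v * v = p)
    (hq : v * star v = q) : V.mk p = V.mk q :=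
  V.mk_eq_mk.2 ((hasRoom_stab A).uequiv_of_mul hp hq)

theorem stabTmul_sub_left (a b : A) (k : Compacts) :
    stabTmul (a - b) k = stabTmul a k - stabTmul b k := by rw [map_sub]; rfl

theorem stabTmul_add_left (a b : A) (k : Compacts) :
    stabTmul (a + b) k = stabTmul a k + stabTmul b k := by rw [map_add]; rfl

/-- The elementary tensor of two projections. -/
def tmulProj {a : A} {k : Compacts} (ha : IsStarProjection a) (hk : IsStarProjection k) :
    Proj (Stab A) := ⟨stabTmul a k, ha.stabTmul hk⟩

variable (A) in
/-- The diagonal projection of size `n`. -/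
def truncProj (n : ℕ) : Proj (Stab A) := tmulProj (.one A) (isStarProjection_ctrunc n)

theorem coe_truncProj (n : ℕ) : (truncProj A n : Stab A) = oneTmul (ctrunc n) := rfl

theorem Frame.sub_diag_mul_stabTmul_mul_diag (F : Frame A) (m : ℕ) (a : A) (k : Compacts) :
    (oneTmul (ctrunc m) - F.diag m) * stabTmul a k * F.diag m =
      stabTmul (a * F.e - F.e * a * F.e) (ctrunc m * k * ctrunc m) := by
  rw [Frame.diag, ← stabTmul_one, sub_mul, stabTmul_mul, stabTmul_mul, sub_mul, stabTmul_mul,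
    stabTmul_mul, one_mul, stabTmul_sub_left]

theorem ctrunc_mul_matUnit_self (n : ℕ) : ctrunc n * matUnit n n = 0 := by
  rw [ctrunc_eq_sum, Finset.sum_mul]
  refine Finset.sum_eq_zero fun i hi => ?_
  rw [matUnit_mul, if_neg (Finset.mem_range.1 hi).ne]

theorem ctrunc_succ (n : ℕ) : ctrunc (n + 1) = ctrunc n + matUnit n n := by
  rw [ctrunc_eq_sum, ctrunc_eq_sum, Finset.sum_range_succ]

theorem ctrunc_mul_ctrunc {n m : ℕ} (h : n ≤ m) : ctrunc m * ctrunc n = ctrunc n := by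
  rw [ctrunc_eq_sum, ctrunc_eq_sum, Finset.sum_mul_sum, Finset.sum_comm]
  refine Finset.sum_congr rfl fun i hi => ?_
  rw [Finset.sum_eq_single i]
  · exact matUnit_mul_same i i i
  · intro j _ hj
    rw [matUnit_mul, if_neg hj]
  · exact fun hi' => absurd (Finset.mem_range.2 ((Finset.mem_range.1 hi).trans_le h)) hi'

theorem ctrunc_mul_ctrunc' {n m : ℕ} (h : n ≤ m) : ctrunc n * ctrunc m = ctrunc n := by
  have := congrArg star (ctrunc_mul_ctrunc h)
  rwa [star_mul, (isStarProjection_ctrunc n).isSelfAdjoint.star_eq,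
    (isStarProjection_ctrunc m).isSelfAdjoint.star_eq] at this

theorem V.mk_truncProj (n : ℕ) : V.mk (truncProj A n) =
    n • V.mk (tmulProj (.one A) (isStarProjection_matUnit 0)) := by
  induction n with
  | zero =>
    rw [zero_smul, V.zero_def]
    congr 1
    refine Subtype.ext ?_
    show stabTmul (1 : A) (ctrunc 0) = 0
    rw [ctrunc_eq_sum, Finset.sum_range_zero, map_zero]
  | succ n ih =>
    have h : (truncProj A n : Stab A) * tmulProj (.one A) (isStarProjection_matUnit n) = 0 := by
      show stabTmul _ _ * stabTmul _ _ = _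
      rw [stabTmul_mul, ctrunc_mul_matUnit_self, map_zero]
    have h1 : truncProj A (n + 1) = (truncProj A n).add _ h := by
      refine Subtype.ext ?_
      show stabTmul _ _ = stabTmul _ _ + stabTmul _ _
      rw [ctrunc_succ, map_add]
    rw [h1, ← V.mk_add_mk, ih, succ_nsmul]
    congr 1
    refine V.mk_eq_of_mul (v := stabTmul 1 (matUnit 0 n)) ?_ ?_
    · rw [star_stabTmul, stabTmul_mul, star_matUnit, matUnit_mul_same, star_one, one_mul]; rfl
    · rw [star_stabTmul, stabTmul_mul, star_matUnit, matUnit_mul_same, star_one, one_mul]; rfl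

theorem V.mk_truncProj_add (n m : ℕ) :
    V.mk (truncProj A n) + V.mk (truncProj A m) = V.mk (truncProj A (n + m)) := by
  rw [V.mk_truncProj, V.mk_truncProj, V.mk_truncProj, add_smul]

/-- The difference of a projection and a smaller one. -/
def Proj.sub {B : Type u} [NonUnitalCStarAlgebra B] (q p : Proj B) (h : (q : B) * p = p) : Proj B :=
  ⟨q - p, p.2.sub_of_mul_eq_left q.2 (by
    have := congrArg star h
    rwa [star_mul, p.2.isSelfAdjoint.star_eq, q.2.isSelfAdjoint.star_eq] at this)⟩

theorem V.mk_add_mk_sub {q p : Proj (Stab A)} (h : (q : Stab A) * p = p) :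
    V.mk p + V.mk (q.sub p h) = V.mk q := by
  have h' : (p : Stab A) * q = p := by
    have := congrArg star h
    rwa [star_mul, p.2.isSelfAdjoint.star_eq, q.2.isSelfAdjoint.star_eq] at this
  have h0 : (p : Stab A) * (q.sub p h) = 0 := by
    show (p : Stab A) * (q - p) = 0
    rw [mul_sub, h', p.2.isIdempotentElem.eq, sub_self]
  rw [V.mk_add_mk h0]
  congr 1
  exact Subtype.ext (add_sub_cancel _ _)

/-- The projections 1 ⊗ `trunc n` form an approximate unit; once ‖p − (1 ⊗ `trunc n`)p‖ ≤ 1/4, the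
threshold of `exists_uequiv_le`, p can be rotated below 1 ⊗ `trunc n`. -/
theorem V.exists_trunc_mul (p : Proj (Stab A)) :
    ∃ (n : ℕ) (q : Proj (Stab A)), UEquiv p q ∧ (oneTmul (ctrunc n) : Stab A) * q = q := by
  have h := (tendsto_iff_norm_sub_tendsto_zero.1 (tendsto_oneTmul_mul (p : Stab A))).eventually_le_const
    (show (0 : ℝ) < 1 / 4 by norm_num)
  obtain ⟨n, hn⟩ := h.exists
  rw [norm_sub_rev] at hn
  exact ⟨n, exists_uequiv_le p (truncProj A n).2 hn⟩

/-- Every class is a summand of a truncation. In stable equalities the auxiliary class may therefore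
be taken to be a truncation. -/
theorem V.exists_add_eq_trunc (x : V A) : ∃ (n : ℕ) (y : V A), x + y = V.mk (truncProj A n) := by
  induction x using V.ind with | _ p
  obtain ⟨n, q, hq, hn⟩ := V.exists_trunc_mul p
  exact ⟨n, _, by rw [V.mk_eq_mk.2 hq]; exact V.mk_add_mk_sub (q := truncProj A n) hn⟩

end VLemmas

/-! ### Frames in the unitized stabilization and asymptotic commutation -/

section Frames

variable (A : Type u) [CStarAlgebra A]

/-- The unitization of the stabilization. -/
abbrev UStab : Type u := Unitization ℂ (Stab A)

/-- The partial isometry that moves the first `N` basis vectors to the block number `i`. -/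
def blockShift (N i : ℕ) : Compacts := ∑ j ∈ Finset.range N, matUnit (i * N + j) j

theorem star_blockShift_mul (N i k : ℕ) : star (blockShift N i) * blockShift N k =
    if i = k then ctrunc N else 0 := by
  rw [blockShift, blockShift, star_sum, Finset.sum_mul_sum, ctrunc_eq_sum]
  simp only [star_matUnit, matUnit_mul]
  split_ifs with h
  · subst h
    refine Finset.sum_congr rfl fun j hj => ?_
    rw [Finset.sum_eq_single j]
    · rw [if_pos rfl]
    · intro l _ hl
      rw [if_neg (by omega)]
    · exact fun h => absurd hj h
  · refine Finset.sum_eq_zero fun j hj => Finset.sum_eq_zero fun l hl => if_neg fun h' => h ?_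
    have hj := Finset.mem_range.1 hj
    have hl := Finset.mem_range.1 hl
    -- Division by N recovers the number of a block from an index in it, so different blocks are
    -- disjoint.
    have h1 : (i * N + j) / N = i := by
      rw [mul_comm, Nat.mul_add_div (by omega), Nat.div_eq_of_lt hj, add_zero]
    have h2 : (k * N + l) / N = k := by
      rw [mul_comm, Nat.mul_add_div (by omega), Nat.div_eq_of_lt hl, add_zero]
    rw [← h1, h', h2]

theorem blockShift_mul_ctrunc (N i : ℕ) : blockShift N i * ctrunc N = blockShift N i := by
  rw [blockShift, ctrunc_eq_sum, Finset.sum_mul_sum]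
  refine Finset.sum_congr rfl fun j hj => ?_
  rw [Finset.sum_eq_single j]
  · exact matUnit_mul_same _ _ _
  · intro l _ hl
    rw [matUnit_mul, if_neg hl.symm]
  · exact fun h => absurd hj h

/-- The frame in `(A ⊗ 𝒦)⁺` with initial projection `1 ⊗ trunc N`. -/
def stdFrame (N : ℕ) : Frame (UStab A) where
  e := ((oneTmul (ctrunc N) : Stab A) : UStab A)
  S i := ((oneTmul (blockShift N i) : Stab A) : UStab A)
  star_mul_self i := by
    rw [← Unitization.inr_star, ← Unitization.inr_mul, star_oneTmul, oneTmul_mul,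
      star_blockShift_mul, if_pos rfl]
  star_mul_of_ne i j h := by
    rw [← Unitization.inr_star, ← Unitization.inr_mul, star_oneTmul, oneTmul_mul,
      star_blockShift_mul, if_neg h, ← stabTmul_one, map_zero, Unitization.inr_zero]
  mul_e i := by
    rw [← Unitization.inr_mul, oneTmul_mul, blockShift_mul_ctrunc]

theorem stdFrame_e (N : ℕ) : (stdFrame A N).e = ((oneTmul (ctrunc N) : Stab A) : UStab A) := rfl

theorem stdFrame_S (N i : ℕ) :
    (stdFrame A N).S i = ((oneTmul (blockShift N i) : Stab A) : UStab A) := rfl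

/-- The scalar part, as a non-unital homomorphism. -/
abbrev scal : UStab A →⋆ₙₐ[ℂ] ℂ := (scalarHom (Stab A) : UStab A →⋆ₐ[ℂ] ℂ)

theorem scal_apply (x : UStab A) : scal A x = x.fst := rfl

/-- The embedding of the scalars. -/
abbrev scalIncl : ℂ →⋆ₙₐ[ℂ] UStab A := (StarAlgHom.ofId ℂ (UStab A) : ℂ →⋆ₐ[ℂ] UStab A)

/-- The frame consists of elements of the ideal A ⊗ 𝒦, so everything produced by `toBase` has scalar
part zero. -/
theorem exists_toBase_eq_inr (N m : ℕ) {y : Stab (UStab A)} (hy : IsStarProjection y)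
    (h : Commute ((stdFrame A N).diag m) y) :
    ∃ p : Proj (Stab A), (stdFrame A N).toBase m y = ((p : Stab A) : UStab A) := by
  refine exists_proj_inr ((stdFrame A N).isStarProjection_toBase m hy h) ?_
  exact (stdFrame A N).map_toBase m (scal A) (fun i => by
    rw [scal_apply, stdFrame_S, Unitization.fst_inr]) y

variable {A}

theorem tendsto_mul_oneTmul (b : Stab A) :
    Tendsto (fun n => b * oneTmul (ctrunc n)) atTop (𝓝 b) := by
  have h := (tendsto_oneTmul_mul (star b)).star
  rw [star_star] at h
  refine h.congr fun n => ?_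
  rw [star_mul, star_star, star_oneTmul, (isStarProjection_ctrunc n).isSelfAdjoint.star_eq]

theorem norm_stdFrame_e_le (N : ℕ) : ‖(stdFrame A N).e‖ ≤ 1 :=
  IsStarProjection.norm_le _ (stdFrame A N).isStarProjection_e

theorem norm_diag_le (N m : ℕ) : ‖(stdFrame A N).diag m‖ ≤ 1 :=
  IsStarProjection.norm_le _ ((stdFrame A N).isStarProjection_diag m)

/-- Scalars commute with e, and on the remaining part e = 1 ⊗ `trunc N` acts as an approximate unit
as N grows. -/
theorem tendsto_commutator_e (a : UStab A) :
    Tendsto (fun N => a * (stdFrame A N).e - (stdFrame A N).e * a * (stdFrame A N).e)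
      atTop (𝓝 0) := by
  induction a using Unitization.ind with | _ r b
  have h := tendsto_iff_norm_sub_tendsto_zero.1 (tendsto_oneTmul_mul b)
  refine squeeze_zero_norm (fun N => ?_) h
  have hee : (stdFrame A N).e * (stdFrame A N).e = (stdFrame A N).e :=
    (stdFrame A N).isStarProjection_e.isIdempotentElem
  have h1 : ((Unitization.inl r : UStab A) + (b : UStab A)) * (stdFrame A N).e -
      (stdFrame A N).e * ((Unitization.inl r : UStab A) + (b : UStab A)) * (stdFrame A N).e =
      ((b - oneTmul (ctrunc N) * b : Stab A) : UStab A) * (stdFrame A N).e := by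
    have h2 : (stdFrame A N).e * (Unitization.inl r : UStab A) * (stdFrame A N).e =
        (Unitization.inl r : UStab A) * (stdFrame A N).e := by
      have h3 : (Unitization.inl r : UStab A) = algebraMap ℂ (UStab A) r := rfl
      rw [h3, ← Algebra.commutes, mul_assoc, hee]
    rw [Unitization.inr_sub, Unitization.inr_mul, ← stdFrame_e, add_mul, mul_add, add_mul, h2,
      sub_mul]
    abel
  rw [h1, norm_sub_rev]
  refine (norm_mul_le _ _).trans ?_
  rw [Unitization.norm_inr]
  exact mul_le_of_le_one_right (norm_nonneg _) (norm_stdFrame_e_le N)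

theorem norm_oneTmul_ctrunc_sub_le (N m : ℕ) (y z : Stab (UStab A)) (hz : ‖z‖ ≤ 1) :
    ‖(oneTmul (ctrunc m) - (stdFrame A N).diag m) * y * z‖ ≤ 2 * ‖y‖ := by
  have h1 : ‖(oneTmul (ctrunc m) - (stdFrame A N).diag m : Stab (UStab A))‖ ≤ 2 := by
    linarith [norm_sub_le (oneTmul (ctrunc m) : Stab (UStab A)) ((stdFrame A N).diag m),
      norm_oneTmul_ctrunc_le (A := UStab A) m, norm_diag_le (A := A) N m]
  calc ‖(oneTmul (ctrunc m) - (stdFrame A N).diag m) * y * z‖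
      ≤ ‖(oneTmul (ctrunc m) - (stdFrame A N).diag m : Stab (UStab A))‖ * ‖y‖ * ‖z‖ :=
        (norm_mul_le _ _).trans (mul_le_mul_of_nonneg_right (norm_mul_le _ _) (norm_nonneg _))
    _ ≤ 2 * ‖y‖ * 1 := by gcongr
    _ = 2 * ‖y‖ := mul_one _

/-- The diagonal matrices `e ⊗ trunc m` asymptotically commute with matrices. -/
theorem tendsto_commutator_diag (m : ℕ) (y : Stab (UStab A)) :
    Tendsto (fun N => (oneTmul (ctrunc m) - (stdFrame A N).diag m) * y * (stdFrame A N).diag m)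
      atTop (𝓝 0) := by
  refine tendsto_zero_of_stabTmul (fun N => (AddMonoidHom.mulRight ((stdFrame A N).diag m)).comp
    (AddMonoidHom.mulLeft (oneTmul (ctrunc m) - (stdFrame A N).diag m))) 2
    (fun N y => norm_oneTmul_ctrunc_sub_le N m y _ (norm_diag_le N m)) (fun a k => ?_) y
  have h := (tendsto_zero_iff_norm_tendsto_zero.1 (tendsto_commutator_e a)).mul_const
    ‖ctrunc m * k * ctrunc m‖
  rw [zero_mul] at h
  refine squeeze_zero_norm (fun N => ?_) h
  show ‖(oneTmul (ctrunc m) - (stdFrame A N).diag m) * stabTmul a k * (stdFrame A N).diag m‖ ≤ _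
  rw [Frame.sub_diag_mul_stabTmul_mul_diag]
  exact norm_stabTmul_le _ _

/-- The difference equals, up to sign, `toBase` of v* times the commutator-like term in the last
hypothesis. Since `toBase` is contractive and ‖v‖ ≤ 1, the bound on that term carries over. Strict
inequality with 1 is what the perturbation of approximate partial isometries requires. -/
theorem norm_star_toBase_mul_sub_lt {N m : ℕ} {p v : Stab (UStab A)} (hp : IsStarProjection p)
    (hv : star v * v = p) (htv : oneTmul (ctrunc m) * v = v)
    (h : ‖(oneTmul (ctrunc m) - (stdFrame A N).diag m) * v * (stdFrame A N).diag m‖ < 1) :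
    ‖star ((stdFrame A N).toBase m v) * (stdFrame A N).toBase m v - (stdFrame A N).toBase m p‖
      < 1 := by
  set F := stdFrame A N with hF
  have hv1 : ‖v‖ ≤ 1 := by
    have h1 : ‖v‖ * ‖v‖ ≤ 1 := by
      rw [← CStarRing.norm_star_mul_self, hv]
      exact IsStarProjection.norm_le _ hp
    nlinarith [norm_nonneg v]
  have h1 : star (F.toBase m v) * F.toBase m v - F.toBase m p =
      - F.toBase m (star v * ((oneTmul (ctrunc m) - F.diag m) * v * F.diag m)) := by
    rw [← F.toBase_star, F.toBase_mul, ← F.toBase_mul_diag m p,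
      ← F.toBase_mul_diag m (star v * F.diag m * v), ← hv, sub_mul, htv, sub_mul, mul_sub,
      F.toBase_sub, neg_sub]
    simp only [mul_assoc]
  rw [h1, norm_neg]
  refine (F.norm_toBase_le m _).trans_lt ((norm_mul_le _ _).trans_lt ?_)
  rw [norm_star]
  exact (mul_le_of_le_one_left (norm_nonneg _) hv1).trans_lt h

end Frames

/-! ### Injectivity -/

section Augment

variable {D : Type u} [CStarAlgebra D]

theorem truncProj_mul_tmulProj (n : ℕ) (p : Proj D) :
    (truncProj D n : Stab D) * tmulProj p.2 (isStarProjection_matUnit n) = 0 := by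
  show stabTmul _ _ * stabTmul _ _ = _
  rw [stabTmul_mul, ctrunc_mul_matUnit_self, map_zero]

/-- The diagonal projection with entries `1` (`n` times) and `p`. -/
def augProj (n : ℕ) (p : Proj D) : Proj (Stab D) :=
  (truncProj D n).add _ (truncProj_mul_tmulProj n p)

theorem coe_augProj (n : ℕ) (p : Proj D) :
    (augProj n p : Stab D) = oneTmul (ctrunc n) + stabTmul (p : D) (matUnit n n) := rfl

theorem V.mk_augProj (n : ℕ) (p : Proj D) :
    V.mk (augProj n p) = V.mk (truncProj D n) + V.mk (p.map (cornerHom D)) := by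
  rw [augProj, ← V.mk_add_mk]
  congr 1
  have hp : (p : D) * p = p := p.2.isIdempotentElem
  have hs : star (p : D) = p := p.2.isSelfAdjoint
  refine V.mk_eq_of_mul (v := stabTmul (p : D) (matUnit 0 n)) ?_ ?_
  · rw [star_stabTmul, stabTmul_mul, star_matUnit, matUnit_mul_same, hs, hp]; rfl
  · rw [star_stabTmul, stabTmul_mul, star_matUnit, matUnit_mul_same, hs, hp]; rfl

theorem ctrunc_succ_mul_matUnit (n : ℕ) : ctrunc (n + 1) * matUnit n n = matUnit n n := by
  rw [ctrunc_succ, add_mul, ctrunc_mul_matUnit_self, zero_add, matUnit_mul_same]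

theorem matUnit_mul_ctrunc_succ (n : ℕ) : matUnit n n * ctrunc (n + 1) = matUnit n n := by
  have := congrArg star (ctrunc_succ_mul_matUnit n)
  rwa [star_mul, star_matUnit, (isStarProjection_ctrunc (n + 1)).isSelfAdjoint.star_eq] at this

theorem oneTmul_mul_augProj (n : ℕ) (p : Proj D) :
    (oneTmul (ctrunc (n + 1)) : Stab D) * augProj n p = augProj n p := by
  rw [coe_augProj, mul_add, oneTmul_mul, ctrunc_mul_ctrunc n.le_succ, ← stabTmul_one (ctrunc (n + 1)),
    stabTmul_mul, one_mul, ctrunc_succ_mul_matUnit]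

namespace Frame

variable (F : Frame D)

theorem commute_diag_oneTmul {n m : ℕ} (h : n ≤ m) :
    Commute (F.diag m) (oneTmul (ctrunc n) : Stab D) := by
  show _ * _ = _ * _
  rw [Frame.diag, ← stabTmul_one, stabTmul_mul, stabTmul_mul, mul_one, one_mul,
    ctrunc_mul_ctrunc h, ctrunc_mul_ctrunc' h]

theorem commute_diag_augProj (n : ℕ) (p : Proj D) (hp : F.e * p = p) :
    Commute (F.diag (n + 1)) (augProj n p : Stab D) := by
  have hp' : (p : D) * F.e = p := by
    have := congrArg star hp
    rwa [star_mul, p.2.isSelfAdjoint.star_eq, F.isStarProjection_e.isSelfAdjoint.star_eq] at this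
  rw [coe_augProj]
  refine (F.commute_diag_oneTmul n.le_succ).add_right ?_
  show stabTmul F.e (ctrunc (n + 1)) * stabTmul (p : D) (matUnit n n) =
    stabTmul (p : D) (matUnit n n) * stabTmul F.e (ctrunc (n + 1))
  rw [stabTmul_mul, stabTmul_mul, hp, hp', ctrunc_succ_mul_matUnit, matUnit_mul_ctrunc_succ]

theorem toBase_augProj (n : ℕ) (p : Proj D) :
    F.toBase (n + 1) (augProj n p : Stab D) =
      F.toBase (n + 1) (oneTmul (ctrunc n)) + F.S n * p * star (F.S n) := by
  rw [coe_augProj, toBase_add, toBase_stabTmul_matUnit _ _ _ n.lt_succ_self]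

theorem toBase_zero (m : ℕ) : F.toBase m 0 = 0 := by
  have := F.toBase_sub m 0 0
  rwa [sub_self, sub_self] at this

theorem toBase_mul_conj (n : ℕ) (p : Proj D) (hp : F.e * p = p) :
    F.toBase (n + 1) (oneTmul (ctrunc n)) * (F.S n * p * star (F.S n)) = 0 := by
  rw [← F.toBase_stabTmul_matUnit (n + 1) _ n.lt_succ_self, toBase_mul, Frame.diag, ← stabTmul_one,
    stabTmul_mul, stabTmul_mul, one_mul, hp, ctrunc_mul_ctrunc' n.le_succ, ctrunc_mul_matUnit_self,
    map_zero, toBase_zero]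

theorem toBase_mul_toBase_of_mul {m : ℕ} {x y z : Stab D} (hy : Commute (F.diag m) y)
    (h : x * y = z) : F.toBase m x * F.toBase m y = F.toBase m z := by
  rw [toBase_mul, mul_assoc, hy.eq, ← mul_assoc, h, toBase_mul_diag]

theorem toBase_mul_toBase_of_mul' {m : ℕ} {x y z : Stab D} (hx : Commute (F.diag m) x)
    (h : x * y = z) : F.toBase m x * F.toBase m y = F.toBase m z := by
  rw [toBase_mul, ← hx.eq, mul_assoc, h, toBase_diag_mul]

end Frame

end Augment

/-! ### The corner embedding on V(A) and cancellation of the compressed block -/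

section Injective

variable {A : Type u} [CStarAlgebra A]

/-- The embedding of `A ⊗ 𝒦` in the stabilization of its unitization. -/
def stabIncl (A : Type u) [CStarAlgebra A] : Stab A →⋆ₙₐ[ℂ] Stab (UStab A) :=
  (cornerHom (UStab A)).comp (Unitization.inrNonUnitalStarAlgHom ℂ (Stab A))

/-- A projection of `A ⊗ 𝒦` as a projection of the unitization. -/
def Proj.inr (p : Proj (Stab A)) : Proj (UStab A) := ⟨((p : Stab A) : UStab A),
  isStarProjection_inr.2 p.2⟩

theorem Proj.map_stabIncl (p : Proj (Stab A)) :
    p.map (stabIncl A) = p.inr.map (cornerHom (UStab A)) := rfl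

/-- `toBase` turns diag(1_n, r) into the orthogonal sum of c and S_n r S_n*, where c does not depend
on r, and S_n r S_n* is equivalent to r. The given v need only lie in the unitization, which
suffices for equivalence in a stable algebra. -/
theorem V.mk_add_eq_of_partialIsometry {p q : Proj (Stab A)} {n N : ℕ}
    (hp : (stdFrame A N).e * p.inr = p.inr) (hq : (stdFrame A N).e * q.inr = q.inr)
    {c : Proj (Stab A)}
    (hc : (stdFrame A N).toBase (n + 1) (oneTmul (ctrunc n)) = ((c : Stab A) : UStab A))
    {v : UStab A}
    (h1 : star v * v = (stdFrame A N).toBase (n + 1) (augProj n p.inr : Stab (UStab A)))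
    (h2 : v * star v = (stdFrame A N).toBase (n + 1) (augProj n q.inr : Stab (UStab A))) :
    V.mk c + V.mk p = V.mk c + V.mk q := by
  set F := stdFrame A N with hF
  set s : Stab A := oneTmul (blockShift N n) with hs
  -- For r below e, the element s r of A ⊗ 𝒦 is a partial isometry from r to s r s*, because s*s is
  -- e.
  have hconj : ∀ r : Proj (Stab A), F.e * r.inr = r.inr → ∃ (r' : Proj (Stab A))
      (h : (c : Stab A) * r' = 0), V.mk r' = V.mk r ∧
      F.toBase (n + 1) (augProj n r.inr : Stab (UStab A)) =
        (((c.add r' h : Proj (Stab A)) : Stab A) : UStab A) := fun r hr => by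
    have hss : star s * s * r = r := by
      apply Unitization.inr_injective (R := ℂ)
      rw [hs, star_oneTmul, oneTmul_mul, star_blockShift_mul, if_pos rfl, Unitization.inr_mul]
      exact hr
    have hrr : (r : Stab A) * r = r := r.2.isIdempotentElem
    have hrs : star (r : Stab A) = r := r.2.isSelfAdjoint
    have e1 : star (s * r) * (s * r) = (r : Stab A) := by
      rw [star_mul, hrs, mul_assoc, ← mul_assoc (star s), hss, hrr]
    have e2 : s * r * star (s * r) = s * r * star s := by
      rw [star_mul, hrs, ← mul_assoc, mul_assoc s, hrr]
    have hr' : IsStarProjection (s * r * star s) := by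
      rw [← e2]
      constructor
      · show _ * _ = _
        rw [← mul_assoc, mul_assoc (s * (r : Stab A)) _ (s * r), e1, mul_assoc s, hrr]
      · show star _ = _
        rw [star_mul, star_star]
    have hS : F.S n * r.inr * star (F.S n) = ((s * r * star s : Stab A) : UStab A) := by
      rw [Unitization.inr_mul, Unitization.inr_mul, Unitization.inr_star]; rfl
    have hcr : (c : Stab A) * (s * r * star s) = 0 := by
      apply Unitization.inr_injective (R := ℂ)
      have h0 := F.toBase_mul_conj n r.inr hr
      rwa [hc, hS, ← Unitization.inr_mul] at h0
    refine ⟨⟨s * r * star s, hr'⟩, hcr, (V.mk_eq_of_mul e1 e2).symm, ?_⟩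
    refine (F.toBase_augProj n r.inr).trans ?_
    rw [hc, hS]
    exact (Unitization.inr_add ℂ _ _).symm
  obtain ⟨p', hp', hpp, hp1⟩ := hconj p hp
  obtain ⟨q', hq', hqq, hq1⟩ := hconj q hq
  rw [← hpp, ← hqq, V.mk_add_mk hp', V.mk_add_mk hq', V.mk_eq_mk]
  exact (hasRoom_stab A).uequiv_of_unitization (h1.trans hp1) (h2.trans hq1)

/-- A partial isometry v over D between the augmented projections is compressed by the frame. The
compressed end projections are exact, as p and q lie below e_N; the compressed v is only
approximately a partial isometry and is corrected by `exists_partialIsometry_of_norm_lt`. -/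
theorem V.exists_add_eq_of_le {p q : Proj (Stab A)} {n N₀ : ℕ}
    (hp : (oneTmul (ctrunc N₀) : Stab A) * p = p) (hq : (oneTmul (ctrunc N₀) : Stab A) * q = q)
    (h : UEquiv (augProj n p.inr) (augProj n q.inr)) :
    ∃ c : V A, c + V.mk p = c + V.mk q := by
  obtain ⟨v, hvp, hvq⟩ := h.exists_partialIsometry
  set P := augProj n p.inr with hP
  set Q := augProj n q.inr with hQ
  have hvP : v * P = v := mul_eq_self_of_star_mul_self P.2 hvp
  have hvQ : star v * Q = star v := mul_eq_self_of_star_mul_self Q.2 (by rw [star_star, hvq])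
  have hQv : (Q : Stab (UStab A)) * v = v := by
    have := congrArg star hvQ
    rwa [star_mul, star_star, Q.2.isSelfAdjoint.star_eq] at this
  have hPv : (P : Stab (UStab A)) * star v = star v := by
    have := congrArg star hvP
    rwa [star_mul, P.2.isSelfAdjoint.star_eq] at this
  have htv : oneTmul (ctrunc (n + 1)) * v = v := by
    rw [← hQv, ← mul_assoc, oneTmul_mul_augProj]
  have htv' : oneTmul (ctrunc (n + 1)) * star v = star v := by
    rw [← hPv, ← mul_assoc, oneTmul_mul_augProj]
  have l1 := (tendsto_zero_iff_norm_tendsto_zero.1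
    (tendsto_commutator_diag (n + 1) v)).eventually_lt_const zero_lt_one
  have l2 := (tendsto_zero_iff_norm_tendsto_zero.1
    (tendsto_commutator_diag (n + 1) (star v))).eventually_lt_const zero_lt_one
  -- N is large enough for v and v* to be compressed with error below one, and N ≥ N₀ keeps p and q
  -- below e_N.
  obtain ⟨N, ⟨hN1, hN2⟩, hN⟩ := ((l1.and l2).and (eventually_ge_atTop N₀)).exists
  have hle : ∀ r : Proj (Stab A), (oneTmul (ctrunc N₀) : Stab A) * r = r →
      (stdFrame A N).e * r.inr = r.inr := fun r hr => by
    have : (oneTmul (ctrunc N) : Stab A) * r = r := by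
      rw [← hr, ← mul_assoc, oneTmul_mul, ctrunc_mul_ctrunc hN]
    show ((oneTmul (ctrunc N) : Stab A) : UStab A) * ((r : Stab A) : UStab A) = _
    rw [← Unitization.inr_mul, this]; rfl
  have hcP := (stdFrame A N).commute_diag_augProj n p.inr (hle p hp)
  have hcQ := (stdFrame A N).commute_diag_augProj n q.inr (hle q hq)
  have k1 := norm_star_toBase_mul_sub_lt P.2 hvp htv hN1
  have k2 := norm_star_toBase_mul_sub_lt Q.2 (by rw [star_star, hvq]) htv' hN2
  rw [Frame.toBase_star, star_star] at k2
  obtain ⟨x, hx1, hx2⟩ := exists_partialIsometry_of_norm_lt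
    ((stdFrame A N).isStarProjection_toBase _ P.2 hcP)
    ((stdFrame A N).isStarProjection_toBase _ Q.2 hcQ)
    ((stdFrame A N).toBase_mul_toBase_of_mul hcP hvP)
    ((stdFrame A N).toBase_mul_toBase_of_mul' hcQ hQv) k1 k2
  obtain ⟨c, hc⟩ := exists_toBase_eq_inr A N (n + 1) (truncProj (UStab A) n).2
    ((stdFrame A N).commute_diag_oneTmul n.le_succ)
  exact ⟨V.mk c, V.mk_add_eq_of_partialIsometry (hle p hp) (hle q hq) hc hx1 hx2⟩

/-- The map `V(A) → V((A ⊗ 𝒦)⁺)` induced by the embedding in a corner. -/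
def VstabIncl (A : Type u) [CStarAlgebra A] : V A →+ V (UStab A) where
  toFun := Quotient.map (sa := projSetoid (Stab A)) (sb := projSetoid (Stab (UStab A)))
    (Proj.map (stabIncl A)) fun _ _ h => h.map _
  map_zero' := congrArg V.mk (Subtype.ext (map_zero (stabIncl A)))
  map_add' x y := by
    induction x using V.ind with | _ p
    induction y using V.ind with | _ q
    obtain ⟨r, hr, hpr⟩ := V.exists_orthogonal p q
    rw [V.mk_eq_mk.2 hr, V.mk_add_mk hpr]
    refine Eq.trans ?_ (V.mk_add_mk (p := p.map (stabIncl A)) (q := r.map (stabIncl A)) ?_).symm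
    · exact congrArg V.mk (Subtype.ext (map_add (stabIncl A) _ _))
    · show stabIncl A p * stabIncl A r = 0
      rw [← map_mul, hpr, map_zero]

theorem VstabIncl_mk (p : Proj (Stab A)) : VstabIncl A (V.mk p) = V.mk (p.map (stabIncl A)) := rfl

/-- The auxiliary class is enlarged to a truncation, and p and q are moved below a common
truncation; then the equality says that diag(1_n, p) and diag(1_n, q) are equivalent over D. -/
theorem V.exists_add_eq_of_stabIncl {x y : V A} {c : V (UStab A)}
    (h : c + VstabIncl A x = c + VstabIncl A y) : ∃ d : V A, d + x = d + y := by
  obtain ⟨n, c', hc'⟩ := V.exists_add_eq_trunc c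
  have h1 : V.mk (truncProj (UStab A) n) + VstabIncl A x =
      V.mk (truncProj (UStab A) n) + VstabIncl A y := by
    rw [← hc', add_comm c, add_assoc, add_assoc, h]
  induction x using V.ind with | _ p
  induction y using V.ind with | _ q
  obtain ⟨n₁, p', hp, hp1⟩ := V.exists_trunc_mul p
  obtain ⟨n₂, q', hq, hq1⟩ := V.exists_trunc_mul q
  rw [V.mk_eq_mk.2 hp, V.mk_eq_mk.2 hq] at h1 ⊢
  rw [VstabIncl_mk, VstabIncl_mk, Proj.map_stabIncl, Proj.map_stabIncl, ← V.mk_augProj,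
    ← V.mk_augProj, V.mk_eq_mk] at h1
  refine V.exists_add_eq_of_le (N₀ := max n₁ n₂) ?_ ?_ h1
  · rw [← hp1, ← mul_assoc, oneTmul_mul, ctrunc_mul_ctrunc (le_max_left _ _)]
  · rw [← hq1, ← mul_assoc, oneTmul_mul, ctrunc_mul_ctrunc (le_max_right _ _)]

variable (A) in
/-- The homomorphism `K₀(A) → K₀((A ⊗ 𝒦)⁺)` induced by the embedding in a corner. -/
def K0stabIncl : K0 A →+ K0 (UStab A) :=
  Algebra.GrothendieckAddGroup.lift (Algebra.GrothendieckAddGroup.of.comp (VstabIncl A))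

theorem K0stabIncl_of (x : V A) : K0stabIncl A (Algebra.GrothendieckAddGroup.of x) =
    Algebra.GrothendieckAddGroup.of (VstabIncl A x) :=
  DFunLike.congr_fun (Algebra.GrothendieckAddGroup.lift.symm_apply_apply
    (Algebra.GrothendieckAddGroup.of.comp (VstabIncl A))) x

theorem K0stabIncl_mk (p : Proj (Stab A)) :
    K0stabIncl A (K0.mk p) = K0.mk (p.map (stabIncl A)) := K0stabIncl_of (V.mk p)

theorem K0stabIncl_injective : Function.Injective (K0stabIncl A) := by
  rw [injective_iff_map_eq_zero]
  intro x hx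
  obtain ⟨y, z, h⟩ := K0.exists_add_of x
  have h1 := congrArg (K0stabIncl A) h
  rw [map_add, hx, zero_add, K0stabIncl_of, K0stabIncl_of, K0.of_eq_of_iff] at h1
  obtain ⟨c, hc⟩ := h1
  obtain ⟨d, hd⟩ := V.exists_add_eq_of_stabIncl hc
  rw [← K0.of_eq_of_iff.2 ⟨d, hd⟩] at h
  exact add_eq_right.1 h

end Injective

/-! ### Surjectivity -/

section Finite

/-- The compressions of `ℂ ⊗ 𝒦` to a matrix algebra are spanned by the matrix units. -/
theorem trunc_mul_mul_trunc_mem_span (n : ℕ) (y : Stab ℂ) :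
    oneTmul (ctrunc n) * y * oneTmul (ctrunc n) ∈ Submodule.span ℂ
      (Set.range fun ij : Fin n × Fin n => (oneTmul (matUnit ij.1 ij.2) : Stab ℂ)) := by
  set W := Submodule.span ℂ
    (Set.range fun ij : Fin n × Fin n => (oneTmul (matUnit ij.1 ij.2) : Stab ℂ)) with hW
  have hfin : FiniteDimensional ℂ W := FiniteDimensional.span_of_finite ℂ (Set.finite_range _)
  -- A finite-dimensional subspace is closed, so the claim passes from elementary tensors to the
  -- completion.
  have hc : IsClosed (W : Set (Stab ℂ)) := W.closed_of_finiteDimensional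
  have hcont : Continuous fun y : Stab ℂ => oneTmul (ctrunc n) * y * oneTmul (ctrunc n) := by
    fun_prop
  refine CTensor.induction_on y (hc.preimage hcont) fun x => ?_
  induction x using AlgTensor.induction_on with
  | zero => rw [map_zero, mul_zero, zero_mul]; exact W.zero_mem
  | add x y hx hy => rw [map_add, mul_add, add_mul]; exact W.add_mem hx hy
  | tmul a k =>
    rw [← stabTmul_eq_mk, ← stabTmul_one, stabTmul_mul, stabTmul_mul, one_mul, mul_one,
      ctrunc_eq_sum, Finset.sum_mul, Finset.sum_mul, map_sum]
    refine W.sum_mem fun i hi => ?_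
    rw [Finset.mul_sum, map_sum]
    refine W.sum_mem fun j hj => ?_
    have h : stabTmul a (matUnit i i * k * matUnit j j) =
        (a * coeff i j k) • (oneTmul (matUnit i j) : Stab ℂ) := by
      have ha : stabTmul a (matUnit i j) = a • (stabTmul 1 (matUnit i j) : Stab ℂ) := by
        rw [← LinearMap.smul_apply, ← map_smul, smul_eq_mul, mul_one]
      rw [matUnit_mul_mul_matUnit, map_smul, mul_comm, mul_smul, ← stabTmul_one, ha]
    rw [h]
    exact W.smul_mem _ (Submodule.subset_span
      ⟨(⟨i, Finset.mem_range.1 hi⟩, ⟨j, Finset.mem_range.1 hj⟩), rfl⟩)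

/-- The diagonal projections in `ℂ ⊗ 𝒦` are finite. -/
theorem mul_star_eq_of_star_mul_eq_trunc {n : ℕ} {v : Stab ℂ}
    (hv : star v * v = oneTmul (ctrunc n)) (hEv : oneTmul (ctrunc n) * v = v) :
    v * star v = oneTmul (ctrunc n) := by
  set E : Stab ℂ := oneTmul (ctrunc n) with hE
  have hEp : IsStarProjection E := (truncProj ℂ n).2
  have hEE : E * E = E := hEp.isIdempotentElem
  have hvE : v * E = v := mul_eq_self_of_star_mul_self hEp hv
  let W : Submodule ℂ (Stab ℂ) :=
    { carrier := {y | E * y * E = y}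
      zero_mem' := by show E * 0 * E = 0; rw [mul_zero, zero_mul]
      add_mem' := fun {x y} hx hy => by
        show E * (x + y) * E = x + y
        rw [mul_add, add_mul, hx, hy]
      smul_mem' := fun c y hy => by
        show E * (c • y) * E = c • y
        rw [mul_smul_comm, smul_mul_assoc, hy] }
  have hWfin : FiniteDimensional ℂ W := by
    have hfin : FiniteDimensional ℂ (Submodule.span ℂ
        (Set.range fun ij : Fin n × Fin n => (oneTmul (matUnit ij.1 ij.2) : Stab ℂ))) :=
      FiniteDimensional.span_of_finite ℂ (Set.finite_range _)
    refine Submodule.finiteDimensional_of_le (S₂ := Submodule.span ℂ (Set.range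
      fun ij : Fin n × Fin n => (oneTmul (matUnit ij.1 ij.2) : Stab ℂ)))
      fun y (hy : E * y * E = y) => ?_
    rw [← hy]
    exact trunc_mul_mul_trunc_mem_span n y
  have hmem : ∀ y ∈ W, v * y ∈ W := fun y (hy : E * y * E = y) => by
    have hyE : y * E = y := by rw [← hy, mul_assoc, hEE]
    show E * (v * y) * E = v * y
    rw [mul_assoc, mul_assoc, hyE, ← mul_assoc, hEv]
  -- Left multiplication by v on the finite-dimensional corner `W` is injective because v*v = E,
  -- hence surjective; a right inverse y of v in the corner forces v v* = E.
  let L : W →ₗ[ℂ] W := (LinearMap.mulLeft ℂ v).restrict hmem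
  have hinj : Function.Injective L := by
    rw [injective_iff_map_eq_zero]
    rintro ⟨y, hy⟩ h
    have h0 : v * y = 0 := congrArg Subtype.val h
    have hy' : E * y * E = y := hy
    refine Subtype.ext ?_
    have hEy : E * y = y := by rw [← hy', ← mul_assoc, ← mul_assoc, hEE]
    show y = 0
    rw [← hEy, ← hv, mul_assoc, h0, mul_zero]
  obtain ⟨⟨y, hy⟩, hLy⟩ := LinearMap.injective_iff_surjective.1 hinj
    ⟨E, by show E * E * E = E; rw [hEE, hEE]⟩
  have hvy : v * y = E := congrArg Subtype.val hLy
  have h1 : v * star v * E = E := by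
    rw [← hvy, ← mul_assoc, mul_assoc v, hv, hvE]
  have h2 : star v * E = star v := by
    have := congrArg star hEv
    rwa [star_mul, hEp.isSelfAdjoint.star_eq] at this
  rwa [mul_assoc, h2] at h1

/-- A projection below 1_n and equivalent to it equals 1_n, by finiteness applied to the partial
isometry that implements the equivalence. -/
theorem eq_truncProj_of_uequiv {n : ℕ} {g : Proj (Stab ℂ)} (h : UEquiv (truncProj ℂ n) g)
    (hg : (oneTmul (ctrunc n) : Stab ℂ) * g = g) : g = truncProj ℂ n := by
  obtain ⟨v, h1, h2⟩ := h.exists_partialIsometry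
  have hgv : (g : Stab ℂ) * v = v := by
    have := mul_eq_self_of_star_mul_self (v := star v) g.2 (by rw [star_star, h2])
    have := congrArg star this
    rwa [star_mul, star_star, g.2.isSelfAdjoint.star_eq] at this
  refine Subtype.ext (h2.symm.trans (mul_star_eq_of_star_mul_eq_trunc h1 ?_))
  rw [← hgv, ← mul_assoc, hg]

end Finite

/-! ### Splitting off the scalar part of matrices over (A ⊗ 𝒦)⁺ -/

section Scalars

variable {A : Type u} [CStarAlgebra A]

theorem scal_scalIncl (r : ℂ) : scal A (scalIncl A r) = r := by
  show (algebraMap ℂ (UStab A) r).fst = r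
  rw [Unitization.algebraMap_eq_inl, Unitization.fst_inl]

theorem stabMap_scal_scalIncl (y : Stab ℂ) :
    Stab.map (scal A) (Stab.map (scalIncl A) y) = y := by
  have h : (scal A).comp (scalIncl A) = NonUnitalStarAlgHom.id ℂ ℂ :=
    NonUnitalStarAlgHom.ext fun r => scal_scalIncl (A := A) r
  have h1 := CTensor.map_comp (B := Compacts) (scal A) (scalIncl A) y
  rw [h] at h1
  exact h1.symm.trans (CTensor.map_id y)

theorem truncProj_map_scal (n : ℕ) :
    (truncProj (UStab A) n).map (Stab.map (scal A)) = truncProj ℂ n := by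
  refine Subtype.ext ?_
  show Stab.map (scal A) (stabTmul 1 (ctrunc n)) = stabTmul 1 (ctrunc n)
  have h : scal A 1 = 1 := rfl
  rw [stabMap_stabTmul, h]

theorem stabMap_scal_diag (N m : ℕ) : Stab.map (scal A) ((stdFrame A N).diag m) = 0 := by
  rw [Frame.diag, stabMap_stabTmul, scal_apply, stdFrame_e, Unitization.fst_inr, map_zero]; rfl

theorem Frame.stabTmul_sub_mul_diag {D : Type u} [CStarAlgebra D] (F : Frame D) (m : ℕ) (b : D)
    (k : Compacts) : stabTmul b k - stabTmul b k * F.diag m =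
      stabTmul (b - b * F.e) k + stabTmul (b * F.e) (k - k * ctrunc m) := by
  rw [Frame.diag, stabTmul_mul, stabTmul_sub_left, map_sub]
  abel

theorem tendsto_mul_ctrunc (k : Compacts) : Tendsto (fun n => k * ctrunc n) atTop (𝓝 k) := by
  have h := (tendsto_ctrunc_mul (star k)).star
  rw [star_star] at h
  refine h.congr fun n => ?_
  rw [star_mul, star_star, (isStarProjection_ctrunc n).isSelfAdjoint.star_eq]

/-- A single index N controls both factors: e_N approximates the unit on A ⊗ 𝒦 and `ctrunc N`
approximates it on the outer copy of 𝒦. -/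
theorem tendsto_stabTmul_inr_sub_mul_diag (b : Stab A) (k : Compacts) :
    Tendsto (fun N => stabTmul (b : UStab A) k - stabTmul (b : UStab A) k * (stdFrame A N).diag N)
      atTop (𝓝 0) := by
  have h1 := (tendsto_iff_norm_sub_tendsto_zero.1 (tendsto_mul_oneTmul b)).mul_const ‖k‖
  have h2 := (tendsto_iff_norm_sub_tendsto_zero.1 (tendsto_mul_ctrunc k)).const_mul ‖b‖
  have h3 := h1.add h2
  rw [zero_mul, mul_zero, add_zero] at h3
  refine squeeze_zero_norm (fun N => ?_) h3
  rw [Frame.stabTmul_sub_mul_diag]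
  refine (norm_add_le _ _).trans (add_le_add ((norm_stabTmul_le _ _).trans ?_)
    ((norm_stabTmul_le _ _).trans ?_))
  · rw [stdFrame_e, ← Unitization.inr_mul, ← Unitization.inr_sub, Unitization.norm_inr, norm_sub_rev]
  · rw [norm_sub_rev]
    refine mul_le_mul_of_nonneg_right ((norm_mul_le _ _).trans ?_) (norm_nonneg _)
    rw [Unitization.norm_inr]
    exact mul_le_of_le_one_right (norm_nonneg _) (norm_stdFrame_e_le N)

/-- The projection onto the complement of the scalar part. -/
def removeScal (A : Type u) [CStarAlgebra A] : Stab (UStab A) →+ Stab (UStab A) :=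
  AddMonoidHom.mk' (fun y => y - Stab.map (scalIncl A) (Stab.map (scal A) y)) fun y z => by
    rw [map_add, map_add]; abel

theorem norm_removeScal_le (y : Stab (UStab A)) : ‖removeScal A y‖ ≤ 2 * ‖y‖ := by
  have h : ‖Stab.map (scalIncl A) (Stab.map (scal A) y)‖ ≤ ‖y‖ :=
    (NonUnitalStarAlgHom.norm_apply_le _ _).trans (NonUnitalStarAlgHom.norm_apply_le _ _)
  have h1 := norm_sub_le y (Stab.map (scalIncl A) (Stab.map (scal A) y))
  show ‖y - Stab.map (scalIncl A) (Stab.map (scal A) y)‖ ≤ _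
  linarith

theorem removeScal_stabTmul (r : ℂ) (b : Stab A) (k : Compacts) :
    removeScal A (stabTmul ((Unitization.inl r : UStab A) + (b : UStab A)) k) =
      stabTmul (b : UStab A) k := by
  show _ - Stab.map (scalIncl A) (Stab.map (scal A) _) = _
  have h : scalIncl A (scal A ((Unitization.inl r : UStab A) + (b : UStab A))) =
      Unitization.inl r := by
    rw [scal_apply, Unitization.fst_add, Unitization.fst_inl, Unitization.fst_inr, add_zero]
    rfl
  rw [stabMap_stabTmul, stabMap_stabTmul, h, stabTmul_add_left]
  exact add_sub_cancel_left _ _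

/-- Matrices without scalar part are asymptotically fixed by the projections `e ⊗ trunc N`. -/
theorem tendsto_sub_mul_diag {y : Stab (UStab A)} (hy : Stab.map (scal A) y = 0) :
    Tendsto (fun N => y - y * (stdFrame A N).diag N) atTop (𝓝 0) := by
  let T : ℕ → Stab (UStab A) →+ Stab (UStab A) := fun N =>
    removeScal A - (AddMonoidHom.mulRight ((stdFrame A N).diag N)).comp (removeScal A)
  have hT : ∀ N z, T N z = removeScal A z - removeScal A z * (stdFrame A N).diag N :=
    fun _ _ => rfl
  -- The bound 4 is 2 + 2: `removeScal` has norm at most 2, and multiplication by a projection does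
  -- not increase the norm.
  have key := tendsto_zero_of_stabTmul T 4 (fun N z => ?_) (fun a k => ?_) y
  · refine key.congr fun N => ?_
    have h : removeScal A y = y := by
      show y - Stab.map (scalIncl A) (Stab.map (scal A) y) = y
      rw [hy, map_zero, sub_zero]
    rw [hT, h]
  · rw [hT]
    have h1 := norm_removeScal_le z
    have h2 : ‖removeScal A z * (stdFrame A N).diag N‖ ≤ ‖removeScal A z‖ :=
      (norm_mul_le _ _).trans (mul_le_of_le_one_right (norm_nonneg _) (norm_diag_le N N))
    linarith [norm_sub_le (removeScal A z) (removeScal A z * (stdFrame A N).diag N)]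
  · induction a using Unitization.ind with | _ r b
    refine (tendsto_stabTmul_inr_sub_mul_diag b k).congr fun N => ?_
    rw [hT, removeScal_stabTmul]

end Scalars

/-! ### The kernel of the scalar projection comes from A ⊗ 𝒦 -/

section Surjective

variable {A : Type u} [CStarAlgebra A]

/-- Without scalar part, Q is almost below e_N ⊗ 1_N for large N, hence equivalent to some R below
it. Then `row N * R` is a partial isometry from R to a projection in the e₀₀-corner whose entry has
no scalar part. -/
theorem V.exists_stabIncl_of_map_eq_zero (Q : Proj (Stab (UStab A)))
    (hQ : Stab.map (scal A) (Q : Stab (UStab A)) = 0) :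
    ∃ p : Proj (Stab A), V.mk Q = V.mk (p.map (stabIncl A)) := by
  obtain ⟨N, hN⟩ := ((tendsto_zero_iff_norm_tendsto_zero.1
    (tendsto_sub_mul_diag hQ)).eventually_le_const (show (0 : ℝ) < 1 / 4 by norm_num)).exists
  set F := stdFrame A N with hF
  have hd := F.isStarProjection_diag N
  have hN' : ‖(Q : Stab (UStab A)) - F.diag N * Q‖ ≤ 1 / 4 := by
    rw [← norm_star, star_sub, star_mul, Q.2.isSelfAdjoint.star_eq, hd.isSelfAdjoint.star_eq]
    exact hN
  obtain ⟨R, hQR, hR⟩ := exists_uequiv_le Q hd hN'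
  have hR' : (R : Stab (UStab A)) * F.diag N = R := by
    have := congrArg star hR
    rwa [star_mul, R.2.isSelfAdjoint.star_eq, hd.isSelfAdjoint.star_eq] at this
  have hRR : (R : Stab (UStab A)) * R = R := R.2.isIdempotentElem
  obtain ⟨p, hp⟩ := exists_toBase_eq_inr A N N R.2 (hR.trans hR'.symm)
  refine ⟨p, ?_⟩
  rw [V.mk_eq_mk.2 hQR]
  refine V.mk_eq_of_mul (v := F.row N * R) ?_ ?_
  · rw [star_mul, R.2.isSelfAdjoint.star_eq, mul_assoc, ← mul_assoc (star (F.row N)),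
      F.star_row_mul_row, hR, hRR]
  · rw [star_mul, R.2.isSelfAdjoint.star_eq, ← mul_assoc, mul_assoc (F.row N), hRR,
      ← F.cornerHom_toBase, hp]
    rfl

theorem K0.map_of {B C : Type*} [CStarAlgebra B] [CStarAlgebra C] (φ : B →⋆ₐ[ℂ] C) (x : V B) :
    K0.map φ (Algebra.GrothendieckAddGroup.of x) = Algebra.GrothendieckAddGroup.of (V.map φ x) := by
  induction x using V.ind with | _ p
  exact K0.map_mk φ p

/-- Every element of `K₀(A ⊗ 𝒦)` is the difference of a projection and a trivial one with the same
scalar part. -/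
theorem K0.exists_add_trunc {x : K0 (UStab A)} (hx : K0.map (scalarHom (Stab A)) x = 0) :
    ∃ (n : ℕ) (R : Proj (Stab (UStab A))), x + K0.mk (truncProj (UStab A) n) = K0.mk R ∧
      UEquiv (R.map (Stab.map (scal A))) (truncProj ℂ n) := by
  have htr : ∀ n, V.map (scalarHom (Stab A)) (V.mk (truncProj (UStab A) n)) =
      V.mk (truncProj ℂ n) := fun n => congrArg V.mk (truncProj_map_scal n)
  obtain ⟨y, z, h⟩ := K0.exists_add_of x
  obtain ⟨n, y', hy'⟩ := V.exists_add_eq_trunc y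
  have h1 : x + Algebra.GrothendieckAddGroup.of (V.mk (truncProj (UStab A) n)) =
      Algebra.GrothendieckAddGroup.of (z + y') := by
    rw [← hy', map_add, map_add, ← h, add_assoc]
  have h2 := congrArg (K0.map (scalarHom (Stab A))) h1
  rw [map_add, hx, zero_add, K0.map_of, K0.map_of, htr, K0.of_eq_of_iff] at h2
  obtain ⟨c, hc⟩ := h2
  -- The class c needed for cancellation over ℂ is absorbed in a truncation of size m, which lifts
  -- to D and can be added to both sides there; the sizes m and n add up.
  obtain ⟨m, c', hc'⟩ := V.exists_add_eq_trunc c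
  have h3 : V.map (scalarHom (Stab A)) (V.mk (truncProj (UStab A) m) + (z + y')) =
      V.mk (truncProj ℂ (m + n)) := by
    rw [map_add, htr, ← V.mk_truncProj_add, ← hc', add_comm c, add_assoc, add_assoc, hc]
  have h4 : x + Algebra.GrothendieckAddGroup.of (V.mk (truncProj (UStab A) (m + n))) =
      Algebra.GrothendieckAddGroup.of (V.mk (truncProj (UStab A) m) + (z + y')) := by
    rw [← V.mk_truncProj_add, map_add, map_add, ← h1, add_left_comm]
  generalize V.mk (truncProj (UStab A) m) + (z + y') = w at h3 h4
  induction w using V.ind with | _ R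
  exact ⟨m + n, R, h4, V.mk_eq_mk.1 h3⟩

/-- The splitting ψ lifts the implementing unitary, and conjugation by the lift makes the image
exactly q. For the scalar projection this normalizes the scalar part of a projection. -/
theorem exists_uequiv_map_eq {B : Type u} {C : Type v} [NonUnitalCStarAlgebra B]
    [NonUnitalCStarAlgebra C] {φ : B →⋆ₙₐ[ℂ] C} {ψ : C →⋆ₙₐ[ℂ] B} (h : ∀ y, φ (ψ y) = y)
    {p : Proj B} {q : Proj C} (hpq : UEquiv (p.map φ) q) :
    ∃ r : Proj B, UEquiv p r ∧ r.map φ = q := by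
  obtain ⟨w, hw, hq⟩ := hpq.symm
  have hw' := Unitary.map_mem (Unitization.starMap ψ) hw
  obtain ⟨r, hr⟩ := exists_conj p hw'
  refine ⟨r, UEquiv.symm ⟨_, hw', hr⟩, Subtype.ext (Unitization.inr_injective (R := ℂ) ?_)⟩
  have hid : ∀ y, Unitization.starMap φ (Unitization.starMap ψ y) = y := fun y => by
    have hc : φ.comp ψ = NonUnitalStarAlgHom.id ℂ C := NonUnitalStarAlgHom.ext h
    rw [← StarAlgHom.comp_apply, ← Unitization.starMap_comp, hc, Unitization.starMap_id]
    rfl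
  have := congrArg (Unitization.starMap φ) hr
  rw [map_mul, map_mul, map_star, hid, Unitization.starMap_inr, Unitization.starMap_inr] at this
  exact this.trans hq.symm

theorem sub_mul_eq_of_mul_eq_zero {B : Type*} [NonUnitalRing B] {r e f p : B} (hp : e * p = p)
    (hf : f * p = 0) : p - r * p = -((r - e - (r - e) * f) * p) := by
  rw [sub_mul, mul_assoc _ f, hf, mul_zero, sub_mul, hp]; abel

namespace Frame

variable {D : Type u} [CStarAlgebra D] (F : Frame D)

/-- The diagonal matrix with entries `e`, as a projection. -/
def diagProj (n : ℕ) : Proj (Stab D) := ⟨F.diag n, F.isStarProjection_diag n⟩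

theorem truncProj_mul_diagProj (n : ℕ) :
    (truncProj D n : Stab D) * F.diagProj n = F.diagProj n := by
  show stabTmul 1 (ctrunc n) * stabTmul F.e (ctrunc n) = stabTmul F.e (ctrunc n)
  rw [stabTmul_mul, one_mul, (isStarProjection_ctrunc n).isIdempotentElem.eq]

/-- The diagonal matrix with `n` entries `1 - e`, as a projection. -/
def coProj (n : ℕ) : Proj (Stab D) :=
  (truncProj D n).sub (F.diagProj n) (F.truncProj_mul_diagProj n)

theorem coe_coProj (n : ℕ) : (F.coProj n : Stab D) = truncProj D n - F.diag n := rfl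

theorem truncProj_mul_coProj (n : ℕ) : (truncProj D n : Stab D) * F.coProj n = F.coProj n := by
  have h : (truncProj D n : Stab D) * F.diag n = F.diag n := F.truncProj_mul_diagProj n
  rw [coe_coProj, mul_sub, h, (truncProj D n).2.isIdempotentElem.eq]

theorem diag_mul_coProj (n N : ℕ) : F.diag N * (F.coProj n : Stab D) = 0 := by
  show stabTmul F.e (ctrunc N) * (stabTmul 1 (ctrunc n) - stabTmul F.e (ctrunc n)) = 0
  rw [mul_sub, stabTmul_mul, stabTmul_mul, mul_one, F.isStarProjection_e.isIdempotentElem.eq,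
    sub_self]

/-- (1 − e) ⊗ 1_n is fixed by 1_n and annihilated by e ⊗ 1_N. Since R − 1_n is nearly unchanged
under right multiplication by e ⊗ 1_N, it is small on (1 − e) ⊗ 1_n, which is therefore nearly below
R. -/
theorem exists_uequiv_coProj {R : Proj (Stab D)} {n N : ℕ}
    (h : ‖(R : Stab D) - truncProj D n - (R - truncProj D n) * F.diag N‖ ≤ 1 / 4) :
    ∃ G : Proj (Stab D), UEquiv (F.coProj n) G ∧ (R : Stab D) * G = G := by
  refine exists_uequiv_le _ R.2 ?_
  rw [sub_mul_eq_of_mul_eq_zero (F.truncProj_mul_coProj n) (F.diag_mul_coProj n N), norm_neg]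
  exact (norm_mul_le _ _).trans ((mul_le_of_le_one_right (norm_nonneg _)
    (IsStarProjection.norm_le _ (F.coProj n).2)).trans h)

end Frame

theorem exists_uequiv_coProj_le {R : Proj (Stab (UStab A))} {n : ℕ}
    (hR : R.map (Stab.map (scal A)) = truncProj ℂ n) :
    ∃ (N : ℕ) (G : Proj (Stab (UStab A))), UEquiv ((stdFrame A N).coProj n) G ∧
      (R : Stab (UStab A)) * G = G := by
  have hRE : Stab.map (scal A) ((R : Stab (UStab A)) - truncProj (UStab A) n) = 0 := by
    rw [map_sub, sub_eq_zero]
    exact congrArg Subtype.val (hR.trans (truncProj_map_scal n).symm)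
  obtain ⟨N, hN⟩ := ((tendsto_zero_iff_norm_tendsto_zero.1
    (tendsto_sub_mul_diag hRE)).eventually_le_const (show (0 : ℝ) < 1 / 4 by norm_num)).exists
  exact ⟨N, (stdFrame A N).exists_uequiv_coProj hN⟩

theorem coProj_map_scal (N n : ℕ) :
    ((stdFrame A N).coProj n).map (Stab.map (scal A)) = truncProj ℂ n := by
  refine Subtype.ext ?_
  show Stab.map (scal A) ((stdFrame A N).coProj n : Stab (UStab A)) = _
  rw [Frame.coe_coProj, map_sub, stabMap_scal_diag, sub_zero]
  exact congrArg Subtype.val (truncProj_map_scal n)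

/-- The scalar part of G is equivalent to that of (1 − e) ⊗ 1_n, which is 1_n, and it lies below
that of R, again 1_n; finiteness of matrix algebras leaves only equality. -/
theorem map_scal_eq_of_uequiv_coProj {R G : Proj (Stab (UStab A))} {n N : ℕ}
    (hR : R.map (Stab.map (scal A)) = truncProj ℂ n) (hG : UEquiv ((stdFrame A N).coProj n) G)
    (hRG : (R : Stab (UStab A)) * G = G) : G.map (Stab.map (scal A)) = truncProj ℂ n := by
  refine eq_truncProj_of_uequiv (coProj_map_scal (A := A) N n ▸ hG.map _) ?_
  rw [← coe_truncProj, ← hR]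
  show Stab.map (scal A) R * Stab.map (scal A) G = Stab.map (scal A) G
  rw [← map_mul, hRG]

/-- [R] = [G] + [R − G] and [1_n] = [e ⊗ 1_n] + [(1 − e) ⊗ 1_n], where G is equivalent to (1 − e) ⊗
1_n. The summands R − G and e ⊗ 1_n have no scalar part, so they come from A ⊗ 𝒦. -/
theorem V.exists_stabIncl_add {R : Proj (Stab (UStab A))} {n : ℕ}
    (hR : R.map (Stab.map (scal A)) = truncProj ℂ n) :
    ∃ p q : Proj (Stab A), V.mk R + V.mk (q.map (stabIncl A)) =
      V.mk (p.map (stabIncl A)) + V.mk (truncProj (UStab A) n) := by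
  obtain ⟨N, G, hG, hRG⟩ := exists_uequiv_coProj_le hR
  have hπG := map_scal_eq_of_uequiv_coProj hR hG hRG
  have hπ : Stab.map (scal A) ((R.sub G hRG : Proj (Stab (UStab A))) : Stab (UStab A)) = 0 := by
    show Stab.map (scal A) ((R : Stab (UStab A)) - G) = 0
    rw [map_sub, sub_eq_zero]
    exact congrArg Subtype.val (hR.trans hπG.symm)
  obtain ⟨p, hp⟩ := V.exists_stabIncl_of_map_eq_zero _ hπ
  obtain ⟨q, hq⟩ := V.exists_stabIncl_of_map_eq_zero ((stdFrame A N).diagProj n)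
    (stabMap_scal_diag N n)
  have e1 := V.mk_add_mk_sub hRG
  have e2 := V.mk_add_mk_sub ((stdFrame A N).truncProj_mul_diagProj n)
  have e3 : V.mk ((stdFrame A N).coProj n) = V.mk G := V.mk_eq_mk.2 hG
  refine ⟨p, q, ?_⟩
  rw [← hp, ← hq, ← e1, ← e2, ← e3, Frame.coProj]
  abel

theorem mem_range_K0stabIncl {x : K0 (UStab A)} (hx : K0.map (scalarHom (Stab A)) x = 0) :
    ∃ y, K0stabIncl A y = x := by
  obtain ⟨n, R₀, hxR, hR₀⟩ := K0.exists_add_trunc hx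
  obtain ⟨R, hR₀R, hR⟩ := exists_uequiv_map_eq stabMap_scal_scalIncl hR₀
  obtain ⟨p, q, hpq⟩ := V.exists_stabIncl_add hR
  refine ⟨K0.mk p - K0.mk q, ?_⟩
  have h := congrArg (fun y : V (UStab A) => (Algebra.GrothendieckAddGroup.of y : K0 (UStab A))) hpq
  simp only [map_add, ← K0.mk_eq_of] at h
  have hRR : K0.mk R₀ = K0.mk R := K0.mk_congr hR₀R
  rw [map_sub, K0stabIncl_mk, K0stabIncl_mk, sub_eq_iff_eq_add]
  rw [← hRR, ← hxR, add_right_comm] at h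
  exact (add_right_cancel h).symm

end Surjective

/-! ### The stability isomorphism and its naturality -/

section Stability

variable (A : Type u) [CStarAlgebra A]

theorem map_scalarHom_K0stabIncl (y : K0 A) :
    K0.map (scalarHom (Stab A)) (K0stabIncl A y) = 0 := by
  suffices h : (K0.map (scalarHom (Stab A))).comp (K0stabIncl A) = 0 from DFunLike.congr_fun h y
  refine K0.hom_ext fun p => ?_
  rw [AddMonoidHom.comp_apply, K0stabIncl_mk, K0.map_mk, AddMonoidHom.zero_apply, K0.mk_eq_of]
  have h : (p.map (stabIncl A)).map (Stab.map (scal A)) = V.zeroProj _ := by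
    refine Subtype.ext ?_
    show Stab.map (scal A) (cornerHom (UStab A) ((p : Stab A) : UStab A)) = 0
    rw [stabMap_cornerHom, scal_apply, Unitization.fst_inr, map_zero]
  exact (congrArg (fun q => Algebra.GrothendieckAddGroup.of (V.mk q)) h).trans (map_zero _)

/-- Stability of operator `K₀`. -/
def stabEquiv : K0 A ≃+ K0nu (Stab A) :=
  AddEquiv.ofBijective ((K0stabIncl A).codRestrict (K0nu (Stab A)) (map_scalarHom_K0stabIncl A))
    ⟨fun _ _ h => K0stabIncl_injective (congrArg Subtype.val h), fun x => by
      obtain ⟨y, hy⟩ := mem_range_K0stabIncl x.2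
      exact ⟨y, Subtype.ext hy⟩⟩

theorem coe_stabEquiv (y : K0 A) : (stabEquiv A y : K0 (UStab A)) = K0stabIncl A y := rfl

variable {A}

theorem map_stabEquiv {B : Type u} [CStarAlgebra B] (φ : A →⋆ₐ[ℂ] B) (y : K0 A) :
    K0nu.map (Stab.map (φ : A →⋆ₙₐ[ℂ] B)) (stabEquiv A y) = stabEquiv B (K0.map φ y) := by
  refine Subtype.ext ?_
  rw [K0nu.coe_map, coe_stabEquiv, coe_stabEquiv]
  suffices h : (K0.map (Unitization.starMap (Stab.map (φ : A →⋆ₙₐ[ℂ] B)))).comp (K0stabIncl A) =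
    (K0stabIncl B).comp (K0.map φ) from DFunLike.congr_fun h y
  refine K0.hom_ext fun p => ?_
  rw [AddMonoidHom.comp_apply, AddMonoidHom.comp_apply, K0stabIncl_mk, K0.map_mk, K0.map_mk,
    K0stabIncl_mk]
  refine congrArg K0.mk (Subtype.ext ?_)
  refine (stabMap_cornerHom _ _).trans (congrArg (cornerHom (UStab B)) ?_)
  exact Unitization.starMap_inr ..

end Stability

end OpK

end

theorem mainTheorem1 :
    (∃ θ : ∀ (A : Type u) [CStarAlgebra A], OpK.K0nu (OpK.Stab A) ≃+ OpK.K0 A,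
      ∀ (A B : Type u) [CStarAlgebra A] [CStarAlgebra B] (φ : A →⋆ₐ[ℂ] B)
        (x : OpK.K0nu (OpK.Stab A)),
        θ B (OpK.K0nu.map (OpK.Stab.map (φ : A →⋆ₙₐ[ℂ] B)) x) = OpK.K0.map φ (θ A x)) ∧
    (∃ η : ∀ (A : Type u) [CStarAlgebra A], OpK.K0 A ≃+ OpK.Kfnu (OpK.Stab A),
      (∀ (A B : Type u) [CStarAlgebra A] [CStarAlgebra B] (φ : A →⋆ₐ[ℂ] B) (x : OpK.K0 A),
        η B (OpK.K0.map φ x) = OpK.Kfnu.map (OpK.Stab.map (φ : A →⋆ₙₐ[ℂ] B)) (η A x)) ∧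
      ∀ (A : Type u) [CStarAlgebra A] (P Q : OpK.Proj (OpK.Stab A)),
        (η A (OpK.K0.mk P - OpK.K0.mk Q) : OpK.Kf (Unitization ℂ (OpK.Stab A))) =
          OpK.Kf.projInr P - OpK.Kf.projInr Q) := by
  refine ⟨⟨fun A _ => (OpK.stabEquiv A).symm, fun A B _ _ φ x => ?_⟩,
    ⟨fun A _ => OpK.eta A, fun A B _ _ φ x => OpK.eta_map φ x, fun A _ P Q => ?_⟩⟩
  -- θ is the inverse of the map induced by the corner embedding, so its naturality is that of the
  -- embedding.
  · rw [AddEquiv.symm_apply_eq, ← OpK.map_stabEquiv, AddEquiv.apply_symm_apply]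
  · rw [OpK.coe_eta, map_sub, OpK.etaHom_mk, OpK.etaHom_mk]
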